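/- Let $n\ge 1$ and let $\mathbb{L}^{(D)}$, $D=n+5$, be flat space-time with coordinates $(t,x_1,\dots,x_{D-1})$ and metric $g=-dt^2+\sum_q dx_q^2$. Let $X:M\to\mathbb{R}^3$ be a connected, smoothly immersed minimal surface (self-intersections are allowed). The associated static (Type I) worldvolume is $\mathbb{R}\times M$, mapped to $\mathbb{L}^{(D)}$ by $(\tau,p)\mapsto(t,x)=(\tau,X(p),0,\dots,0)$. In worldvolume coordinates $\sigma^a$ with mapping functions $Y^\mu(\sigma)$, the induced metric is $\gamma_{ab}=g(\partial_aY,\partial_bY)$; for an orthonormal frame $n^i$ of the normal space the extrinsic curvature is $K_{ab}{}^i=g(n^i,\partial_a\partial_bY)$, and $K^i=\gamma^{ab}K_{ab}{}^i$. The worldvolume is called stationary with respect to a Killing vector field $k$ of $\mathbb{L}^{(D)}$ if, along the worldvolume, $k$ is the image of a worldvolume vector field $\mathbf{k}^a\partial_a=\partial_\tau+\chi$, where $\chi$ is tangent to the surface $M$ and not identically zero (for instance $\chi=\Omega\,\partial_\phi$, $\Omega\neq0$, induced by a rotation, a translation (boost) or a screw motion of $\mathbb{R}^3$). Where $\mathbf{k}^2:=-\gamma_{ab}\mathbf{k}^a\mathbf{k}^b>0$,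 put $u^a=\mathbf{k}^a/\mathbf{k}$. The blackfold equations are $$K^i=n\,u^au^bK_{ab}{}^i \quad\text{for all } i,$$ together with the condition $\mathbf{k}=0$ on the boundary of the worldvolume, if there is one. 1. Let the worldvolume of $X$ be stationary with respect to $k$, and let $W\subseteq M$ be a non-empty open set on which $\mathbf{k}^2>0$. Then $K^i=n\,u^au^bK_{ab}{}^i$ holds on $\mathbb{R}\times W$ if and only if $X(M)$ lies on a plane or on a helicoid, i.e. if and only if, up to an isometry of $\mathbb{R}^3$, $X(M)$ is contained in the plane $\{x_3=0\}$ or in the helicoid $\{(\rho\cos a\phi,\rho\sin a\phi,\lambda\phi):\rho,\phi\in\mathbb{R}\}$ for some $a,\lambda>0$. 2. Both surfaces occur: * for every $\Omega\ne0$, the plane $\{x_3=0\}$ is a minimal surface whose worldvolume is stationary with respect to $k=\partial_t+\Omega(x_1\partial_{x_2}-x_2\partial_{x_1})$; * for all $a,\lambda>0$ and $\Omega\ne0$ with $\Omega^2\lambda^2<1$, the helicoid $(\rho\cos a\phi,\rho\sin a\phi,\lambda\phi)$ is a minimal surface whose worldvolume is stationary with respect to $k=\partial_t+a\Omega(x_1\partial_{x_2}-x_2\partial_{x_1})+\lambda\Omega\,\partial_{x_3}$.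 In both cases the region where $\mathbf{k}^2>0$ is non-empty, the equation $K^i=n\,u^au^bK_{ab}{}^i$ holds on it, and $\mathbf{k}=0$ on its boundary. -/

import Mathlib

open scoped Manifold ContDiff

/-! ### Submanifolds of flat (pseudo-)Euclidean space, in coordinates

Points of a flat ambient space are coordinate tuples `ι → ℝ` with respect to global Cartesian
coordinates, in which the metric is the constant diagonal matrix with entries `η μ = ± 1`
(so that all Christoffel symbols vanish). Only the topology and the smooth structure of
`ι → ℝ` are used; all lengths and angles are measured with `η`. A piece of a submanifold is
given by mapping functions `Y : (α → ℝ) → (ι → ℝ)` of coordinates indexed by `α`. -/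

section FlatGeometry

/-- The flat metric `g(v, w) = ∑ μ, η μ v^μ w^μ`. -/
def flatMetric {ι : Type} [Fintype ι] (η : ι → ℝ) (v w : ι → ℝ) : ℝ :=
  ∑ μ, η μ * v μ * w μ

/-- The tangent vector `∂_a Y` at the point with coordinates `s`. -/
noncomputable def tangentVector {α ι : Type} [Fintype α] [DecidableEq α] [Fintype ι]
    (Y : (α → ℝ) → (ι → ℝ)) (s : α → ℝ) (a : α) : ι → ℝ :=
  fderiv ℝ Y s (Pi.single a 1)

/-- The second derivative `∂_a ∂_b Y` at the point with coordinates `s`. -/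
noncomputable def secondDerivative {α ι : Type} [Fintype α] [DecidableEq α] [Fintype ι]
    (Y : (α → ℝ) → (ι → ℝ)) (s : α → ℝ) (a b : α) : ι → ℝ :=
  fderiv ℝ (fun s' => tangentVector Y s' b) s (Pi.single a 1)

/-- The induced metric `γ_ab = g(∂_a Y, ∂_b Y)`. -/
noncomputable def inducedMetric {α ι : Type} [Fintype α] [DecidableEq α] [Fintype ι]
    (η : ι → ℝ) (Y : (α → ℝ) → (ι → ℝ)) (s : α → ℝ) : Matrix α α ℝ :=
  Matrix.of fun a b => flatMetric η (tangentVector Y s a) (tangentVector Y s b)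

/-- The vector `ν` is normal to the submanifold at the point with coordinates `s`. -/
def IsNormalVector {α ι : Type} [Fintype α] [DecidableEq α] [Fintype ι]
    (η : ι → ℝ) (Y : (α → ℝ) → (ι → ℝ)) (s : α → ℝ) (ν : ι → ℝ) : Prop :=
  ∀ a, flatMetric η ν (tangentVector Y s a) = 0

/-- The component of the extrinsic curvature tensor along the normal vector `ν`,
`K_ab = g(ν, ∂_a ∂_b Y)` (there is no Christoffel term in Cartesian coordinates). -/
noncomputable def extrinsicCurvature {α ι : Type} [Fintype α] [DecidableEq α] [Fintype ι]
    (η : ι → ℝ) (Y : (α → ℝ) → (ι → ℝ)) (s : α → ℝ) (ν : ι → ℝ) : Matrix α α ℝ :=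
  Matrix.of fun a b => flatMetric η ν (secondDerivative Y s a b)

/-- The component `K = γ^{ab} K_ab` of the mean extrinsic curvature along `ν`. -/
noncomputable def meanCurvature {α ι : Type} [Fintype α] [DecidableEq α] [Fintype ι]
    (η : ι → ℝ) (Y : (α → ℝ) → (ι → ℝ)) (s : α → ℝ) (ν : ι → ℝ) : ℝ :=
  ∑ a, ∑ b, (inducedMetric η Y s)⁻¹ a b * extrinsicCurvature η Y s ν a b

/-- A Killing vector field of the flat ambient space: a smooth vector field with
`∂_μ k_ν + ∂_ν k_μ = 0`. -/
def IsKillingField {ι : Type} [Fintype ι] (η : ι → ℝ) (k : (ι → ℝ) → (ι → ℝ)) : Prop :=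
  ContDiff ℝ ∞ k ∧
    ∀ x v w, flatMetric η (fderiv ℝ k x v) w + flatMetric η v (fderiv ℝ k x w) = 0

end FlatGeometry

/-! ### Minimal surfaces in Euclidean three-space -/

/-- `X : M → ℝ³` is a (smoothly immersed) minimal surface: its mean extrinsic curvature with
respect to the Euclidean metric vanishes along every normal vector, in every coordinate chart. -/
structure IsMinimalSurface {M : Type*} [TopologicalSpace M] [ChartedSpace (Fin 2 → ℝ) M]
    (X : M → (Fin 3 → ℝ)) : Prop where
  smooth : ContMDiff 𝓘(ℝ, Fin 2 → ℝ) 𝓘(ℝ, Fin 3 → ℝ) ∞ X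
  immersion : ∀ p : M,
    Function.Injective (mfderiv 𝓘(ℝ, Fin 2 → ℝ) 𝓘(ℝ, Fin 3 → ℝ) X p)
  minimal : ∀ e ∈ atlas (Fin 2 → ℝ) M, ∀ σ ∈ e.target, ∀ ν : Fin 3 → ℝ,
    IsNormalVector (fun _ => 1) (X ∘ e.symm) σ ν →
      meanCurvature (fun _ => 1) (X ∘ e.symm) σ ν = 0

/-! ### Static (Type I) worldvolumes in flat space-time -/

/-- Indices of the `D = n + 5` space-time coordinates: time, the three coordinates of the
`ℝ³` that contains the surface, and the remaining `D - 4 = n + 1` spatial coordinates. -/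
abbrev SpacetimeIndex (n : ℕ) : Type := Fin 1 ⊕ (Fin 3 ⊕ Fin (n + 1))

/-- Indices of the worldvolume coordinates `(τ, σ¹, σ²)`. -/
abbrev WorldvolumeIndex : Type := Fin 1 ⊕ Fin 2

/-- The metric `-dt² + ∑ (dx^q)²` of flat space-time. -/
def minkowski (n : ℕ) : SpacetimeIndex n → ℝ :=
  Sum.elim (fun _ => -1) (fun _ => 1)

/-- The space-time point `(t, x, 0)`, for `x ∈ ℝ³`. -/
def spacetimePoint (n : ℕ) (t : ℝ) (x : Fin 3 → ℝ) : SpacetimeIndex n → ℝ :=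
  Sum.elim (fun _ => t) (Sum.elim x (fun _ => 0))

/-- The worldvolume point with coordinates `(τ, σ)`. -/
def worldvolumePoint (τ : ℝ) (σ : Fin 2 → ℝ) : WorldvolumeIndex → ℝ :=
  Sum.elim (fun _ => τ) σ

/-- The Type I embedding `(τ, σ) ↦ (t, x, …) = (τ, x(σ), 0)` determined by the
(time-independent) mapping functions `x` of a surface in `ℝ³`. -/
def typeIEmbedding (n : ℕ) (x : (Fin 2 → ℝ) → (Fin 3 → ℝ)) :
    (WorldvolumeIndex → ℝ) → (SpacetimeIndex n → ℝ) :=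
  fun s => spacetimePoint n (s (Sum.inl 0)) (x fun a => s (Sum.inr a))

/-- The worldvolume vector field `∂_τ + χ^a ∂_a` at the point with coordinates `s`, with `χ`
tangent to the surface, is mapped to the value there of the ambient vector field `k`. -/
def PushesForwardTo (n : ℕ) (x : (Fin 2 → ℝ) → (Fin 3 → ℝ))
    (k : (SpacetimeIndex n → ℝ) → (SpacetimeIndex n → ℝ))
    (s : WorldvolumeIndex → ℝ) (χ : Fin 2 → ℝ) : Prop :=
  ∑ a, worldvolumePoint 1 χ a • tangentVector (typeIEmbedding n x) s a =
    k (typeIEmbedding n x s)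

/-- The Type I worldvolume `ℝ × M` over the surface `X : M → ℝ³` in flat space-time is made
stationary by `k`: `k` is a Killing vector field of the space-time and, along the worldvolume,
it is the image of a vector field `∂_τ + χ`, where `χ` (rotation and/or boost velocity, that is
`χ = Ω ∂_φ`) is tangent to the surface and does not vanish identically. -/
structure IsStationaryTypeI (n : ℕ) {M : Type*} [TopologicalSpace M]
    [ChartedSpace (Fin 2 → ℝ) M] (X : M → (Fin 3 → ℝ))
    (k : (SpacetimeIndex n → ℝ) → (SpacetimeIndex n → ℝ)) : Prop where
  killing : IsKillingField (minkowski n) k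
  tangent : ∀ e ∈ atlas (Fin 2 → ℝ) M, ∀ σ ∈ e.target, ∀ τ : ℝ, ∃ χ : Fin 2 → ℝ,
    PushesForwardTo n (X ∘ e.symm) k (worldvolumePoint τ σ) χ
  nonstatic : ∃ e ∈ atlas (Fin 2 → ℝ) M, ∃ σ ∈ e.target, ∃ τ : ℝ, ∃ χ : Fin 2 → ℝ,
    PushesForwardTo n (X ∘ e.symm) k (worldvolumePoint τ σ) χ ∧ χ ≠ 0

/-! ### The blackfold equations -/

/-- The squared modulus `-γ_ab k^a k^b` of the worldvolume vector `κ = k^a`. -/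
noncomputable def modulusSq (n : ℕ) (Y : (WorldvolumeIndex → ℝ) → (SpacetimeIndex n → ℝ))
    (s κ : WorldvolumeIndex → ℝ) : ℝ :=
  -∑ a, ∑ b, inducedMetric (minkowski n) Y s a b * κ a * κ b

/-- The squared modulus `-g(k, k)` of the ambient vector field `k` at the point `(τ, p)` of the
worldvolume `ℝ × M`; see `modulusSq_eq` for its agreement with `-γ_ab k^a k^b`. -/
def killingModulusSq (n : ℕ) {M : Type*} (X : M → (Fin 3 → ℝ))
    (k : (SpacetimeIndex n → ℝ) → (SpacetimeIndex n → ℝ)) (τ : ℝ) (p : M) : ℝ :=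
  -flatMetric (minkowski n) (k (spacetimePoint n τ (X p))) (k (spacetimePoint n τ (X p)))

/-- If the worldvolume vector `κ` is mapped to the ambient vector `v`, their squared moduli
agree. -/
theorem modulusSq_eq (n : ℕ) (Y : (WorldvolumeIndex → ℝ) → (SpacetimeIndex n → ℝ))
    (s κ : WorldvolumeIndex → ℝ) (v : SpacetimeIndex n → ℝ)
    (h : ∑ a, κ a • tangentVector Y s a = v) :
    modulusSq n Y s κ = -flatMetric (minkowski n) v v := by
  subst h
  simp only [modulusSq, inducedMetric, flatMetric, Matrix.of_apply, Finset.sum_apply,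
    Pi.smul_apply, smul_eq_mul, neg_inj, Finset.sum_mul, Finset.mul_sum]
  rw [Finset.sum_comm' (t' := Finset.univ) (s' := fun _ => Finset.univ) (by simp)]
  conv_rhs => rw [Finset.sum_comm]
  refine Finset.sum_congr rfl fun b _ => ?_
  rw [Finset.sum_comm]
  refine Finset.sum_congr rfl fun μ _ => Finset.sum_congr rfl fun a _ => ?_
  ring

/-- The equation `K^i = n u^a u^b K_ab^i` at the worldvolume point with coordinates `s`, for
`u^a = k^a / 𝐤` with `k^a = κ a` and `𝐤 = √(-γ_ab k^a k^b)`. The equation is linear in the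
normal vector, so that it is imposed along all normal vectors `ν`, and not only along the
members of an orthonormal frame of the normal space. -/
def BlackfoldEquationAt (n : ℕ) (Y : (WorldvolumeIndex → ℝ) → (SpacetimeIndex n → ℝ))
    (s κ : WorldvolumeIndex → ℝ) : Prop :=
  ∀ ν : SpacetimeIndex n → ℝ, IsNormalVector (minkowski n) Y s ν →
    meanCurvature (minkowski n) Y s ν =
      n * ∑ a, ∑ b, (κ a / √(modulusSq n Y s κ)) * (κ b / √(modulusSq n Y s κ)) *
        extrinsicCurvature (minkowski n) Y s ν a b

/-- The worldvolume `ℝ × W` solves the (extrinsic) blackfold equation, in every chart. -/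
def SolvesBlackfoldEquation (n : ℕ) {M : Type*} [TopologicalSpace M]
    [ChartedSpace (Fin 2 → ℝ) M] (X : M → (Fin 3 → ℝ))
    (k : (SpacetimeIndex n → ℝ) → (SpacetimeIndex n → ℝ)) (W : Set M) : Prop :=
  ∀ e ∈ atlas (Fin 2 → ℝ) M, ∀ σ ∈ e.target, e.symm σ ∈ W → ∀ (τ : ℝ) (χ : Fin 2 → ℝ),
    PushesForwardTo n (X ∘ e.symm) k (worldvolumePoint τ σ) χ →
      BlackfoldEquationAt n (typeIEmbedding n (X ∘ e.symm)) (worldvolumePoint τ σ)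
        (worldvolumePoint 1 χ)

/-- The part of the surface where the Killing vector field is timelike. -/
def timelikeRegion (n : ℕ) {M : Type*} (X : M → (Fin 3 → ℝ))
    (k : (SpacetimeIndex n → ℝ) → (SpacetimeIndex n → ℝ)) : Set M :=
  {p | ∀ τ : ℝ, 0 < killingModulusSq n X k τ p}

/-- The boundary condition `𝐤 = 0` on the boundary of the worldvolume `ℝ × W`. -/
def SatisfiesBoundaryCondition (n : ℕ) {M : Type*} [TopologicalSpace M] (X : M → (Fin 3 → ℝ))
    (k : (SpacetimeIndex n → ℝ) → (SpacetimeIndex n → ℝ)) (W : Set M) : Prop :=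
  ∀ p ∈ frontier W, ∀ τ : ℝ, killingModulusSq n X k τ p = 0

/-! ### The plane and the helicoid -/

/-- The standard plane in `ℝ³`. -/
def planeMap (s : Fin 2 → ℝ) : Fin 3 → ℝ := ![s 0, s 1, 0]

/-- The helicoid `(ρ, φ) ↦ (ρ cos (a φ), ρ sin (a φ), l φ)`, of pitch `l / a`. -/
noncomputable def helicoidMap (a l : ℝ) (s : Fin 2 → ℝ) : Fin 3 → ℝ :=
  ![s 0 * Real.cos (a * s 1), s 0 * Real.sin (a * s 1), l * s 1]

/-- The surface `X` lies on a plane, i.e. on the image of the standard plane under some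
isometry of Euclidean space. -/
def LiesOnPlane {M : Type*} (X : M → (Fin 3 → ℝ)) : Prop :=
  ∃ R ∈ Matrix.orthogonalGroup (Fin 3) ℝ, ∃ v : Fin 3 → ℝ,
    ∀ p, ∃ s, X p = R.mulVec (planeMap s) + v

/-- The surface `X` lies on a helicoid, i.e. on the image of a standard helicoid under some
isometry of Euclidean space. -/
def LiesOnHelicoid {M : Type*} (X : M → (Fin 3 → ℝ)) : Prop :=
  ∃ a l : ℝ, 0 < a ∧ 0 < l ∧ ∃ R ∈ Matrix.orthogonalGroup (Fin 3) ℝ, ∃ v : Fin 3 → ℝ,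
    ∀ p, ∃ s, X p = R.mulVec (helicoidMap a l s) + v

/-- The vector field `∂_t + α (x₁ ∂_{x₂} - x₂ ∂_{x₁}) + β ∂_{x₃}` of flat space-time. -/
def screwKillingField (n : ℕ) (α β : ℝ) :
    (SpacetimeIndex n → ℝ) → (SpacetimeIndex n → ℝ) :=
  fun y => spacetimePoint n 1
    ![-(α * y (Sum.inr (Sum.inl 1))), α * y (Sum.inr (Sum.inl 0)), β]

/-! A Killing field of flat space is affine, and it must have time component 1 along the
worldvolume. Either this is a nontrivial linear equation on `X`, so that the surface is planar, or
the Killing field restricts to `∂_t + V` with `V = w × x + b` a time-independent Killing field of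
`ℝ³` tangent to the surface (`IsStationaryTypeI.liesOnPlane_or_exists`).

On a Type I worldvolume the time direction carries no extrinsic curvature. Since the surface is
minimal and `n ≥ 1`, the blackfold equation therefore reduces to `K(V, V) = 0` for the second
fundamental form of the surface (`blackfoldEquationAt_iff`). Differentiating the tangency of `V`
identifies `K(V, V)` with the normal component of the acceleration `w × V`
(`IsPatch.acceleration_eq`), an expression free of charts.

The decisive fact is that `K(V, V)`, taken with a unit normal, is locally constant up to sign
(`IsPatch.killing_curvature_const`). Conceptually, the Hopf differential of a minimal surface
evaluated on `V` is a holomorphic function invariant under the flow of `V`, hence constant where `V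
≠ 0`. The proof here is a direct computation with the unnormalised normal `∂₀Y × ∂₁Y`
(`normal_component_derivative`, `sq_div_normSq_eq`). Hence vanishing at one point of `W` spreads to
the whole connected surface.

It remains to classify. If `w = 0`, the surface is translation invariant and minimal, so its second
fundamental form vanishes and it is planar. If `w ≠ 0`, move the axis of `V` to the `x₃`-axis: the
screw field `(-y, x, l)` and the radial field `(x, y, 0)` are both tangent. For `l = 0` this forces
the normal to be vertical. For `l ≠ 0`, horizontal coordinates that turn with the height are
constant along the screw field and scale along the radial field, so they map the surface locally
into a line through the origin, which is the equation of a helicoid (`liesOnHelicoid_of_screw`).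

Conversely, planes have `K = 0`. A Killing field tangent to an open piece of a helicoid must be a
screw field about its axis (`screw_of_tangent_helicoid`), and the acceleration of such a field
points along the rulings. -/

namespace Blackfold

open scoped Matrix Topology

/-! ### Killing fields of flat space -/

section Killing

variable {ι : Type} [Fintype ι] {η : ι → ℝ}

theorem flatMetric_comm (v w : ι → ℝ) : flatMetric η v w = flatMetric η w v :=
  Finset.sum_congr rfl fun _ _ => by ring

theorem flatMetric_single_right [DecidableEq ι] (v : ι → ℝ) (μ : ι) :
    flatMetric η v (Pi.single μ 1) = η μ * v μ := by
  simp [flatMetric, Pi.single_apply]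

theorem flatMetric_one (v w : ι → ℝ) : flatMetric (fun _ => 1) v w = v ⬝ᵥ w := by
  simp [flatMetric, dotProduct]

/-- The trilinear form `g(D²k(u, v), w)` is symmetric in `u, v` because second derivatives commute,
and antisymmetric in `v, w` by the differentiated Killing equation. Such a form is zero, and
nondegeneracy of `η` then gives `D²k = 0`. -/
theorem _root_.IsKillingField.fderiv_fderiv_eq_zero {k : (ι → ℝ) → (ι → ℝ)}
    (hk : IsKillingField η k) (hη : ∀ μ, η μ ≠ 0) (x : ι → ℝ) :
    fderiv ℝ (fderiv ℝ k) x = 0 := by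
  classical
  have hD : ContDiff ℝ 1 (fderiv ℝ k) := hk.1.fderiv_right (by norm_cast)
  have hD' : HasFDerivAt (fderiv ℝ k) (fderiv ℝ (fderiv ℝ k) x) x :=
    ((hD.differentiable one_ne_zero) x).hasFDerivAt
  set T := fderiv ℝ (fderiv ℝ k) x with hT
  have hsymm : ∀ u v, T u v = T v u := fun u v =>
    second_derivative_symmetric (𝕜 := ℝ)
      (fun y => ((hk.1.differentiable (by simp)) y).hasFDerivAt) hD' u v
  have hanti : ∀ u v w, flatMetric η (T u v) w + flatMetric η v (T u w) = 0 := by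
    intro u v w
    have hc : ∀ v μ, HasDerivAt (fun t : ℝ => fderiv ℝ k (x + t • u) v μ) (T u v μ) 0 := by
      intro v μ
      have h1 : HasDerivAt (fun t : ℝ => fderiv ℝ k (x + t • u)) (T u) 0 :=
        hD'.hasLineDerivAt u
      exact hasDerivAt_pi.1 (h1.clm_apply (hasDerivAt_const 0 v) |>.congr_deriv (by simp)) μ
    have h2 : HasDerivAt (fun t : ℝ => flatMetric η (fderiv ℝ k (x + t • u) v) w +
        flatMetric η v (fderiv ℝ k (x + t • u) w))
        (flatMetric η (T u v) w + flatMetric η v (T u w)) 0 := by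
      refine HasDerivAt.add ?_ ?_
      · exact HasDerivAt.fun_sum fun μ _ => ((hc v μ).const_mul (η μ)).mul_const (w μ)
      · exact HasDerivAt.fun_sum fun μ _ => (hc w μ).const_mul (η μ * v μ)
    have h3 : (fun t : ℝ => flatMetric η (fderiv ℝ k (x + t • u) v) w +
        flatMetric η v (fderiv ℝ k (x + t • u) w)) = fun _ => 0 := funext fun t => hk.2 _ _ _
    rw [h3] at h2
    exact h2.unique (hasDerivAt_const 0 0)
  refine ContinuousLinearMap.ext fun u => ContinuousLinearMap.ext fun v => funext fun μ => ?_
  have h : ∀ v w, flatMetric η (T u v) w = 0 := by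
    intro v w
    have e1 := hanti u v w
    have e2 := hanti w u v
    have e3 := hanti v w u
    rw [flatMetric_comm v] at e1
    rw [flatMetric_comm u] at e2
    rw [flatMetric_comm w] at e3
    rw [hsymm w v] at e2
    rw [hsymm w u] at e2
    rw [hsymm v u] at e3
    linarith
  have := h v (Pi.single μ 1)
  rw [flatMetric_single_right] at this
  simpa using (mul_eq_zero.1 this).resolve_left (hη μ)

theorem _root_.IsKillingField.exists_affine [DecidableEq ι] {k : (ι → ℝ) → (ι → ℝ)}
    (hk : IsKillingField η k) (hη : ∀ μ, η μ ≠ 0) :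
    ∃ (A : Matrix ι ι ℝ) (b : ι → ℝ), (∀ x, k x = A *ᵥ x + b) ∧
      ∀ μ ν, η μ * A μ ν + η ν * A ν μ = 0 := by
  have hD : ContDiff ℝ 1 (fderiv ℝ k) := hk.1.fderiv_right (by norm_cast)
  have hconst : ∀ x, fderiv ℝ k x = fderiv ℝ k 0 := fun x =>
    is_const_of_fderiv_eq_zero (hD.differentiable one_ne_zero)
      (hk.fderiv_fderiv_eq_zero hη) x 0
  have hdk : Differentiable ℝ k := hk.1.differentiable (by simp)
  refine ⟨LinearMap.toMatrix' (fderiv ℝ k 0 : (ι → ℝ) →ₗ[ℝ] (ι → ℝ)), k 0, fun x => ?_,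
    fun μ ν => ?_⟩
  · have h := is_const_of_fderiv_eq_zero (𝕜 := ℝ) (f := fun x => k x - fderiv ℝ k 0 x)
      (hdk.sub (fderiv ℝ k 0).differentiable) (fun y => by
        rw [fderiv_fun_sub (hdk y) (fderiv ℝ k 0).differentiableAt, hconst y]
        simp) x 0
    rw [LinearMap.toMatrix'_mulVec]
    simp only [map_zero, sub_zero] at h
    rw [← h]
    simp
  · have h := hk.2 0 (Pi.single ν 1) (Pi.single μ 1)
    rw [flatMetric_single_right, flatMetric_comm, flatMetric_single_right] at h
    simpa [LinearMap.toMatrix'_apply] using h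

end Killing

/-! ### Calculus along coordinate lines -/

section LineDerivatives

variable {U : Set (Fin 2 → ℝ)} {s : Fin 2 → ℝ}

theorem hasDerivAt_dotProduct {u v : ℝ → Fin 3 → ℝ} {u' v' : Fin 3 → ℝ} {t : ℝ}
    (hu : HasDerivAt u u' t) (hv : HasDerivAt v v' t) :
    HasDerivAt (fun t => u t ⬝ᵥ v t) (u' ⬝ᵥ v t + u t ⬝ᵥ v') t := by
  have h := HasDerivAt.fun_sum (u := Finset.univ) fun i (_ : i ∈ Finset.univ) =>
    (hasDerivAt_pi.1 hu i).fun_mul (hasDerivAt_pi.1 hv i)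
  simpa [dotProduct, Finset.sum_add_distrib] using h

theorem hasDerivAt_crossProduct {u v : ℝ → Fin 3 → ℝ} {u' v' : Fin 3 → ℝ} {t : ℝ}
    (hu : HasDerivAt u u' t) (hv : HasDerivAt v v' t) :
    HasDerivAt (fun t => crossProduct (u t) (v t))
      (crossProduct u' (v t) + crossProduct (u t) v') t := by
  have hu' := hasDerivAt_pi.1 hu
  have hv' := hasDerivAt_pi.1 hv
  rw [hasDerivAt_pi]
  intro i
  fin_cases i
  · exact (((hu' 1).fun_mul (hv' 2)).fun_sub ((hu' 2).fun_mul (hv' 1))).congr_deriv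
      (by simp [cross_apply]; ring)
  · exact (((hu' 2).fun_mul (hv' 0)).fun_sub ((hu' 0).fun_mul (hv' 2))).congr_deriv
      (by simp [cross_apply]; ring)
  · exact (((hu' 0).fun_mul (hv' 1)).fun_sub ((hu' 1).fun_mul (hv' 0))).congr_deriv
      (by simp [cross_apply]; ring)

theorem hasLineDerivAt_tangentVector {ι : Type} [Fintype ι] {Y : (Fin 2 → ℝ) → ι → ℝ}
    (hY : DifferentiableAt ℝ Y s) (a : Fin 2) :
    HasLineDerivAt ℝ Y (tangentVector Y s a) s (Pi.single a 1) :=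
  hY.hasFDerivAt.hasLineDerivAt _

theorem contDiffOn_tangentVector {ι : Type} [Fintype ι] {Y : (Fin 2 → ℝ) → ι → ℝ}
    (hU : IsOpen U) (hY : ContDiffOn ℝ ∞ Y U) (a : Fin 2) :
    ContDiffOn ℝ ∞ (fun s => tangentVector Y s a) U :=
  (hY.fderiv_of_isOpen hU (by norm_cast)).clm_apply contDiffOn_const

theorem differentiableAt_tangentVector {ι : Type} [Fintype ι] {Y : (Fin 2 → ℝ) → ι → ℝ}
    (hU : IsOpen U) (hY : ContDiffOn ℝ ∞ Y U) (hs : s ∈ U) (a : Fin 2) :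
    DifferentiableAt ℝ (fun s => tangentVector Y s a) s :=
  ((contDiffOn_tangentVector hU hY a).contDiffAt (hU.mem_nhds hs)).differentiableAt (by simp)

theorem hasLineDerivAt_secondDerivative {ι : Type} [Fintype ι] {Y : (Fin 2 → ℝ) → ι → ℝ}
    (hU : IsOpen U) (hY : ContDiffOn ℝ ∞ Y U) (hs : s ∈ U) (a b : Fin 2) :
    HasLineDerivAt ℝ (fun s => tangentVector Y s b) (secondDerivative Y s a b) s
      (Pi.single a 1) :=
  (differentiableAt_tangentVector hU hY hs b).hasFDerivAt.hasLineDerivAt _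

theorem two_le_infty : (2 : WithTop ℕ∞) ≤ ∞ :=
  WithTop.coe_le_coe.2 (le_top (a := (2 : ℕ∞)))

theorem secondDerivative_comm {ι : Type} [Fintype ι] {Y : (Fin 2 → ℝ) → ι → ℝ}
    (hU : IsOpen U) (hY : ContDiffOn ℝ ∞ Y U) (hs : s ∈ U) (a b : Fin 2) :
    secondDerivative Y s a b = secondDerivative Y s b a := by
  have hc := hY.contDiffAt (hU.mem_nhds hs)
  have hd : DifferentiableAt ℝ (fderiv ℝ Y) s :=
    (hc.fderiv_right (m := ∞) (by norm_cast)).differentiableAt (by simp)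
  have h : ∀ a b, secondDerivative Y s a b =
      fderiv ℝ (fderiv ℝ Y) s (Pi.single a 1) (Pi.single b 1) := by
    intro a b
    simp only [secondDerivative, tangentVector]
    rw [fderiv_clm_apply hd (differentiableAt_const _)]
    simp
  rw [h, h]
  exact (hc.isSymmSndFDerivAt (by simpa using two_le_infty)).eq _ _

theorem eq_of_hasLineDerivAt_zero {f : (Fin 2 → ℝ) → ℝ} (hU : IsOpen U)
    (hc : IsPreconnected U) (hf : DifferentiableOn ℝ f U)
    (h : ∀ s ∈ U, ∀ a, HasLineDerivAt ℝ f 0 s (Pi.single a 1)) {s s' : Fin 2 → ℝ}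
    (hs : s ∈ U) (hs' : s' ∈ U) : f s = f s' := by
  refine hU.is_const_of_fderiv_eq_zero (𝕜 := ℝ) hc hf (fun s hs => ?_) hs hs'
  have hd : DifferentiableAt ℝ f s := hf.differentiableAt (hU.mem_nhds hs)
  refine ContinuousLinearMap.coe_inj.1 (LinearMap.pi_ext' fun a => LinearMap.ext_ring ?_)
  simpa using (hd.hasFDerivAt.hasLineDerivAt (Pi.single a 1)).unique (h s hs a)

/-- If `|N|² dφ = φ ⟨N, dN⟩`, then `φ / |N|` is constant up to sign. -/
theorem sq_div_normSq_eq {φ : (Fin 2 → ℝ) → ℝ} {N : (Fin 2 → ℝ) → Fin 3 → ℝ}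
    {φ' : (Fin 2 → ℝ) → Fin 2 → ℝ} {N' : (Fin 2 → ℝ) → Fin 2 → Fin 3 → ℝ}
    (hU : IsOpen U) (hc : IsPreconnected U)
    (hφ : DifferentiableOn ℝ φ U) (hN : DifferentiableOn ℝ N U)
    (hφ' : ∀ s ∈ U, ∀ a, HasLineDerivAt ℝ φ (φ' s a) s (Pi.single a 1))
    (hN' : ∀ s ∈ U, ∀ a, HasLineDerivAt ℝ N (N' s a) s (Pi.single a 1))
    (hne : ∀ s ∈ U, N s ⬝ᵥ N s ≠ 0)
    (h : ∀ s ∈ U, ∀ a, φ' s a * (N s ⬝ᵥ N s) = φ s * (N s ⬝ᵥ N' s a))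
    {s s' : Fin 2 → ℝ} (hs : s ∈ U) (hs' : s' ∈ U) :
    φ s ^ 2 / (N s ⬝ᵥ N s) = φ s' ^ 2 / (N s' ⬝ᵥ N s') := by
  refine eq_of_hasLineDerivAt_zero (f := fun s => φ s ^ 2 / (N s ⬝ᵥ N s)) hU hc
    ?_ (fun s hs a => ?_) hs hs'
  · have h1 : ∀ i, DifferentiableOn ℝ (fun s => N s i) U := fun i => differentiableOn_pi.1 hN i
    have h2 : DifferentiableOn ℝ (fun s => N s ⬝ᵥ N s) U :=
      DifferentiableOn.fun_sum fun i _ => (h1 i).fun_mul (h1 i)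
    simp only [div_eq_mul_inv]
    exact (hφ.fun_pow 2).fun_mul (h2.fun_inv hne)
  · have h1 := (hφ' s hs a)
    have h2 := (hN' s hs a)
    unfold HasLineDerivAt at h1 h2 ⊢
    have h0 : s + (0 : ℝ) • Pi.single a (1 : ℝ) = s := by simp
    refine ((h1.fun_pow 2).fun_div (hasDerivAt_dotProduct h2 h2) ?_).congr_deriv ?_
    · rw [h0]; exact hne s hs
    · simp only [h0]
      rw [div_eq_zero_iff]
      left
      rw [dotProduct_comm (N' s a)]
      linear_combination 2 * φ s * h s hs a

end LineDerivatives

/-! ### Linear algebra in three dimensions -/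

section LinearAlgebra

theorem dotProduct_fin_three (v w : Fin 3 → ℝ) :
    v ⬝ᵥ w = v 0 * w 0 + v 1 * w 1 + v 2 * w 2 := by
  simp [dotProduct, Fin.sum_univ_three]

theorem mulVec_fin_three (A : Matrix (Fin 3) (Fin 3) ℝ) (x : Fin 3 → ℝ) (i : Fin 3) :
    (A *ᵥ x) i = A i 0 * x 0 + A i 1 * x 1 + A i 2 * x 2 := by
  simp [Matrix.mulVec, dotProduct_fin_three]

theorem skew_mulVec_eq_cross {A : Matrix (Fin 3) (Fin 3) ℝ} (hA : ∀ i j, A i j + A j i = 0)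
    (x : Fin 3 → ℝ) : A *ᵥ x = crossProduct ![A 2 1, A 0 2, A 1 0] x := by
  have h00 := hA 0 0
  have h11 := hA 1 1
  have h22 := hA 2 2
  have h01 := hA 0 1
  have h02 := hA 0 2
  have h12 := hA 1 2
  funext i
  rw [mulVec_fin_three]
  fin_cases i <;> simp [cross_apply]
  · linear_combination x 0 / 2 * h00 + x 1 * h01
  · linear_combination x 1 / 2 * h11 + x 2 * h12
  · linear_combination x 2 / 2 * h22 + x 0 * h02

theorem normSq_pos {v : Fin 3 → ℝ} (hv : v ≠ 0) : 0 < v ⬝ᵥ v :=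
  lt_of_le_of_ne (by
    rw [dotProduct_fin_three]
    exact add_nonneg (add_nonneg (mul_self_nonneg _) (mul_self_nonneg _)) (mul_self_nonneg _)) fun h =>
    hv (dotProduct_self_eq_zero.1 h.symm)

theorem exists_unit_orthogonal (w : Fin 3 → ℝ) : ∃ u : Fin 3 → ℝ, u ⬝ᵥ u = 1 ∧ u ⬝ᵥ w = 0 := by
  obtain ⟨u, hu, huw⟩ : ∃ u : Fin 3 → ℝ, u ≠ 0 ∧ u ⬝ᵥ w = 0 := by
    by_cases h : w 0 = 0
    · exact ⟨![1, 0, 0], fun h' => by simpa using congrFun h' 0, by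
        rw [dotProduct_fin_three]; simp [h]⟩
    · exact ⟨![-w 1, w 0, 0], fun h' => h (by simpa using congrFun h' 1), by
        rw [dotProduct_fin_three]; simp; ring⟩
  have hpos := normSq_pos hu
  refine ⟨(√(u ⬝ᵥ u))⁻¹ • u, ?_, by simp [huw]⟩
  rw [smul_dotProduct, dotProduct_smul, smul_eq_mul, smul_eq_mul, ← mul_assoc, ← mul_inv,
    Real.mul_self_sqrt hpos.le, inv_mul_cancel₀ hpos.ne']

/-- An orthonormal frame whose last member has the direction of a given vector. -/
theorem exists_adapted_frame {w : Fin 3 → ℝ} (hw : w ≠ 0) :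
    ∃ R ∈ Matrix.orthogonalGroup (Fin 3) ℝ, ∃ c : ℝ, c ≠ 0 ∧
      (∀ x, w ⬝ᵥ (R *ᵥ x) = c * x 2) ∧
      ∀ x, crossProduct w (R *ᵥ x) = R *ᵥ ![-(c * x 1), c * x 0, 0] := by
  obtain ⟨a, ha, haw⟩ := exists_unit_orthogonal w
  have hpos := normSq_pos hw
  set c := √(w ⬝ᵥ w) with hc
  have hc0 : c ≠ 0 := (Real.sqrt_pos.2 hpos).ne'
  set e : Fin 3 → ℝ := c⁻¹ • w with he
  have hwe : w = c • e := by rw [he, smul_smul, mul_inv_cancel₀ hc0, one_smul]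
  have hee : e ⬝ᵥ e = 1 := by
    rw [he, smul_dotProduct, dotProduct_smul, smul_eq_mul, smul_eq_mul, ← mul_assoc, ← mul_inv,
      Real.mul_self_sqrt hpos.le, inv_mul_cancel₀ hpos.ne']
  have hae : a ⬝ᵥ e = 0 := by rw [he, dotProduct_smul, haw, smul_zero]
  clear_value e c
  subst hwe
  simp only [dotProduct_fin_three] at ha hee hae
  -- The columns `a`, `e × a`, `e` are ordered so that `e ×` acts as the positive quarter turn of
  -- the first two coordinates.
  refine ⟨Matrix.of fun i j => ![a i, crossProduct e a i, e i] j, ?_, c, hc0, ?_, ?_⟩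
  · rw [Matrix.mem_orthogonalGroup_iff']
    ext i j
    simp only [Matrix.mul_apply, Fin.sum_univ_three, Matrix.transpose_apply, Matrix.of_apply]
    fin_cases i <;> fin_cases j <;> simp [cross_apply]
    · linear_combination ha
    · ring
    · linear_combination hae
    · ring
    · linear_combination hee * (a 0 * a 0 + a 1 * a 1 + a 2 * a 2) + ha -
        (a 0 * e 0 + a 1 * e 1 + a 2 * e 2) * hae
    · ring
    · linear_combination hae
    · ring
    · linear_combination hee
  · intro x
    simp only [dotProduct_fin_three, mulVec_fin_three, Matrix.of_apply]
    simp [cross_apply]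
    linear_combination c * x 0 * hae + c * x 2 * hee
  · intro x
    funext i
    rw [mulVec_fin_three]
    fin_cases i <;> simp [cross_apply, mulVec_fin_three]
    · linear_combination c * x 1 * (e 0 * hae - a 0 * hee)
    · linear_combination c * x 1 * (e 1 * hae - a 1 * hee)
    · linear_combination c * x 1 * (e 2 * hae - a 2 * hee)

theorem orthogonal_mulVec_transpose {R : Matrix (Fin 3) (Fin 3) ℝ}
    (hR : R ∈ Matrix.orthogonalGroup (Fin 3) ℝ) (x : Fin 3 → ℝ) : R *ᵥ (Rᵀ *ᵥ x) = x := by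
  have h := (Matrix.mem_orthogonalGroup_iff (Fin 3) ℝ).1 hR
  rw [Matrix.mulVec_mulVec, h, Matrix.one_mulVec]

theorem orthogonal_transpose_mulVec {R : Matrix (Fin 3) (Fin 3) ℝ}
    (hR : R ∈ Matrix.orthogonalGroup (Fin 3) ℝ) (x : Fin 3 → ℝ) : Rᵀ *ᵥ (R *ᵥ x) = x := by
  have h := (Matrix.mem_orthogonalGroup_iff' (Fin 3) ℝ).1 hR
  rw [Matrix.mulVec_mulVec, h, Matrix.one_mulVec]

theorem orthogonal_dotProduct {R : Matrix (Fin 3) (Fin 3) ℝ}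
    (hR : R ∈ Matrix.orthogonalGroup (Fin 3) ℝ) (x y : Fin 3 → ℝ) :
    (R *ᵥ x) ⬝ᵥ (R *ᵥ y) = x ⬝ᵥ y := by
  rw [Matrix.dotProduct_mulVec, ← Matrix.mulVec_transpose, orthogonal_transpose_mulVec hR]

/-- A vector orthogonal to two independent vectors is a multiple of their cross product. -/
theorem eq_smul_cross_of_dotProduct_eq_zero {u v ν : Fin 3 → ℝ} (h : crossProduct u v ≠ 0)
    (hu : ν ⬝ᵥ u = 0) (hv : ν ⬝ᵥ v = 0) :
    ν = ((ν ⬝ᵥ crossProduct u v) / (crossProduct u v ⬝ᵥ crossProduct u v)) •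
      crossProduct u v := by
  have hpos := normSq_pos h
  have key : (crossProduct u v ⬝ᵥ crossProduct u v) • ν =
      (ν ⬝ᵥ crossProduct u v) • crossProduct u v := by
    rw [dotProduct_fin_three] at hu hv
    funext i
    simp only [dotProduct_fin_three, Pi.smul_apply, smul_eq_mul]
    fin_cases i <;> simp [cross_apply]
    · linear_combination ((v 0 * v 0 + v 1 * v 1 + v 2 * v 2) * u 0 -
        (u 0 * v 0 + u 1 * v 1 + u 2 * v 2) * v 0) * hu +
        ((u 0 * u 0 + u 1 * u 1 + u 2 * u 2) * v 0 -
        (u 0 * v 0 + u 1 * v 1 + u 2 * v 2) * u 0) * hv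
    · linear_combination ((v 0 * v 0 + v 1 * v 1 + v 2 * v 2) * u 1 -
        (u 0 * v 0 + u 1 * v 1 + u 2 * v 2) * v 1) * hu +
        ((u 0 * u 0 + u 1 * u 1 + u 2 * u 2) * v 1 -
        (u 0 * v 0 + u 1 * v 1 + u 2 * v 2) * u 1) * hv
    · linear_combination ((v 0 * v 0 + v 1 * v 1 + v 2 * v 2) * u 2 -
        (u 0 * v 0 + u 1 * v 1 + u 2 * v 2) * v 2) * hu +
        ((u 0 * u 0 + u 1 * u 1 + u 2 * u 2) * v 2 -
        (u 0 * v 0 + u 1 * v 1 + u 2 * v 2) * u 2) * hv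
  rw [div_eq_inv_mul, mul_smul, ← key, smul_smul, inv_mul_cancel₀ hpos.ne', one_smul]

/-- A vector orthogonal to the normal is a combination of the two tangent vectors. -/
theorem exists_eq_smul_add_smul {u v x : Fin 3 → ℝ} (h : crossProduct u v ≠ 0)
    (hx : crossProduct u v ⬝ᵥ x = 0) : ∃ p q : ℝ, x = p • u + q • v := by
  have hpos := normSq_pos h
  refine ⟨(crossProduct x v ⬝ᵥ crossProduct u v) / (crossProduct u v ⬝ᵥ crossProduct u v),
    (crossProduct u x ⬝ᵥ crossProduct u v) / (crossProduct u v ⬝ᵥ crossProduct u v), ?_⟩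
  have key : (crossProduct u v ⬝ᵥ crossProduct u v) • x =
      (crossProduct x v ⬝ᵥ crossProduct u v) • u +
      (crossProduct u x ⬝ᵥ crossProduct u v) • v := by
    rw [dotProduct_fin_three] at hx
    funext i
    simp only [dotProduct_fin_three, Pi.smul_apply, Pi.add_apply, smul_eq_mul]
    simp [cross_apply] at hx
    fin_cases i <;> simp [cross_apply]
    · linear_combination (u 1 * v 2 - u 2 * v 1) * hx
    · linear_combination (u 2 * v 0 - u 0 * v 2) * hx
    · linear_combination (u 0 * v 1 - u 1 * v 0) * hx
  rw [div_eq_inv_mul, div_eq_inv_mul, mul_smul, mul_smul, ← smul_add, ← key, smul_smul,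
    inv_mul_cancel₀ hpos.ne', one_smul]

theorem linearCombination_eq_zero_of_cross_ne_zero {u v : Fin 3 → ℝ}
    (h : crossProduct u v ≠ 0) {p q : ℝ} (hpq : p • u + q • v = 0) : p = 0 ∧ q = 0 := by
  constructor
  · have := congrArg (fun x => crossProduct x v) hpq
    simp [cross_self] at this
    exact this.resolve_right h
  · have := congrArg (fun x => crossProduct u x) hpq
    simp [cross_self] at this
    exact this.resolve_right h

end LinearAlgebra

/-! ### Surface patches to which a Killing field of Euclidean space is tangent -/

section PointwiseIdentities

variable (u v w x V N : Fin 3 → ℝ)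

/-- This is `⟨x, N × ((w × V) × N)⟩` expanded in two ways by the triple product formula. For `V`
tangent the last term drops, and what is left has the factor `⟨w, N⟩`. -/
theorem cross_normal_identity :
    (x ⬝ᵥ crossProduct w V) * (N ⬝ᵥ N) - (N ⬝ᵥ crossProduct w V) * (N ⬝ᵥ x) =
      (w ⬝ᵥ N) * (x ⬝ᵥ crossProduct N V) - (V ⬝ᵥ N) * (x ⬝ᵥ crossProduct N w) := by
  simp only [dotProduct_fin_three, cross_apply, Matrix.cons_val]
  ring

theorem dotProduct_cross_cross :
    N ⬝ᵥ crossProduct w (crossProduct w u) = (w ⬝ᵥ N) * (w ⬝ᵥ u) - (w ⬝ᵥ w) * (N ⬝ᵥ u) := by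
  simp only [dotProduct_fin_three, cross_apply, Matrix.cons_val]
  ring

theorem dotProduct_cross_normal_left :
    x ⬝ᵥ crossProduct (crossProduct u v) u = (u ⬝ᵥ u) * (x ⬝ᵥ v) - (u ⬝ᵥ v) * (x ⬝ᵥ u) := by
  simp only [dotProduct_fin_three, cross_apply, Matrix.cons_val]
  ring

theorem dotProduct_cross_normal_right :
    x ⬝ᵥ crossProduct (crossProduct u v) v = (u ⬝ᵥ v) * (x ⬝ᵥ v) - (v ⬝ᵥ v) * (x ⬝ᵥ u) := by
  simp only [dotProduct_fin_three, cross_apply, Matrix.cons_val]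
  ring

theorem normal_dotProduct_cross_left :
    crossProduct u v ⬝ᵥ crossProduct w u = (u ⬝ᵥ v) * (w ⬝ᵥ u) - (u ⬝ᵥ u) * (w ⬝ᵥ v) := by
  simp only [dotProduct_fin_three, cross_apply, Matrix.cons_val]
  ring

theorem normal_dotProduct_cross_right :
    crossProduct u v ⬝ᵥ crossProduct w v = (v ⬝ᵥ v) * (w ⬝ᵥ u) - (u ⬝ᵥ v) * (w ⬝ᵥ v) := by
  simp only [dotProduct_fin_three, cross_apply, Matrix.cons_val]
  ring

theorem normal_dotProduct_self :
    crossProduct u v ⬝ᵥ crossProduct u v = (u ⬝ᵥ u) * (v ⬝ᵥ v) - (u ⬝ᵥ v) * (u ⬝ᵥ v) := by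
  simp only [dotProduct_fin_three, cross_apply, Matrix.cons_val]
  ring

variable {u v w x V N}

/-- The Codazzi-free form of the invariance of `K(V, V)`: here `u, v` are the tangent vectors,
`N` the normal, `Nu, Nv` its derivatives and `V = p u + q v` is the Killing field. -/
theorem normal_component_derivative {Nu Nv : Fin 3 → ℝ} {p q l m r : ℝ}
    (hN : N = crossProduct u v) (hV : V = p • u + q • v)
    (hl : Nu ⬝ᵥ u = -l) (hm : Nu ⬝ᵥ v = -m) (hm' : Nv ⬝ᵥ u = -m) (hr : Nv ⬝ᵥ v = -r)
    (hmin : (v ⬝ᵥ v) * l - 2 * (u ⬝ᵥ v) * m + (u ⬝ᵥ u) * r = 0)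
    (hu : Nu ⬝ᵥ V + N ⬝ᵥ crossProduct w u = 0) (hv : Nv ⬝ᵥ V + N ⬝ᵥ crossProduct w v = 0) :
    (Nu ⬝ᵥ crossProduct w V + N ⬝ᵥ crossProduct w (crossProduct w u)) * (N ⬝ᵥ N) =
        (N ⬝ᵥ crossProduct w V) * (N ⬝ᵥ Nu) ∧
      (Nv ⬝ᵥ crossProduct w V + N ⬝ᵥ crossProduct w (crossProduct w v)) * (N ⬝ᵥ N) =
        (N ⬝ᵥ crossProduct w V) * (N ⬝ᵥ Nv) := by
  have hVN : V ⬝ᵥ N = 0 := by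
    rw [hV, hN, add_dotProduct, smul_dotProduct, smul_dotProduct, dot_self_cross,
      dot_cross_self, smul_zero, smul_zero, add_zero]
  have hNu0 : N ⬝ᵥ u = 0 := by rw [hN, dotProduct_comm, dot_self_cross]
  have hNv0 : N ⬝ᵥ v = 0 := by rw [hN, dotProduct_comm, dot_cross_self]
  have h1 := cross_normal_identity w Nu V N
  have h2 := cross_normal_identity w Nv V N
  have hNN : N ⬝ᵥ N = (u ⬝ᵥ u) * (v ⬝ᵥ v) - (u ⬝ᵥ v) * (u ⬝ᵥ v) := by
    rw [hN, normal_dotProduct_self]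
  have e1 : Nu ⬝ᵥ crossProduct N V = p * ((u ⬝ᵥ u) * (-m) - (u ⬝ᵥ v) * (-l)) +
      q * ((u ⬝ᵥ v) * (-m) - (v ⬝ᵥ v) * (-l)) := by
    rw [hV, hN, map_add, map_smul, map_smul, dotProduct_add, dotProduct_smul, dotProduct_smul,
      dotProduct_cross_normal_left, dotProduct_cross_normal_right, hl, hm, smul_eq_mul,
      smul_eq_mul]
  have e2 : Nv ⬝ᵥ crossProduct N V = p * ((u ⬝ᵥ u) * (-r) - (u ⬝ᵥ v) * (-m)) +
      q * ((u ⬝ᵥ v) * (-r) - (v ⬝ᵥ v) * (-m)) := by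
    rw [hV, hN, map_add, map_smul, map_smul, dotProduct_add, dotProduct_smul, dotProduct_smul,
      dotProduct_cross_normal_left, dotProduct_cross_normal_right, hm', hr, smul_eq_mul,
      smul_eq_mul]
  have hu' : p * (-l) + q * (-m) + ((u ⬝ᵥ v) * (w ⬝ᵥ u) - (u ⬝ᵥ u) * (w ⬝ᵥ v)) = 0 := by
    rw [hV, hN, normal_dotProduct_cross_left, dotProduct_add, dotProduct_smul, dotProduct_smul,
      hl, hm] at hu
    exact hu
  have hv' : p * (-m) + q * (-r) + ((v ⬝ᵥ v) * (w ⬝ᵥ u) - (u ⬝ᵥ v) * (w ⬝ᵥ v)) = 0 := by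
    rw [hV, hN, normal_dotProduct_cross_right, dotProduct_add, dotProduct_smul, dotProduct_smul,
      hm', hr] at hv
    exact hv
  rw [dotProduct_cross_cross, dotProduct_cross_cross, hNu0, hNv0]
  rw [hVN, e1] at h1
  rw [hVN, e2] at h2
  -- Both identities now reduce to `⟨w, N⟩` times the bracket `⟨N_a, N × V⟩ + ⟨w, ∂_a⟩ |N|²`. The
  -- bracket vanishes: minimality makes the shape operator anticommute with the rotation `N ×`,
  -- which turns the bracket into a combination of the tangency relations `hu'` and `hv'`.
  constructor
  · linear_combination h1 + (w ⬝ᵥ N) * (w ⬝ᵥ u) * hNN + (w ⬝ᵥ N) * ((u ⬝ᵥ u) * hv' -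
      (u ⬝ᵥ v) * hu' + q * hmin)
  · linear_combination h2 + (w ⬝ᵥ N) * (w ⬝ᵥ v) * hNN + (w ⬝ᵥ N) * ((u ⬝ᵥ v) * hv' -
      (v ⬝ᵥ v) * hu' - p * hmin)

end PointwiseIdentities

/-! ### Normal, second fundamental form and tangent Killing fields of a patch. -/

section Patch

/-- The normal `∂₀Y × ∂₁Y` of a surface patch. -/
noncomputable def normalVector (Y : (Fin 2 → ℝ) → Fin 3 → ℝ) (s : Fin 2 → ℝ) : Fin 3 → ℝ :=
  crossProduct (tangentVector Y s 0) (tangentVector Y s 1)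

/-- The derivative `∂_a (∂₀Y × ∂₁Y)` of the normal. -/
noncomputable def normalDerivative (Y : (Fin 2 → ℝ) → Fin 3 → ℝ) (s : Fin 2 → ℝ) (a : Fin 2) :
    Fin 3 → ℝ :=
  crossProduct (secondDerivative Y s a 0) (tangentVector Y s 1) +
    crossProduct (tangentVector Y s 0) (secondDerivative Y s a 1)

/-- A smooth immersed patch. -/
structure IsPatch (Y : (Fin 2 → ℝ) → Fin 3 → ℝ) (U : Set (Fin 2 → ℝ)) : Prop where
  isOpen : IsOpen U
  contDiffOn : ContDiffOn ℝ ∞ Y U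
  normal_ne_zero : ∀ s ∈ U, normalVector Y s ≠ 0

/-- The patch has vanishing mean curvature. -/
def IsMinimalPatch (Y : (Fin 2 → ℝ) → Fin 3 → ℝ) (U : Set (Fin 2 → ℝ)) : Prop :=
  ∀ s ∈ U, (tangentVector Y s 1 ⬝ᵥ tangentVector Y s 1) *
      (normalVector Y s ⬝ᵥ secondDerivative Y s 0 0) -
    2 * (tangentVector Y s 0 ⬝ᵥ tangentVector Y s 1) *
      (normalVector Y s ⬝ᵥ secondDerivative Y s 0 1) +
    (tangentVector Y s 0 ⬝ᵥ tangentVector Y s 0) *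
      (normalVector Y s ⬝ᵥ secondDerivative Y s 1 1) = 0

variable {Y : (Fin 2 → ℝ) → Fin 3 → ℝ} {U : Set (Fin 2 → ℝ)} {s : Fin 2 → ℝ}

theorem IsPatch.mono (h : IsPatch Y U) {U' : Set (Fin 2 → ℝ)} (hU : IsOpen U') (hs : U' ⊆ U) :
    IsPatch Y U' :=
  ⟨hU, h.contDiffOn.mono hs, fun s hs' => h.normal_ne_zero s (hs hs')⟩

theorem IsPatch.differentiableAt (h : IsPatch Y U) (hs : s ∈ U) : DifferentiableAt ℝ Y s :=
  (h.contDiffOn.contDiffAt (h.isOpen.mem_nhds hs)).differentiableAt (by simp)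

theorem IsPatch.hasLineDerivAt (h : IsPatch Y U) (hs : s ∈ U) (a : Fin 2) :
    HasLineDerivAt ℝ Y (tangentVector Y s a) s (Pi.single a 1) :=
  hasLineDerivAt_tangentVector (h.differentiableAt hs) a

theorem IsPatch.hasLineDerivAt_normal (h : IsPatch Y U) (hs : s ∈ U) (a : Fin 2) :
    HasLineDerivAt ℝ (normalVector Y) (normalDerivative Y s a) s (Pi.single a 1) := by
  have h0 := hasLineDerivAt_secondDerivative h.isOpen h.contDiffOn hs a 0
  have h1 := hasLineDerivAt_secondDerivative h.isOpen h.contDiffOn hs a 1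
  unfold HasLineDerivAt at h0 h1 ⊢
  exact (hasDerivAt_crossProduct h0 h1).congr_deriv (by simp [normalDerivative])

theorem contDiffOn_cross {f g : (Fin 2 → ℝ) → Fin 3 → ℝ} (hf : ContDiffOn ℝ ∞ f U)
    (hg : ContDiffOn ℝ ∞ g U) : ContDiffOn ℝ ∞ (fun s => crossProduct (f s) (g s)) U := by
  rw [contDiffOn_pi] at hf hg ⊢
  intro i
  fin_cases i
  · exact (((hf 1).mul (hg 2)).sub ((hf 2).mul (hg 1))).congr fun s _ => by simp [cross_apply]
  · exact (((hf 2).mul (hg 0)).sub ((hf 0).mul (hg 2))).congr fun s _ => by simp [cross_apply]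
  · exact (((hf 0).mul (hg 1)).sub ((hf 1).mul (hg 0))).congr fun s _ => by simp [cross_apply]

theorem contDiffOn_dotProduct {f g : (Fin 2 → ℝ) → Fin 3 → ℝ} (hf : ContDiffOn ℝ ∞ f U)
    (hg : ContDiffOn ℝ ∞ g U) : ContDiffOn ℝ ∞ (fun s => f s ⬝ᵥ g s) U :=
  ContDiffOn.sum fun i _ => (contDiffOn_pi.1 hf i).mul (contDiffOn_pi.1 hg i)

theorem IsPatch.contDiffOn_normal (h : IsPatch Y U) : ContDiffOn ℝ ∞ (normalVector Y) U :=
  contDiffOn_cross (contDiffOn_tangentVector h.isOpen h.contDiffOn 0)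
    (contDiffOn_tangentVector h.isOpen h.contDiffOn 1)

theorem normalDerivative_dotProduct (Y : (Fin 2 → ℝ) → Fin 3 → ℝ) (s : Fin 2 → ℝ) (a b : Fin 2) :
    normalDerivative Y s a ⬝ᵥ tangentVector Y s b =
      -(normalVector Y s ⬝ᵥ secondDerivative Y s a b) := by
  revert b
  rw [Fin.forall_fin_two]
  constructor <;>
  · simp only [normalDerivative, normalVector, dotProduct_fin_three, cross_apply, Matrix.cons_val,
      Pi.add_apply]
    ring

theorem normal_dotProduct_tangent (Y : (Fin 2 → ℝ) → Fin 3 → ℝ) (s : Fin 2 → ℝ) (a : Fin 2) :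
    normalVector Y s ⬝ᵥ tangentVector Y s a = 0 := by
  rw [dotProduct_comm]
  fin_cases a
  · exact dot_self_cross _ _
  · exact dot_cross_self _ _

variable {w b : Fin 3 → ℝ}

/-- Derivative of the condition that the Killing field `w × x + b` is tangent. -/
theorem IsPatch.tangency_derivative (h : IsPatch Y U)
    (ht : ∀ s ∈ U, normalVector Y s ⬝ᵥ (crossProduct w (Y s) + b) = 0) (hs : s ∈ U)
    (a : Fin 2) :
    normalDerivative Y s a ⬝ᵥ (crossProduct w (Y s) + b) +
      normalVector Y s ⬝ᵥ crossProduct w (tangentVector Y s a) = 0 := by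
  have h1 := h.hasLineDerivAt_normal hs a
  have h2 := h.hasLineDerivAt hs a
  unfold HasLineDerivAt at h1 h2
  have h3 := hasDerivAt_dotProduct h1
    ((hasDerivAt_crossProduct (hasDerivAt_const (0 : ℝ) w) h2).add_const b)
  simp only [zero_smul, add_zero, map_zero, LinearMap.zero_apply, zero_add] at h3
  have hev : ∀ᶠ t : ℝ in 𝓝 0, s + t • Pi.single a 1 ∈ U := by
    have hc : ContinuousAt (fun t : ℝ => s + t • (Pi.single a 1 : Fin 2 → ℝ)) 0 := by fun_prop
    exact hc (h.isOpen.mem_nhds (by simpa using hs))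
  exact h3.unique ((hasDerivAt_const (0 : ℝ) (0 : ℝ)).congr_of_eventuallyEq
    (hev.mono fun t ht' => ht _ ht'))

theorem IsPatch.exists_tangent (h : IsPatch Y U) {x : Fin 3 → ℝ} (hs : s ∈ U)
    (hx : normalVector Y s ⬝ᵥ x = 0) :
    ∃ p q : ℝ, x = p • tangentVector Y s 0 + q • tangentVector Y s 1 :=
  exists_eq_smul_add_smul (h.normal_ne_zero s hs) hx

theorem IsPatch.normSq_ne_zero (h : IsPatch Y U) (hs : s ∈ U) :
    normalVector Y s ⬝ᵥ normalVector Y s ≠ 0 :=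
  (normSq_pos (h.normal_ne_zero s hs)).ne'

/-- `K(V, V)` is constant up to sign along a minimal patch with tangent Killing field `V`. -/
theorem IsPatch.killing_curvature_const (h : IsPatch Y U) (hmin : IsMinimalPatch Y U)
    (hc : IsPreconnected U)
    (ht : ∀ s ∈ U, normalVector Y s ⬝ᵥ (crossProduct w (Y s) + b) = 0)
    {s s' : Fin 2 → ℝ} (hs : s ∈ U) (hs' : s' ∈ U) :
    (normalVector Y s ⬝ᵥ crossProduct w (crossProduct w (Y s) + b)) ^ 2 /
        (normalVector Y s ⬝ᵥ normalVector Y s) =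
      (normalVector Y s' ⬝ᵥ crossProduct w (crossProduct w (Y s') + b)) ^ 2 /
        (normalVector Y s' ⬝ᵥ normalVector Y s') := by
  refine sq_div_normSq_eq (N := normalVector Y)
    (φ := fun s => normalVector Y s ⬝ᵥ crossProduct w (crossProduct w (Y s) + b))
    (φ' := fun s a => normalDerivative Y s a ⬝ᵥ crossProduct w (crossProduct w (Y s) + b) +
      normalVector Y s ⬝ᵥ crossProduct w (crossProduct w (tangentVector Y s a)))
    (N' := normalDerivative Y) h.isOpen hc ?_ (h.contDiffOn_normal.differentiableOn (by simp))
    ?_ (fun s hs a => h.hasLineDerivAt_normal hs a) (fun s hs => h.normSq_ne_zero hs)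
    ?_ hs hs'
  · refine (contDiffOn_dotProduct h.contDiffOn_normal ?_).differentiableOn (by simp)
    exact contDiffOn_cross contDiffOn_const
      ((contDiffOn_cross contDiffOn_const h.contDiffOn).add contDiffOn_const)
  · intro s hs a
    have h1 := h.hasLineDerivAt_normal hs a
    have h2 := h.hasLineDerivAt hs a
    unfold HasLineDerivAt at h1 h2 ⊢
    have h3 := hasDerivAt_dotProduct h1 (hasDerivAt_crossProduct (hasDerivAt_const (0 : ℝ) w)
      ((hasDerivAt_crossProduct (hasDerivAt_const (0 : ℝ) w) h2).add_const b))
    simpa only [zero_smul, add_zero, map_zero, LinearMap.zero_apply, zero_add] using h3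
  · intro s hs
    obtain ⟨p, q, hpq⟩ := h.exists_tangent hs (ht s hs)
    have key := normal_component_derivative (w := w) (N := normalVector Y s) rfl hpq
      (normalDerivative_dotProduct Y s 0 0) (normalDerivative_dotProduct Y s 0 1)
      ((normalDerivative_dotProduct Y s 1 0).trans
        (by rw [secondDerivative_comm h.isOpen h.contDiffOn hs]))
      (normalDerivative_dotProduct Y s 1 1) (hmin s hs)
      (h.tangency_derivative ht hs 0) (h.tangency_derivative ht hs 1)
    intro a
    fin_cases a
    · exact key.1
    · exact key.2

/-- Along a tangent Killing field `V = w × x + b`, the curvature `K(V, V)` is the normal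
component of the acceleration `w × V`. -/
theorem IsPatch.acceleration_eq (h : IsPatch Y U)
    (ht : ∀ s ∈ U, normalVector Y s ⬝ᵥ (crossProduct w (Y s) + b) = 0) (hs : s ∈ U)
    {χ : Fin 2 → ℝ}
    (hχ : χ 0 • tangentVector Y s 0 + χ 1 • tangentVector Y s 1 = crossProduct w (Y s) + b) :
    ∑ c, ∑ d, χ c * χ d * (normalVector Y s ⬝ᵥ secondDerivative Y s c d) =
      normalVector Y s ⬝ᵥ crossProduct w (crossProduct w (Y s) + b) := by
  have h0 := h.tangency_derivative ht hs 0
  have h1 := h.tangency_derivative ht hs 1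
  rw [← hχ] at h0 h1 ⊢
  simp only [dotProduct_add, dotProduct_smul, normalDerivative_dotProduct Y s, smul_eq_mul] at h0 h1
  simp only [map_add, map_smul, dotProduct_add, dotProduct_smul, smul_eq_mul, Fin.sum_univ_two]
  -- The differentiated tangency condition is contracted with `χ` itself.
  linear_combination (-χ 0) * h0 - χ 1 * h1

/-- A minimal patch that is invariant under a translation is flat. -/
theorem IsPatch.secondFundamentalForm_eq_zero (h : IsPatch Y U) (hmin : IsMinimalPatch Y U)
    (hb : b ≠ 0) (ht : ∀ s ∈ U, normalVector Y s ⬝ᵥ b = 0) (hs : s ∈ U) (c d : Fin 2) :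
    normalVector Y s ⬝ᵥ secondDerivative Y s c d = 0 := by
  have ht' : ∀ s ∈ U, normalVector Y s ⬝ᵥ (crossProduct 0 (Y s) + b) = 0 := by
    simpa using ht
  obtain ⟨p, q, hpq⟩ := h.exists_tangent hs (ht s hs)
  have h0 := h.tangency_derivative ht' hs 0
  have h1 := h.tangency_derivative ht' hs 1
  simp only [map_zero, LinearMap.zero_apply, zero_add, dotProduct_zero, add_zero, hpq,
    dotProduct_add, dotProduct_smul, normalDerivative_dotProduct Y s, smul_eq_mul,
    secondDerivative_comm h.isOpen h.contDiffOn hs 1 0] at h0 h1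
  have hm := hmin s hs
  have hbb := normSq_pos hb
  have hbe : b ⬝ᵥ b = p ^ 2 * (tangentVector Y s 0 ⬝ᵥ tangentVector Y s 0) +
      2 * p * q * (tangentVector Y s 0 ⬝ᵥ tangentVector Y s 1) +
      q ^ 2 * (tangentVector Y s 1 ⬝ᵥ tangentVector Y s 1) := by
    rw [hpq]
    simp only [dotProduct_add, add_dotProduct, dotProduct_smul, smul_dotProduct, smul_eq_mul,
      dotProduct_comm (tangentVector Y s 1) (tangentVector Y s 0)]
    ring
  set E := tangentVector Y s 0 ⬝ᵥ tangentVector Y s 0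
  set F := tangentVector Y s 0 ⬝ᵥ tangentVector Y s 1
  set G := tangentVector Y s 1 ⬝ᵥ tangentVector Y s 1
  set l := normalVector Y s ⬝ᵥ secondDerivative Y s 0 0
  set m := normalVector Y s ⬝ᵥ secondDerivative Y s 0 1
  set r := normalVector Y s ⬝ᵥ secondDerivative Y s 1 1
  -- `h0` and `h1` say that `b` lies in the kernel of the second fundamental form. A trace-free
  -- symmetric form in two dimensions with a nonzero kernel vector vanishes; the factor `|b|²`
  -- clears denominators.
  have e1 : (b ⬝ᵥ b) * l = 0 := by
    rw [hbe]
    linear_combination (-(E * p + 2 * F * q)) * h0 + E * q * h1 + q ^ 2 * hm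
  have e2 : (b ⬝ᵥ b) * m = 0 := by
    rw [hbe]
    linear_combination (-(E * p)) * h1 - G * q * h0 - p * q * hm
  have e3 : (b ⬝ᵥ b) * r = 0 := by
    rw [hbe]
    linear_combination (-(G * q + 2 * F * p)) * h1 + G * p * h0 + p ^ 2 * hm
  have hl := (mul_eq_zero.1 e1).resolve_left hbb.ne'
  have hm' := (mul_eq_zero.1 e2).resolve_left hbb.ne'
  have hr := (mul_eq_zero.1 e3).resolve_left hbb.ne'
  fin_cases c <;> fin_cases d
  · exact hl
  · exact hm'
  · rw [Fin.mk_one, Fin.zero_eta, secondDerivative_comm h.isOpen h.contDiffOn hs]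
    exact hm'
  · exact hr

/-- The normal of a flat patch has a constant direction. -/
theorem IsPatch.normal_direction_const (h : IsPatch Y U) (hc : IsPreconnected U)
    (hII : ∀ s ∈ U, ∀ c d, normalVector Y s ⬝ᵥ secondDerivative Y s c d = 0) (ν : Fin 3 → ℝ)
    {s s' : Fin 2 → ℝ} (hs : s ∈ U) (hs' : s' ∈ U) :
    (ν ⬝ᵥ normalVector Y s) ^ 2 / (normalVector Y s ⬝ᵥ normalVector Y s) =
      (ν ⬝ᵥ normalVector Y s') ^ 2 / (normalVector Y s' ⬝ᵥ normalVector Y s') := by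
  refine sq_div_normSq_eq (N := normalVector Y) (φ := fun s => ν ⬝ᵥ normalVector Y s)
    (φ' := fun s a => ν ⬝ᵥ normalDerivative Y s a)
    (N' := normalDerivative Y) h.isOpen hc ?_ (h.contDiffOn_normal.differentiableOn (by simp))
    ?_ (fun s hs a => h.hasLineDerivAt_normal hs a) (fun s hs => h.normSq_ne_zero hs)
    ?_ hs hs'
  · exact (contDiffOn_dotProduct contDiffOn_const h.contDiffOn_normal).differentiableOn (by simp)
  · intro s hs a
    have h1 := h.hasLineDerivAt_normal hs a
    unfold HasLineDerivAt at h1 ⊢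
    simpa using hasDerivAt_dotProduct (hasDerivAt_const (0 : ℝ) ν) h1
  · intro s hs a
    -- With vanishing second fundamental form the derivative of the normal has no tangential part,
    -- so it is a multiple of the normal.
    have hN := eq_smul_cross_of_dotProduct_eq_zero (h.normal_ne_zero s hs)
      (ν := normalDerivative Y s a)
      (by rw [normalDerivative_dotProduct Y s, hII s hs, neg_zero])
      (by rw [normalDerivative_dotProduct Y s, hII s hs, neg_zero])
    change _ = _ • normalVector Y s at hN
    rw [hN, dotProduct_smul, dotProduct_smul, smul_eq_mul, smul_eq_mul]
    ring

end Patch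

/-! ### Immersed surfaces -/

section Immersed

variable {M : Type*} [TopologicalSpace M] [ChartedSpace (Fin 2 → ℝ) M]

/-- A smoothly immersed surface in `ℝ³`. -/
structure IsImmersedSurface (X : M → (Fin 3 → ℝ)) : Prop where
  smooth : ContMDiff 𝓘(ℝ, Fin 2 → ℝ) 𝓘(ℝ, Fin 3 → ℝ) ∞ X
  immersion : ∀ p : M,
    Function.Injective (mfderiv 𝓘(ℝ, Fin 2 → ℝ) 𝓘(ℝ, Fin 3 → ℝ) X p)

/-- The differential of a surface, with values in `ℝ³`. -/
noncomputable def differential (X : M → (Fin 3 → ℝ)) (p : M) : (Fin 2 → ℝ) →L[ℝ] (Fin 3 → ℝ) :=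
  mfderiv 𝓘(ℝ, Fin 2 → ℝ) 𝓘(ℝ, Fin 3 → ℝ) X p

/-- The vector `ν` is normal to the surface `X` at `p`. -/
def IsNormalAt (X : M → (Fin 3 → ℝ)) (p : M) (ν : Fin 3 → ℝ) : Prop :=
  ∀ w, ν ⬝ᵥ differential X p w = 0

theorem _root_.IsMinimalSurface.isImmersedSurface {X : M → (Fin 3 → ℝ)}
    (h : IsMinimalSurface X) : IsImmersedSurface X :=
  ⟨h.smooth, h.immersion⟩

theorem cross_ne_zero_of_independent {u v : Fin 3 → ℝ}
    (h : ∀ p q : ℝ, p • u + q • v = 0 → p = 0 ∧ q = 0) : crossProduct u v ≠ 0 := by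
  intro h0
  -- This is `x × (u × v)` up to sign; taking `x = u` makes `-|u|²` the coefficient of `v`.
  have e : ∀ x : Fin 3 → ℝ, (v ⬝ᵥ x) • u + (-(u ⬝ᵥ x)) • v = 0 := by
    intro x
    have h1 := congrFun h0 0
    have h2 := congrFun h0 1
    have h3 := congrFun h0 2
    simp only [cross_apply, Matrix.cons_val, Pi.zero_apply] at h1 h2 h3
    funext i
    simp only [dotProduct_fin_three, Pi.add_apply, Pi.smul_apply, smul_eq_mul, Pi.zero_apply]
    fin_cases i <;> simp
    · linear_combination h3 * x 1 - h2 * x 2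
    · linear_combination h1 * x 2 - h3 * x 0
    · linear_combination h2 * x 0 - h1 * x 1
  have hu : u = 0 := by
    have := (h _ _ (e u)).2
    exact dotProduct_self_eq_zero.1 (by linarith)
  have := (h 1 0 (by simp [hu])).1
  exact one_ne_zero this

variable {X : M → (Fin 3 → ℝ)} {e : OpenPartialHomeomorph M (Fin 2 → ℝ)}

theorem contDiffOn_chart [IsManifold 𝓘(ℝ, Fin 2 → ℝ) ∞ M]
    (hX : ContMDiff 𝓘(ℝ, Fin 2 → ℝ) 𝓘(ℝ, Fin 3 → ℝ) ∞ X)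
    (he : e ∈ atlas (Fin 2 → ℝ) M) : ContDiffOn ℝ ∞ (X ∘ e.symm) e.target := by
  rw [← contMDiffOn_iff_contDiffOn]
  exact hX.comp_contMDiffOn (contMDiffOn_symm_of_mem_maximalAtlas
    (IsManifold.subset_maximalAtlas he))

/-- By the chain rule, with `L` the derivative of the inverse chart. Bijectivity of `L` is what lets
normality and immersivity pass between a chart and the surface itself. -/
theorem tangentVector_chart [IsManifold 𝓘(ℝ, Fin 2 → ℝ) ∞ M]
    (hX : ContMDiff 𝓘(ℝ, Fin 2 → ℝ) 𝓘(ℝ, Fin 3 → ℝ) ∞ X)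
    (he : e ∈ atlas (Fin 2 → ℝ) M) {s : Fin 2 → ℝ} (hs : s ∈ e.target) :
    ∃ L : (Fin 2 → ℝ) →ₗ[ℝ] (Fin 2 → ℝ), Function.Bijective L ∧
      ∀ a, tangentVector (X ∘ e.symm) s a = differential X (e.symm s) (L (Pi.single a 1)) := by
  have : IsManifold 𝓘(ℝ, Fin 2 → ℝ) 1 M := IsManifold.of_le (n := ∞) (by norm_cast)
  have hd := mdifferentiable_of_mem_atlas (I := 𝓘(ℝ, Fin 2 → ℝ)) he
  let D : (Fin 2 → ℝ) →L[ℝ] (Fin 2 → ℝ) := mfderiv 𝓘(ℝ, Fin 2 → ℝ) 𝓘(ℝ, Fin 2 → ℝ) e.symm s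
  refine ⟨D.toLinearMap, hd.symm.mfderiv_bijective (by simpa using hs), fun a => ?_⟩
  unfold tangentVector
  rw [← mfderiv_eq_fderiv, mfderiv_comp s ((hX.mdifferentiable (by simp)) (e.symm s))
    (hd.symm.mdifferentiableAt (by simpa using hs))]
  rfl

theorem isNormalAt_chart_iff [IsManifold 𝓘(ℝ, Fin 2 → ℝ) ∞ M]
    (hX : ContMDiff 𝓘(ℝ, Fin 2 → ℝ) 𝓘(ℝ, Fin 3 → ℝ) ∞ X)
    (he : e ∈ atlas (Fin 2 → ℝ) M) {s : Fin 2 → ℝ} (hs : s ∈ e.target) (ν : Fin 3 → ℝ) :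
    IsNormalAt X (e.symm s) ν ↔ ∀ a, ν ⬝ᵥ tangentVector (X ∘ e.symm) s a = 0 := by
  obtain ⟨L, hL, h⟩ := tangentVector_chart hX he hs
  refine ⟨fun hν a => by rw [h]; exact hν _, fun hν w => ?_⟩
  obtain ⟨x, rfl⟩ := hL.2 w
  have hx : x = x 0 • Pi.single 0 1 + x 1 • Pi.single 1 1 := by
    funext i
    fin_cases i <;> simp
  have h0 := hν 0
  have h1 := hν 1
  rw [h] at h0 h1
  rw [hx, map_add, map_smul, map_smul, map_add, map_smul, map_smul, dotProduct_add,
    dotProduct_smul, dotProduct_smul, h0, h1]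
  simp

theorem IsImmersedSurface.isPatch [IsManifold 𝓘(ℝ, Fin 2 → ℝ) ∞ M]
    (hX : IsImmersedSurface X) (he : e ∈ atlas (Fin 2 → ℝ) M) :
    IsPatch (X ∘ e.symm) e.target := by
  refine ⟨e.open_target, contDiffOn_chart hX.smooth he, fun s hs => ?_⟩
  obtain ⟨L, hL, h⟩ := tangentVector_chart hX.smooth he hs
  refine cross_ne_zero_of_independent fun p q hpq => ?_
  rw [h, h, ← map_smul, ← map_smul, ← map_smul, ← map_smul, ← map_add, ← map_add] at hpq
  have h0 := hX.immersion (e.symm s) (a₁ := L (p • Pi.single 0 1 + q • Pi.single 1 1)) (a₂ := 0)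
    (hpq.trans (map_zero (differential X (e.symm s))).symm)
  have h1 := hL.1 (h0.trans (map_zero L).symm)
  have e0 := congrFun h1 0
  have e1 := congrFun h1 1
  simp at e0 e1
  exact ⟨e0, e1⟩

theorem isNormalAt_normalVector [IsManifold 𝓘(ℝ, Fin 2 → ℝ) ∞ M]
    (hX : IsImmersedSurface X) (he : e ∈ atlas (Fin 2 → ℝ) M) {s : Fin 2 → ℝ}
    (hs : s ∈ e.target) : IsNormalAt X (e.symm s) (normalVector (X ∘ e.symm) s) :=
  (isNormalAt_chart_iff hX.smooth he hs _).2 fun a => normal_dotProduct_tangent _ _ a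

theorem IsNormalAt.exists_eq_smul [IsManifold 𝓘(ℝ, Fin 2 → ℝ) ∞ M]
    (hX : IsImmersedSurface X) (he : e ∈ atlas (Fin 2 → ℝ) M) {s : Fin 2 → ℝ}
    (hs : s ∈ e.target) {ν : Fin 3 → ℝ} (hν : IsNormalAt X (e.symm s) ν) :
    ∃ c : ℝ, ν = c • normalVector (X ∘ e.symm) s :=
  have h := (isNormalAt_chart_iff hX.smooth he hs ν).1 hν
  ⟨_, eq_smul_cross_of_dotProduct_eq_zero ((hX.isPatch he).normal_ne_zero s hs) (h 0) (h 1)⟩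

/-- A condition on all normals at a point, in terms of the normal of a chart. -/
theorem forall_isNormalAt_iff [IsManifold 𝓘(ℝ, Fin 2 → ℝ) ∞ M]
    (hX : IsImmersedSurface X) (he : e ∈ atlas (Fin 2 → ℝ) M) {s : Fin 2 → ℝ}
    (hs : s ∈ e.target) (x : Fin 3 → ℝ) :
    (∀ ν, IsNormalAt X (e.symm s) ν → ν ⬝ᵥ x = 0) ↔ normalVector (X ∘ e.symm) s ⬝ᵥ x = 0 := by
  refine ⟨fun h => h _ (isNormalAt_normalVector hX he hs), fun h ν hν => ?_⟩
  obtain ⟨c, rfl⟩ := hν.exists_eq_smul hX he hs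
  rw [smul_dotProduct, h, smul_zero]

theorem exists_chart (p : M) : ∃ e ∈ atlas (Fin 2 → ℝ) M, ∃ s ∈ e.target, e.symm s = p :=
  ⟨chartAt _ p, chart_mem_atlas _ p, chartAt _ p p, mem_chart_target _ p,
    (chartAt _ p).left_inv (mem_chart_source _ p)⟩

/-- Such a predicate is locally constant, hence constant on a connected surface. This is how local
statements in charts become global. -/
theorem iff_of_eventually_chart [ConnectedSpace M] {P : M → Prop}
    (h : ∀ e ∈ atlas (Fin 2 → ℝ) M, ∀ s ∈ e.target,
      ∀ᶠ s' in 𝓝 s, (P (e.symm s') ↔ P (e.symm s))) (p q : M) : P p ↔ P q := by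
  have hP : IsLocallyConstant P := by
    rw [IsLocallyConstant.iff_eventually_eq]
    intro p
    have h1 := h _ (chart_mem_atlas _ p) _ (mem_chart_target (Fin 2 → ℝ) p)
    have hc := (chartAt (Fin 2 → ℝ) p).continuousAt (mem_chart_source _ p)
    filter_upwards [hc.eventually h1, (chartAt (Fin 2 → ℝ) p).open_source.mem_nhds
      (mem_chart_source _ p)] with q hq hq'
    rw [(chartAt (Fin 2 → ℝ) p).left_inv hq', (chartAt (Fin 2 → ℝ) p).left_inv
      (mem_chart_source _ p)] at hq
    exact propext hq
  exact iff_of_eq (hP.apply_eq_of_preconnectedSpace p q)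

/-- Balls inside the chart target serve as the connected neighbourhoods. One implication is enough,
as the two points may be exchanged. -/
theorem iff_of_chart [ConnectedSpace M] {P : M → Prop}
    (h : ∀ e ∈ atlas (Fin 2 → ℝ) M, ∀ U ⊆ e.target, IsOpen U → IsPreconnected U →
      ∀ s ∈ U, ∀ s' ∈ U, P (e.symm s) → P (e.symm s')) (p q : M) : P p ↔ P q := by
  refine iff_of_eventually_chart (fun e he s hs => ?_) p q
  obtain ⟨r, hr, hb⟩ := Metric.isOpen_iff.1 e.open_target s hs
  have hpc : IsPreconnected (Metric.ball s r) := (convex_ball s r).isPreconnected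
  filter_upwards [Metric.ball_mem_nhds s hr] with s' hs'
  exact ⟨h e he _ hb Metric.isOpen_ball hpc _ hs' _ (Metric.mem_ball_self hr),
    h e he _ hb Metric.isOpen_ball hpc _ (Metric.mem_ball_self hr) _ hs'⟩

/-- A surface with a constant normal lies at a constant height. -/
theorem dotProduct_const_of_isNormalAt [IsManifold 𝓘(ℝ, Fin 2 → ℝ) ∞ M] [ConnectedSpace M]
    (hX : IsImmersedSurface X) {ν : Fin 3 → ℝ} (h : ∀ p, IsNormalAt X p ν) (p q : M) :
    ν ⬝ᵥ X p = ν ⬝ᵥ X q := by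
  refine ((iff_of_chart (P := fun q => ν ⬝ᵥ X p = ν ⬝ᵥ X q)
    (fun e he U hU hUo hUc s hs s' hs' hp => ?_) p q).1 rfl)
  refine hp.trans ?_
  have hY := (hX.isPatch he).mono hUo hU
  refine eq_of_hasLineDerivAt_zero (f := fun s => ν ⬝ᵥ (X ∘ e.symm) s) hUo hUc ?_ ?_ hs hs'
  · exact (contDiffOn_dotProduct contDiffOn_const hY.contDiffOn).differentiableOn (by simp)
  · intro s hs a
    have h1 := hY.hasLineDerivAt hs a
    unfold HasLineDerivAt at h1 ⊢
    refine (hasDerivAt_dotProduct (hasDerivAt_const (0 : ℝ) ν) h1).congr_deriv ?_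
    rw [(isNormalAt_chart_iff hX.smooth he (hU hs) ν).1 (h _) a]
    simp

/-! ### Isometries -/

variable {R : Matrix (Fin 3) (Fin 3) ℝ}

theorem differential_isometry (hX : IsImmersedSurface X)
    (R : Matrix (Fin 3) (Fin 3) ℝ) (c : Fin 3 → ℝ) (p : M) (w : Fin 2 → ℝ) :
    differential (fun p => Rᵀ *ᵥ (X p - c)) p w = Rᵀ *ᵥ differential X p w := by
  let L : (Fin 3 → ℝ) →L[ℝ] (Fin 3 → ℝ) := (Matrix.mulVecLin Rᵀ).toContinuousLinearMap
  have hL : ∀ x, HasFDerivAt (fun x => Rᵀ *ᵥ (x - c)) L x := fun x =>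
    L.hasFDerivAt.comp x ((hasFDerivAt_id x).sub_const c)
  have h := mfderiv_comp p (I := 𝓘(ℝ, Fin 2 → ℝ)) (g := fun x : Fin 3 → ℝ => Rᵀ *ᵥ (x - c))
    (hL (X p)).hasMFDerivAt.mdifferentiableAt ((hX.smooth.mdifferentiable (by simp)) p)
  unfold differential
  change mfderiv _ _ ((fun x : Fin 3 → ℝ => Rᵀ *ᵥ (x - c)) ∘ X) p w = _
  rw [h, (hL (X p)).hasMFDerivAt.mfderiv]
  rfl

theorem IsImmersedSurface.isometry (hX : IsImmersedSurface X)
    (hR : R ∈ Matrix.orthogonalGroup (Fin 3) ℝ) (c : Fin 3 → ℝ) :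
    IsImmersedSurface (fun p => Rᵀ *ᵥ (X p - c)) := by
  refine ⟨?_, fun p (w w' : Fin 2 → ℝ) h => ?_⟩
  · have hf : ContDiff ℝ ∞ (fun x : Fin 3 → ℝ => Rᵀ *ᵥ (x - c)) :=
      (Matrix.mulVecLin Rᵀ).toContinuousLinearMap.contDiff.comp (contDiff_id.sub contDiff_const)
    exact hf.contMDiff.comp hX.smooth
  · have h1 : Rᵀ *ᵥ differential X p w = Rᵀ *ᵥ differential X p w' := by
      rw [← differential_isometry hX R c, ← differential_isometry hX R c]
      exact h
    have h2 := congrArg (R *ᵥ ·) h1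
    simp only [orthogonal_mulVec_transpose hR] at h2
    exact hX.immersion p h2

theorem isNormalAt_isometry_iff (hX : IsImmersedSurface X)
    (hR : R ∈ Matrix.orthogonalGroup (Fin 3) ℝ) (c : Fin 3 → ℝ) (p : M) (ν : Fin 3 → ℝ) :
    IsNormalAt (fun p => Rᵀ *ᵥ (X p - c)) p ν ↔ IsNormalAt X p (R *ᵥ ν) := by
  refine forall_congr' fun w => ?_
  rw [differential_isometry hX, ← orthogonal_dotProduct hR, orthogonal_mulVec_transpose hR]

theorem eq_mulVec_isometry (hR : R ∈ Matrix.orthogonalGroup (Fin 3) ℝ) (c x : Fin 3 → ℝ) :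
    R *ᵥ (Rᵀ *ᵥ (x - c)) + c = x := by
  rw [orthogonal_mulVec_transpose hR, sub_add_cancel]

theorem mulVec_comp_isometry (R R' : Matrix (Fin 3) (Fin 3) ℝ) (x v c : Fin 3 → ℝ) :
    R *ᵥ (R' *ᵥ x + v) + c = (R * R') *ᵥ x + (R *ᵥ v + c) := by
  rw [Matrix.mulVec_add, Matrix.mulVec_mulVec, add_assoc]

end Immersed

/-! ### Surfaces on planes and helicoids -/

section Position

variable {M : Type*} {X : M → (Fin 3 → ℝ)} {R : Matrix (Fin 3) (Fin 3) ℝ}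

theorem liesOnPlane_of_isometry (hR : R ∈ Matrix.orthogonalGroup (Fin 3) ℝ) (c : Fin 3 → ℝ)
    (h : LiesOnPlane (fun p => Rᵀ *ᵥ (X p - c))) : LiesOnPlane X := by
  obtain ⟨R', hR', v, h⟩ := h
  refine ⟨R * R', mul_mem hR hR', R *ᵥ v + c, fun p => ?_⟩
  obtain ⟨s, hs⟩ := h p
  exact ⟨s, by rw [← mulVec_comp_isometry, ← hs, eq_mulVec_isometry hR]⟩

theorem liesOnHelicoid_of_isometry (hR : R ∈ Matrix.orthogonalGroup (Fin 3) ℝ) (c : Fin 3 → ℝ)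
    (h : LiesOnHelicoid (fun p => Rᵀ *ᵥ (X p - c))) : LiesOnHelicoid X := by
  obtain ⟨a, l, ha, hl, R', hR', v, h⟩ := h
  refine ⟨a, l, ha, hl, R * R', mul_mem hR hR', R *ᵥ v + c, fun p => ?_⟩
  obtain ⟨s, hs⟩ := h p
  exact ⟨s, by rw [← mulVec_comp_isometry, ← hs, eq_mulVec_isometry hR]⟩

theorem liesOnPlane_of_const_height {d : ℝ} (h : ∀ p, X p 2 = d) : LiesOnPlane X := by
  refine ⟨1, one_mem _, ![0, 0, d], fun p => ⟨![X p 0, X p 1], ?_⟩⟩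
  funext i
  rw [Matrix.one_mulVec]
  fin_cases i <;> simp [planeMap, h]

theorem liesOnPlane_of_dotProduct_const {ν : Fin 3 → ℝ} (hν : ν ≠ 0) {d : ℝ}
    (h : ∀ p, ν ⬝ᵥ X p = d) : LiesOnPlane X := by
  obtain ⟨R, hR, c, hc, hw, -⟩ := exists_adapted_frame hν
  refine liesOnPlane_of_isometry hR 0 (liesOnPlane_of_const_height (d := d / c) fun p => ?_)
  rw [eq_div_iff hc, mul_comm, ← hw, orthogonal_mulVec_transpose hR, sub_zero, h]

theorem _root_.LiesOnPlane.exists_dotProduct_const (h : LiesOnPlane X) :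
    ∃ ν : Fin 3 → ℝ, ν ≠ 0 ∧ ∃ d, ∀ p, ν ⬝ᵥ X p = d := by
  obtain ⟨R, hR, v, h⟩ := h
  refine ⟨R *ᵥ ![0, 0, 1], fun h0 => ?_, (R *ᵥ ![0, 0, 1]) ⬝ᵥ v, fun p => ?_⟩
  · have := congrArg (Rᵀ *ᵥ ·) h0
    simp only [orthogonal_transpose_mulVec hR, Matrix.mulVec_zero] at this
    simpa using congrFun this 2
  · obtain ⟨s, hs⟩ := h p
    rw [hs, dotProduct_add, orthogonal_dotProduct hR, dotProduct_fin_three]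
    simp [planeMap]

end Position

/-! ### Geometry of Type I worldvolumes -/

section Worldvolume

variable {n : ℕ} {x : (Fin 2 → ℝ) → (Fin 3 → ℝ)} {U : Set (Fin 2 → ℝ)} {s : Fin 2 → ℝ}

/-- The coordinates `x₁, x₂, x₃` of a space-time point. -/
def spacePart {n : ℕ} (ν : SpacetimeIndex n → ℝ) : Fin 3 → ℝ := fun i => ν (Sum.inr (Sum.inl i))

@[simp]
theorem spacePart_spacetimePoint (t : ℝ) (v : Fin 3 → ℝ) :
    spacePart (spacetimePoint n t v) = v := rfl

@[simp]
theorem spacetimePoint_time (t : ℝ) (v : Fin 3 → ℝ) :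
    spacetimePoint n t v (Sum.inl 0) = t := rfl

theorem flatMetric_spacetimePoint (ν : SpacetimeIndex n → ℝ) (t : ℝ) (v : Fin 3 → ℝ) :
    flatMetric (minkowski n) ν (spacetimePoint n t v) =
      -(ν (Sum.inl 0) * t) + spacePart ν ⬝ᵥ v := by
  simp [flatMetric, minkowski, spacetimePoint, spacePart, dotProduct, Fintype.sum_sum_type]

theorem spacetimePoint_add (t t' : ℝ) (v v' : Fin 3 → ℝ) :
    spacetimePoint n (t + t') (v + v') = spacetimePoint n t v + spacetimePoint n t' v' := by
  funext i
  rcases i with i | i | i <;> simp [spacetimePoint]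

theorem spacetimePoint_smul (c t : ℝ) (v : Fin 3 → ℝ) :
    spacetimePoint n (c * t) (c • v) = c • spacetimePoint n t v := by
  funext i
  rcases i with i | i | i <;> simp [spacetimePoint]

theorem spacetimePoint_zero : spacetimePoint n 0 0 = 0 := by
  funext i
  rcases i with i | i | i <;> simp [spacetimePoint]

/-- The inclusion of `ℝ³` in space-time. -/
noncomputable def spaceInclusion (n : ℕ) : (Fin 3 → ℝ) →L[ℝ] (SpacetimeIndex n → ℝ) :=
  LinearMap.toContinuousLinearMap
    { toFun := fun v => spacetimePoint n 0 v
      map_add' := fun v w => by rw [← spacetimePoint_add, add_zero]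
      map_smul' := fun c v => by rw [RingHom.id_apply, ← spacetimePoint_smul, mul_zero] }

/-- The inclusion of the time axis, as a map of the worldvolume coordinates. -/
noncomputable def timeInclusion (n : ℕ) : (WorldvolumeIndex → ℝ) →L[ℝ] (SpacetimeIndex n → ℝ) :=
  LinearMap.toContinuousLinearMap
    { toFun := fun s => spacetimePoint n (s (Sum.inl 0)) 0
      map_add' := fun v w => by rw [← spacetimePoint_add, add_zero, Pi.add_apply]
      map_smul' := fun c v => by
        rw [RingHom.id_apply, ← spacetimePoint_smul, smul_zero, Pi.smul_apply, smul_eq_mul] }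

/-- The projection of the worldvolume coordinates to the coordinates of the surface. -/
noncomputable def surfaceProjection : (WorldvolumeIndex → ℝ) →L[ℝ] (Fin 2 → ℝ) :=
  ContinuousLinearMap.pi fun a => ContinuousLinearMap.proj (Sum.inr a)

@[simp]
theorem surfaceProjection_worldvolumePoint (τ : ℝ) (s : Fin 2 → ℝ) :
    surfaceProjection (worldvolumePoint τ s) = s := rfl

theorem surfaceProjection_single_inl (c : Fin 1) :
    surfaceProjection (Pi.single (Sum.inl c) 1) = 0 := by
  funext a
  simp [surfaceProjection]

theorem surfaceProjection_single_inr (a : Fin 2) :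
    surfaceProjection (Pi.single (Sum.inr a) 1) = Pi.single a 1 := by
  funext c
  simp [surfaceProjection, Pi.single_apply]

theorem typeIEmbedding_eq (n : ℕ) (x : (Fin 2 → ℝ) → (Fin 3 → ℝ)) :
    typeIEmbedding n x =
      fun s => timeInclusion n s + spaceInclusion n (x (surfaceProjection s)) := by
  funext s
  change _ = spacetimePoint n (s (Sum.inl 0)) 0 + spacetimePoint n 0 (x (surfaceProjection s))
  rw [← spacetimePoint_add, add_zero, zero_add]
  rfl

theorem fderiv_typeIEmbedding {s : WorldvolumeIndex → ℝ}
    (hx : DifferentiableAt ℝ x (surfaceProjection s)) (v : WorldvolumeIndex → ℝ) :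
    fderiv ℝ (typeIEmbedding n x) s v =
      spacetimePoint n (v (Sum.inl 0)) (fderiv ℝ x (surfaceProjection s) (surfaceProjection v)) := by
  have h : HasFDerivAt (typeIEmbedding n x) (timeInclusion n + (spaceInclusion n).comp
      ((fderiv ℝ x (surfaceProjection s)).comp surfaceProjection)) s := by
    rw [typeIEmbedding_eq]
    exact (timeInclusion n).hasFDerivAt.add ((spaceInclusion n).hasFDerivAt.comp s
      (hx.hasFDerivAt.comp s surfaceProjection.hasFDerivAt))
  rw [h.fderiv]
  change spacetimePoint n (v (Sum.inl 0)) 0 + spacetimePoint n 0 _ = _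
  rw [← spacetimePoint_add, add_zero, zero_add]
  rfl

theorem tangentVector_typeIEmbedding_inl {s : WorldvolumeIndex → ℝ}
    (hx : DifferentiableAt ℝ x (surfaceProjection s)) (c : Fin 1) :
    tangentVector (typeIEmbedding n x) s (Sum.inl c) = spacetimePoint n 1 0 := by
  unfold tangentVector
  rw [fderiv_typeIEmbedding hx, surfaceProjection_single_inl, map_zero, Subsingleton.elim c 0,
    Pi.single_eq_same]

theorem tangentVector_typeIEmbedding_inr {s : WorldvolumeIndex → ℝ}
    (hx : DifferentiableAt ℝ x (surfaceProjection s)) (a : Fin 2) :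
    tangentVector (typeIEmbedding n x) s (Sum.inr a) =
      spacetimePoint n 0 (tangentVector x (surfaceProjection s) a) := by
  unfold tangentVector
  rw [fderiv_typeIEmbedding hx, surfaceProjection_single_inr, Pi.single_eq_of_ne (by simp)]

theorem eventually_surfaceProjection_mem (hU : IsOpen U) {s : WorldvolumeIndex → ℝ}
    (hs : surfaceProjection s ∈ U) : ∀ᶠ s' in 𝓝 s, surfaceProjection s' ∈ U :=
  surfaceProjection.continuous.continuousAt (hU.mem_nhds hs)

theorem secondDerivative_typeIEmbedding_inl (hx : IsPatch x U) {s : WorldvolumeIndex → ℝ}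
    (hs : surfaceProjection s ∈ U) (i : WorldvolumeIndex) (c : Fin 1) :
    secondDerivative (typeIEmbedding n x) s i (Sum.inl c) = 0 := by
  have h : (fun s' => tangentVector (typeIEmbedding n x) s' (Sum.inl c)) =ᶠ[𝓝 s]
      fun _ => spacetimePoint n 1 0 := by
    filter_upwards [eventually_surfaceProjection_mem hx.isOpen hs] with s' hs'
    exact tangentVector_typeIEmbedding_inl (hx.differentiableAt hs') c
  unfold secondDerivative
  rw [h.fderiv_eq]
  simp

theorem fderiv_tangentVector_typeIEmbedding (hx : IsPatch x U) {s : WorldvolumeIndex → ℝ}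
    (hs : surfaceProjection s ∈ U) (i : WorldvolumeIndex) (a : Fin 2) :
    secondDerivative (typeIEmbedding n x) s i (Sum.inr a) =
      spacetimePoint n 0 (fderiv ℝ (fun s' => tangentVector x s' a) (surfaceProjection s)
        (surfaceProjection (Pi.single i 1))) := by
  have h : (fun s' => tangentVector (typeIEmbedding n x) s' (Sum.inr a)) =ᶠ[𝓝 s]
      fun s' => spaceInclusion n (tangentVector x (surfaceProjection s') a) := by
    filter_upwards [eventually_surfaceProjection_mem hx.isOpen hs] with s' hs'
    exact tangentVector_typeIEmbedding_inr (hx.differentiableAt hs') a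
  have hd := (differentiableAt_tangentVector hx.isOpen hx.contDiffOn hs a).hasFDerivAt
  unfold secondDerivative
  have hf : HasFDerivAt (fun s' => spaceInclusion n (tangentVector x (surfaceProjection s') a)) _ s :=
    (spaceInclusion n).hasFDerivAt.comp s (hd.comp s surfaceProjection.hasFDerivAt)
  rw [h.fderiv_eq, hf.fderiv]
  rfl

theorem secondDerivative_typeIEmbedding_inr_inr (hx : IsPatch x U) {s : WorldvolumeIndex → ℝ}
    (hs : surfaceProjection s ∈ U) (a b : Fin 2) :
    secondDerivative (typeIEmbedding n x) s (Sum.inr a) (Sum.inr b) =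
      spacetimePoint n 0 (secondDerivative x (surfaceProjection s) a b) := by
  rw [fderiv_tangentVector_typeIEmbedding hx hs, surfaceProjection_single_inr]
  rfl

theorem secondDerivative_typeIEmbedding_inl_inr (hx : IsPatch x U) {s : WorldvolumeIndex → ℝ}
    (hs : surfaceProjection s ∈ U) (c : Fin 1) (b : Fin 2) :
    secondDerivative (typeIEmbedding n x) s (Sum.inl c) (Sum.inr b) = 0 := by
  rw [fderiv_tangentVector_typeIEmbedding hx hs, surfaceProjection_single_inl, map_zero,
    spacetimePoint_zero]

theorem pushesForwardTo_iff (hx : IsPatch x U) (hs : s ∈ U)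
    (k : (SpacetimeIndex n → ℝ) → (SpacetimeIndex n → ℝ)) (τ : ℝ) (χ : Fin 2 → ℝ) :
    PushesForwardTo n x k (worldvolumePoint τ s) χ ↔
      spacetimePoint n 1 (χ 0 • tangentVector x s 0 + χ 1 • tangentVector x s 1) =
        k (spacetimePoint n τ (x s)) := by
  unfold PushesForwardTo
  have hd : DifferentiableAt ℝ x (surfaceProjection (worldvolumePoint τ s)) :=
    hx.differentiableAt hs
  have h : ∑ a, worldvolumePoint 1 χ a • tangentVector (typeIEmbedding n x)
      (worldvolumePoint τ s) a =
      spacetimePoint n 1 (χ 0 • tangentVector x s 0 + χ 1 • tangentVector x s 1) := by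
    rw [Fintype.sum_sum_type, Fin.sum_univ_one, Fin.sum_univ_two,
      tangentVector_typeIEmbedding_inl hd, tangentVector_typeIEmbedding_inr hd,
      tangentVector_typeIEmbedding_inr hd, ← spacetimePoint_smul, ← spacetimePoint_smul,
      ← spacetimePoint_smul, ← spacetimePoint_add, ← spacetimePoint_add,
      surfaceProjection_worldvolumePoint]
    simp [worldvolumePoint]
  rw [h]
  rfl

theorem isNormalVector_typeIEmbedding_iff (hx : IsPatch x U) (hs : s ∈ U) (τ : ℝ)
    (ν : SpacetimeIndex n → ℝ) :
    IsNormalVector (minkowski n) (typeIEmbedding n x) (worldvolumePoint τ s) ν ↔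
      ν (Sum.inl 0) = 0 ∧ ∀ a, spacePart ν ⬝ᵥ tangentVector x s a = 0 := by
  have hd : DifferentiableAt ℝ x (surfaceProjection (worldvolumePoint τ s)) :=
    hx.differentiableAt hs
  unfold IsNormalVector
  rw [Sum.forall]
  simp only [tangentVector_typeIEmbedding_inl hd, tangentVector_typeIEmbedding_inr hd,
    flatMetric_spacetimePoint]
  simp

theorem det_inducedMetric (x : (Fin 2 → ℝ) → (Fin 3 → ℝ)) (s : Fin 2 → ℝ) :
    (inducedMetric (fun _ => 1) x s).det = normalVector x s ⬝ᵥ normalVector x s := by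
  rw [Matrix.det_fin_two, normalVector, normal_dotProduct_self]
  simp only [inducedMetric, Matrix.of_apply, flatMetric_one,
    dotProduct_comm (tangentVector x s 1) (tangentVector x s 0)]

/-- The induced metric is block diagonal with time block `-1`, and second derivatives of the
embedding with a time index vanish, so only the surface block contributes to the trace. -/
theorem meanCurvature_typeIEmbedding (hx : IsPatch x U) (hs : s ∈ U) (τ : ℝ)
    (ν : SpacetimeIndex n → ℝ) :
    meanCurvature (minkowski n) (typeIEmbedding n x) (worldvolumePoint τ s) ν =
      meanCurvature (fun _ => 1) x s (spacePart ν) := by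
  have hs' : surfaceProjection (worldvolumePoint τ s) ∈ U := hs
  have hd := hx.differentiableAt hs'
  have hγ : inducedMetric (minkowski n) (typeIEmbedding n x) (worldvolumePoint τ s) =
      Matrix.fromBlocks (-1) 0 0 (inducedMetric (fun _ => 1) x s) := by
    ext i j
    rcases i with i | i <;> rcases j with j | j <;>
    simp [inducedMetric, tangentVector_typeIEmbedding_inl hd, tangentVector_typeIEmbedding_inr hd,
      flatMetric_spacetimePoint, flatMetric_one]
    rw [Subsingleton.elim i j, Matrix.one_apply_eq]
  have hu : IsUnit (inducedMetric (fun _ => 1) x s) := by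
    rw [Matrix.isUnit_iff_isUnit_det, det_inducedMetric]
    exact (hx.normSq_ne_zero hs).isUnit
  have hinv : (inducedMetric (minkowski n) (typeIEmbedding n x) (worldvolumePoint τ s))⁻¹ =
      Matrix.fromBlocks (-1)⁻¹ 0 0 (inducedMetric (fun _ => 1) x s)⁻¹ := by
    rw [hγ, Matrix.inv_fromBlocks_zero₂₁_of_isUnit_iff _ _ _
      (iff_of_true (isUnit_one (M := Matrix (Fin 1) (Fin 1) ℝ)).neg hu)]
    simp
  unfold meanCurvature
  rw [hinv]
  simp [Fintype.sum_sum_type, extrinsicCurvature, secondDerivative_typeIEmbedding_inl hx hs',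
    secondDerivative_typeIEmbedding_inr_inr hx hs', flatMetric_spacetimePoint, flatMetric_one,
    Matrix.fromBlocks]
  simp [flatMetric]

/-- The component 1 of the velocity along `∂_τ` meets only vanishing second derivatives, which
leaves `K(χ, χ)`. -/
theorem extrinsicCurvature_typeIEmbedding_sum (hx : IsPatch x U) (hs : s ∈ U) (τ : ℝ)
    (ν : SpacetimeIndex n → ℝ) (χ : Fin 2 → ℝ) (r : ℝ) :
    ∑ a, ∑ b, (worldvolumePoint 1 χ a / r) * (worldvolumePoint 1 χ b / r) *
        extrinsicCurvature (minkowski n) (typeIEmbedding n x) (worldvolumePoint τ s) ν a b =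
      (∑ a, ∑ b, χ a * χ b * (spacePart ν ⬝ᵥ secondDerivative x s a b)) / r ^ 2 := by
  have hs' : surfaceProjection (worldvolumePoint τ s) ∈ U := hs
  have h0 : flatMetric (minkowski n) ν 0 = 0 := by simp [flatMetric]
  simp only [Fintype.sum_sum_type, extrinsicCurvature, Matrix.of_apply,
    secondDerivative_typeIEmbedding_inl hx hs', secondDerivative_typeIEmbedding_inl_inr hx hs',
    secondDerivative_typeIEmbedding_inr_inr hx hs', flatMetric_spacetimePoint, h0, mul_zero,
    Finset.sum_const_zero, zero_add, neg_zero, surfaceProjection_worldvolumePoint,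
    Finset.sum_div]
  refine Finset.sum_congr rfl fun a _ => Finset.sum_congr rfl fun b _ => ?_
  simp only [worldvolumePoint, Sum.elim_inr]
  ring

/-- On the worldvolume of a minimal surface, the blackfold equation is the vanishing of the
curvature `K(χ, χ)` of the surface. -/
theorem blackfoldEquationAt_iff (hn : 1 ≤ n) (hx : IsPatch x U) (hs : s ∈ U) (τ : ℝ)
    (hmin : ∀ ν, IsNormalVector (fun _ => 1) x s ν → meanCurvature (fun _ => 1) x s ν = 0)
    {χ : Fin 2 → ℝ}
    (hpos : 0 < modulusSq n (typeIEmbedding n x) (worldvolumePoint τ s) (worldvolumePoint 1 χ)) :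
    BlackfoldEquationAt n (typeIEmbedding n x) (worldvolumePoint τ s) (worldvolumePoint 1 χ) ↔
      ∑ a, ∑ b, χ a * χ b * (normalVector x s ⬝ᵥ secondDerivative x s a b) = 0 := by
  have hn' : (n : ℝ) ≠ 0 := by positivity
  unfold BlackfoldEquationAt
  simp only [meanCurvature_typeIEmbedding hx hs, isNormalVector_typeIEmbedding_iff hx hs,
    extrinsicCurvature_typeIEmbedding_sum hx hs, Real.sq_sqrt hpos.le]
  have hm : ∀ ν : Fin 3 → ℝ, (∀ a, ν ⬝ᵥ tangentVector x s a = 0) →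
      meanCurvature (fun _ => 1) x s ν = 0 := fun ν hν =>
    hmin ν fun a => by rw [flatMetric_one]; exact hν a
  constructor
  · intro h
    have h1 := h (spacetimePoint n 0 (normalVector x s))
      ⟨rfl, fun a => normal_dotProduct_tangent x s a⟩
    -- Minimality kills the left-hand side; the factors `n` and `1 / 𝐤²` on the right are nonzero
    -- and can be cancelled.
    rw [spacePart_spacetimePoint, hm _ fun a => normal_dotProduct_tangent x s a] at h1
    have h2 := (mul_eq_zero.1 h1.symm).resolve_left hn'
    exact (div_eq_zero_iff.1 h2).resolve_right hpos.ne'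
  · rintro h ν ⟨-, hν⟩
    obtain ⟨c, hc⟩ : ∃ c : ℝ, spacePart ν = c • normalVector x s :=
      ⟨_, eq_smul_cross_of_dotProduct_eq_zero (hx.normal_ne_zero s hs) (hν 0) (hν 1)⟩
    rw [hm _ hν, hc]
    have h3 : ∑ a, ∑ b, χ a * χ b * ((c • normalVector x s) ⬝ᵥ secondDerivative x s a b) =
        c * ∑ a, ∑ b, χ a * χ b * (normalVector x s ⬝ᵥ secondDerivative x s a b) := by
      simp only [Finset.mul_sum, smul_dotProduct, smul_eq_mul]
      refine Finset.sum_congr rfl fun a _ => Finset.sum_congr rfl fun b _ => ?_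
      ring
    rw [h3, h]
    simp

/-- Write the inverse metric as adjugate over determinant; the determinant is `|N|²` and is cleared.
-/
theorem isMinimalPatch_of_meanCurvature (hx : IsPatch x U)
    (hmin : ∀ s ∈ U, ∀ ν, IsNormalVector (fun _ => 1) x s ν →
      meanCurvature (fun _ => 1) x s ν = 0) : IsMinimalPatch x U := by
  intro s hs
  have h := hmin s hs (normalVector x s) fun a => by
    rw [flatMetric_one]; exact normal_dotProduct_tangent x s a
  have hne := hx.normSq_ne_zero hs
  unfold meanCurvature at h
  rw [Matrix.inv_def, Matrix.adjugate_fin_two, det_inducedMetric, Ring.inverse_eq_inv'] at h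
  simp only [Fin.sum_univ_two, Matrix.smul_apply, Matrix.of_apply, Matrix.cons_val,
    inducedMetric, extrinsicCurvature, flatMetric_one, smul_eq_mul,
    secondDerivative_comm hx.isOpen hx.contDiffOn hs 1 0,
    dotProduct_comm (tangentVector x s 1) (tangentVector x s 0)] at h
  field_simp at h
  simp at h
  linear_combination h

end Worldvolume

/-! ### Stationary minimal surfaces -/

section Stationary

variable {M : Type*} [TopologicalSpace M] [ChartedSpace (Fin 2 → ℝ) M]
  {X : M → (Fin 3 → ℝ)} {n : ℕ} {k : (SpacetimeIndex n → ℝ) → (SpacetimeIndex n → ℝ)}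
  {w b : Fin 3 → ℝ} {W : Set M}

/-- The Killing field `w × x + b` of Euclidean space is tangent to the surface `X`. -/
def IsTangentKillingField (X : M → (Fin 3 → ℝ)) (w b : Fin 3 → ℝ) : Prop :=
  ∀ p ν, IsNormalAt X p ν → ν ⬝ᵥ (crossProduct w (X p) + b) = 0

/-- The acceleration `w × (w × x + b)` of the Killing field `w × x + b` is tangent to the
surface `X` at `p`. -/
def IsTangentAcceleration (X : M → (Fin 3 → ℝ)) (w b : Fin 3 → ℝ) (p : M) : Prop :=
  ∀ ν, IsNormalAt X p ν → ν ⬝ᵥ crossProduct w (crossProduct w (X p) + b) = 0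

theorem minkowski_ne_zero (μ : SpacetimeIndex n) : minkowski n μ ≠ 0 := by
  rcases μ with μ | μ <;> simp [minkowski]

theorem mulVec_spacetimePoint (A : Matrix (SpacetimeIndex n) (SpacetimeIndex n) ℝ) (t : ℝ)
    (v : Fin 3 → ℝ) (μ : SpacetimeIndex n) :
    (A *ᵥ spacetimePoint n t v) μ =
      A μ (Sum.inl 0) * t + (fun j => A μ (Sum.inr (Sum.inl j))) ⬝ᵥ v := by
  simp [Matrix.mulVec, dotProduct, Fintype.sum_sum_type, spacetimePoint]

/-- A stationary surface lies on a plane, or the Killing field restricts to a time-independent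
Killing field of Euclidean space that is tangent to the surface. -/
theorem _root_.IsStationaryTypeI.liesOnPlane_or_exists [IsManifold 𝓘(ℝ, Fin 2 → ℝ) ∞ M]
    (hX : IsImmersedSurface X) (hk : IsStationaryTypeI n X k) :
    LiesOnPlane X ∨ ∃ w b : Fin 3 → ℝ, (w = 0 → b ≠ 0) ∧ IsTangentKillingField X w b ∧
      ∀ τ p, k (spacetimePoint n τ (X p)) = spacetimePoint n 1 (crossProduct w (X p) + b) := by
  obtain ⟨A, c, hA, hskew⟩ := hk.killing.exists_affine minkowski_ne_zero
  have htan : ∀ p τ, ∃ v : Fin 3 → ℝ, k (spacetimePoint n τ (X p)) = spacetimePoint n 1 v ∧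
      ∀ ν, IsNormalAt X p ν → ν ⬝ᵥ v = 0 := by
    intro p τ
    obtain ⟨e, he, s, hs, rfl⟩ := exists_chart p
    obtain ⟨χ, hχ⟩ := hk.tangent e he s hs τ
    rw [pushesForwardTo_iff (hX.isPatch he) hs] at hχ
    refine ⟨_, hχ.symm, fun ν hν => ?_⟩
    have h := (isNormalAt_chart_iff hX.smooth he hs ν).1 hν
    rw [dotProduct_add, dotProduct_smul, dotProduct_smul, h, h]
    simp
  have h00 : A (Sum.inl 0) (Sum.inl 0) = 0 := by
    have := hskew (Sum.inl 0) (Sum.inl 0)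
    simp [minkowski] at this
    linarith
  -- The image of `∂_τ + χ` has time component exactly 1. If the boost part of `A` is nonzero, this
  -- linear equation confines the surface to a plane.
  have htime : ∀ p, (fun j => A (Sum.inl 0) (Sum.inr (Sum.inl j))) ⬝ᵥ X p =
      1 - c (Sum.inl 0) := by
    intro p
    obtain ⟨v, hv, -⟩ := htan p 0
    have h := congrFun hv (Sum.inl 0)
    rw [hA, Pi.add_apply, mulVec_spacetimePoint, h00, spacetimePoint_time] at h
    linarith
  by_cases ha : (fun j => A (Sum.inl 0) (Sum.inr (Sum.inl j))) = 0
  · right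
    -- Skewness with respect to the Minkowski metric links the two mixed blocks: without a
    -- time-space block, `k` does not depend on `τ`.
    have hi0 : ∀ i : Fin 3, A (Sum.inr (Sum.inl i)) (Sum.inl 0) = 0 := by
      intro i
      have h1 := hskew (Sum.inr (Sum.inl i)) (Sum.inl 0)
      have h2 := congrFun ha i
      simp only [minkowski, Sum.elim_inl, Sum.elim_inr, Pi.zero_apply] at h1 h2
      linarith
    let B : Matrix (Fin 3) (Fin 3) ℝ :=
      Matrix.of fun i j => A (Sum.inr (Sum.inl i)) (Sum.inr (Sum.inl j))
    have hB : ∀ i j, B i j + B j i = 0 := by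
      intro i j
      have := hskew (Sum.inr (Sum.inl i)) (Sum.inr (Sum.inl j))
      simpa [minkowski, B] using this
    have hk' : ∀ τ p, k (spacetimePoint n τ (X p)) = spacetimePoint n 1
        (crossProduct ![B 2 1, B 0 2, B 1 0] (X p) + spacePart c) := by
      intro τ p
      obtain ⟨v, hv, -⟩ := htan p τ
      rw [hv, ← skew_mulVec_eq_cross hB]
      congr 1
      funext i
      have h := congrFun hv (Sum.inr (Sum.inl i))
      rw [hA, Pi.add_apply, mulVec_spacetimePoint, hi0, zero_mul, zero_add] at h
      exact h.symm
    refine ⟨_, _, ?_, ?_, hk'⟩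
    -- If `w` and `b` both vanished, then `χ` would vanish at every point, by independence of the
    -- tangent vectors, against `nonstatic`.
    · intro hw hb
      obtain ⟨e, he, s, hs, τ, χ, hχ, hne⟩ := hk.nonstatic
      rw [pushesForwardTo_iff (hX.isPatch he) hs, Function.comp_apply, hk', hw, hb] at hχ
      have h1 := congrArg spacePart hχ
      simp only [spacePart_spacetimePoint, map_zero, LinearMap.zero_apply, add_zero] at h1
      have h2 := linearCombination_eq_zero_of_cross_ne_zero
        ((hX.isPatch he).normal_ne_zero s hs) h1
      refine hne (funext fun a => ?_)
      fin_cases a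
      · exact h2.1
      · exact h2.2
    · intro p ν hν
      obtain ⟨v, hv, hv'⟩ := htan p 0
      rw [hk'] at hv
      have := congrArg spacePart hv
      rw [spacePart_spacetimePoint, spacePart_spacetimePoint] at this
      rw [this]
      exact hv' ν hν
  · exact Or.inl (liesOnPlane_of_dotProduct_const ha htime)

variable [IsManifold 𝓘(ℝ, Fin 2 → ℝ) ∞ M]

theorem IsTangentKillingField.chart (hX : IsImmersedSurface X)
    (ht : IsTangentKillingField X w b) {e : OpenPartialHomeomorph M (Fin 2 → ℝ)}
    (he : e ∈ atlas (Fin 2 → ℝ) M) (s : Fin 2 → ℝ) (hs : s ∈ e.target) :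
    normalVector (X ∘ e.symm) s ⬝ᵥ (crossProduct w ((X ∘ e.symm) s) + b) = 0 :=
  ht _ _ (isNormalAt_normalVector hX he hs)

theorem isMinimalPatch_chart (hX : IsMinimalSurface X)
    {e : OpenPartialHomeomorph M (Fin 2 → ℝ)} (he : e ∈ atlas (Fin 2 → ℝ) M) :
    IsMinimalPatch (X ∘ e.symm) e.target :=
  isMinimalPatch_of_meanCurvature (hX.isImmersedSurface.isPatch he) (hX.minimal e he)

/-- In a chart, the blackfold equation is the vanishing of `K(χ, χ)`. -/
theorem solvesBlackfoldEquation_iff (hn : 1 ≤ n) (hX : IsMinimalSurface X)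
    (hW : W ⊆ timelikeRegion n X k) :
    SolvesBlackfoldEquation n X k W ↔
      ∀ e ∈ atlas (Fin 2 → ℝ) M, ∀ s ∈ e.target, e.symm s ∈ W → ∀ (τ : ℝ) (χ : Fin 2 → ℝ),
        PushesForwardTo n (X ∘ e.symm) k (worldvolumePoint τ s) χ →
          ∑ c, ∑ d, χ c * χ d *
            (normalVector (X ∘ e.symm) s ⬝ᵥ secondDerivative (X ∘ e.symm) s c d) = 0 := by
  refine forall₂_congr fun e he => forall₂_congr fun s hs => forall_congr' fun hsW =>
    forall₃_congr fun τ χ hχ => ?_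
  refine blackfoldEquationAt_iff hn (hX.isImmersedSurface.isPatch he) hs τ
    (hX.minimal e he s hs) ?_
  rw [modulusSq_eq n _ _ _ _ hχ]
  exact hW hsW τ

/-- `K(χ, χ)` is the normal component of the acceleration, which depends on neither the chart nor
`τ`; tangency of `k` supplies the `χ` needed to pass from the equation to the acceleration. -/
theorem solvesBlackfoldEquation_iff_acceleration (hn : 1 ≤ n) (hX : IsMinimalSurface X)
    (hk : IsStationaryTypeI n X k) (ht : IsTangentKillingField X w b)
    (hkwb : ∀ τ p, k (spacetimePoint n τ (X p)) =
      spacetimePoint n 1 (crossProduct w (X p) + b))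
    (hW : W ⊆ timelikeRegion n X k) :
    SolvesBlackfoldEquation n X k W ↔ ∀ p ∈ W, IsTangentAcceleration X w b p := by
  have hX' := hX.isImmersedSurface
  have key : ∀ e ∈ atlas (Fin 2 → ℝ) M, ∀ s ∈ e.target, ∀ (τ : ℝ) (χ : Fin 2 → ℝ),
      PushesForwardTo n (X ∘ e.symm) k (worldvolumePoint τ s) χ →
      (∑ c, ∑ d, χ c * χ d *
        (normalVector (X ∘ e.symm) s ⬝ᵥ secondDerivative (X ∘ e.symm) s c d) = 0 ↔
        IsTangentAcceleration X w b (e.symm s)) := by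
    intro e he s hs τ χ hχ
    rw [pushesForwardTo_iff (hX'.isPatch he) hs, Function.comp_apply, hkwb] at hχ
    rw [(hX'.isPatch he).acceleration_eq (ht.chart hX' he) hs (congrArg spacePart hχ)]
    exact (forall_isNormalAt_iff hX' he hs _).symm
  rw [solvesBlackfoldEquation_iff hn hX hW]
  constructor
  · intro h p hp
    obtain ⟨e, he, s, hs, rfl⟩ := exists_chart p
    obtain ⟨χ, hχ⟩ := hk.tangent e he s hs 0
    exact (key e he s hs 0 χ hχ).1 (h e he s hs hp 0 χ hχ)
  · intro h e he s hs hsW τ χ hχ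
    exact (key e he s hs τ χ hχ).2 (h _ hsW)

/-- A fixed vector `ν` normal to the plane annihilates first derivatives and then second
derivatives. Being a nonzero multiple of the surface normal, it forces the second fundamental form
to vanish. -/
theorem solvesBlackfoldEquation_of_liesOnPlane (hn : 1 ≤ n) (hX : IsMinimalSurface X)
    (hW : W ⊆ timelikeRegion n X k) (hp : LiesOnPlane X) : SolvesBlackfoldEquation n X k W := by
  rw [solvesBlackfoldEquation_iff hn hX hW]
  intro e he s hs hsW τ χ hχ
  obtain ⟨ν, hν, d, hd⟩ := hp.exists_dotProduct_const
  have hY := hX.isImmersedSurface.isPatch he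
  have hline : ∀ {s : Fin 2 → ℝ}, s ∈ e.target → ∀ a,
      ∀ᶠ t : ℝ in 𝓝 0, s + t • Pi.single a 1 ∈ e.target := by
    intro s hs a
    have hc : ContinuousAt (fun t : ℝ => s + t • (Pi.single a 1 : Fin 2 → ℝ)) 0 := by fun_prop
    exact hc (hY.isOpen.mem_nhds (by simpa using hs))
  have h1 : ∀ s ∈ e.target, ∀ a, ν ⬝ᵥ tangentVector (X ∘ e.symm) s a = 0 := by
    intro s hs a
    have h := hasDerivAt_dotProduct (hasDerivAt_const (0 : ℝ) ν) (hY.hasLineDerivAt hs a)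
    rw [zero_dotProduct, zero_add] at h
    refine h.unique ((hasDerivAt_const (0 : ℝ) d).congr_of_eventuallyEq (.of_forall fun t => ?_))
    exact hd _
  have h2 : ∀ c a, ν ⬝ᵥ secondDerivative (X ∘ e.symm) s c a = 0 := by
    intro c a
    have h := hasDerivAt_dotProduct (hasDerivAt_const (0 : ℝ) ν)
      (hasLineDerivAt_secondDerivative hY.isOpen hY.contDiffOn hs c a)
    rw [zero_dotProduct, zero_add] at h
    exact h.unique ((hasDerivAt_const (0 : ℝ) (0 : ℝ)).congr_of_eventuallyEq
      ((hline hs c).mono fun t ht => h1 _ ht a))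
  have h3 := eq_smul_cross_of_dotProduct_eq_zero (hY.normal_ne_zero s hs) (h1 s hs 0) (h1 s hs 1)
  set r := (ν ⬝ᵥ crossProduct (tangentVector (X ∘ e.symm) s 0) (tangentVector (X ∘ e.symm) s 1)) /
    (crossProduct (tangentVector (X ∘ e.symm) s 0) (tangentVector (X ∘ e.symm) s 1) ⬝ᵥ
      crossProduct (tangentVector (X ∘ e.symm) s 0) (tangentVector (X ∘ e.symm) s 1))
  have hr : r ≠ 0 := by
    intro hr
    rw [hr, zero_smul] at h3
    exact hν h3
  refine Finset.sum_eq_zero fun c _ => Finset.sum_eq_zero fun a _ => ?_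
  have h4 := h2 c a
  rw [h3, smul_dotProduct, smul_eq_mul] at h4
  rw [normalVector, (mul_eq_zero.1 h4).resolve_left hr, mul_zero]

/-! ### Propagation over a connected surface -/

variable [ConnectedSpace M]

/-- The square of the acceleration's component along the unit normal is constant on connected pieces
of charts, so its vanishing propagates. Squaring removes the sign of the normal, so no orientation
is needed. -/
theorem isTangentAcceleration_iff (hX : IsMinimalSurface X) (ht : IsTangentKillingField X w b)
    (p q : M) : IsTangentAcceleration X w b p ↔ IsTangentAcceleration X w b q := by
  have hX' := hX.isImmersedSurface
  refine iff_of_chart (fun e he U hU hUo hUc s hs s' hs' h => ?_) p q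
  have hY := (hX'.isPatch he).mono hUo hU
  have hc := hY.killing_curvature_const (fun s hs => isMinimalPatch_chart hX he s (hU hs)) hUc
    (fun s hs => ht.chart hX' he s (hU hs)) hs hs'
  have h1 := (forall_isNormalAt_iff hX' he (hU hs) _).1 h
  refine (forall_isNormalAt_iff hX' he (hU hs') _).2 ?_
  change normalVector (X ∘ e.symm) s ⬝ᵥ crossProduct w (crossProduct w ((X ∘ e.symm) s) + b) = 0
    at h1
  rw [h1, zero_pow two_ne_zero, zero_div] at hc
  exact pow_eq_zero_iff two_ne_zero |>.1
    ((div_eq_zero_iff.1 hc.symm).resolve_right (hY.normSq_ne_zero hs'))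

/-- A translation-invariant minimal surface lies on a plane. -/
theorem liesOnPlane_of_translation (hX : IsMinimalSurface X) (hb : b ≠ 0)
    (ht : IsTangentKillingField X 0 b) : LiesOnPlane X := by
  have hX' := hX.isImmersedSurface
  obtain ⟨p₀⟩ := (inferInstance : Nonempty M)
  obtain ⟨e₀, he₀, s₀, hs₀, rfl⟩ := exists_chart p₀
  set ν := normalVector (X ∘ e₀.symm) s₀ with hνdef
  have hν : ν ≠ 0 := (hX'.isPatch he₀).normal_ne_zero s₀ hs₀
  -- Being normal is rewritten as the equality case of Cauchy–Schwarz between `ν` and `N`, so that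
  -- the constant ratio of `IsPatch.normal_direction_const` applies to it.
  have hpar : ∀ e ∈ atlas (Fin 2 → ℝ) M, ∀ s ∈ e.target, (IsNormalAt X (e.symm s) ν ↔
      (ν ⬝ᵥ normalVector (X ∘ e.symm) s) ^ 2 /
        (normalVector (X ∘ e.symm) s ⬝ᵥ normalVector (X ∘ e.symm) s) = ν ⬝ᵥ ν) := by
    intro e he s hs
    have hne := (hX'.isPatch he).normSq_ne_zero hs
    set N := normalVector (X ∘ e.symm) s with hN
    constructor
    · intro h
      obtain ⟨c, hc⟩ := h.exists_eq_smul hX' he hs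
      rw [← hN] at hc
      rw [hc]
      simp only [smul_dotProduct, dotProduct_smul, smul_eq_mul]
      field_simp
    · intro h
      rw [div_eq_iff hne] at h
      have h1 : ν - ((ν ⬝ᵥ N) / (N ⬝ᵥ N)) • N = 0 := by
        rw [← dotProduct_self_eq_zero]
        simp only [sub_dotProduct, dotProduct_sub, smul_dotProduct, dotProduct_smul, smul_eq_mul,
          dotProduct_comm N ν]
        field_simp
        linear_combination -h
      rw [sub_eq_zero.1 h1]
      intro x
      rw [smul_dotProduct, isNormalAt_normalVector hX' he hs x, smul_zero]
  have hall : ∀ p, IsNormalAt X p ν := by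
    intro p
    refine (iff_of_chart (P := fun p => IsNormalAt X p ν)
      (fun e he U hU hUo hUc s hs s' hs' h => ?_) (e₀.symm s₀) p).1
      (isNormalAt_normalVector hX' he₀ hs₀)
    have hY := (hX'.isPatch he).mono hUo hU
    have hII := fun s hs c d => hY.secondFundamentalForm_eq_zero (s := s)
      (fun s hs => isMinimalPatch_chart hX he s (hU hs)) hb
      (fun s hs => by simpa using ht.chart hX' he s (hU hs)) hs c d
    rw [hpar e he s' (hU hs'), ← hY.normal_direction_const hUc hII ν hs hs',
      ← hpar e he s (hU hs)]
    exact h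
  exact liesOnPlane_of_dotProduct_const hν
    (fun p => dotProduct_const_of_isNormalAt hX' hall p (e₀.symm s₀))

end Stationary

/-! ### Surfaces invariant under a screw motion -/

section RadialMaps

variable {E : Type*} [NormedAddCommGroup E] [NormedSpace ℝ E] {U : Set E} {s₀ : E}

/-- If `ξ dη = η dξ` and `dη(v) = 0 ≠ dξ(v)` at a point, then `η` vanishes near the point. -/
theorem eventually_eq_zero_of_proportional {ξ η : E → ℝ} (hU : IsOpen U)
    (hξ : ContDiffOn ℝ ∞ ξ U) (hη : ContDiffOn ℝ ∞ η U)
    (h : ∀ s ∈ U, ∀ w, ξ s * fderiv ℝ η s w = η s * fderiv ℝ ξ s w) (hs₀ : s₀ ∈ U) {v : E}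
    (hv : fderiv ℝ ξ s₀ v ≠ 0) (hv' : fderiv ℝ η s₀ v = 0) : ∀ᶠ s in 𝓝 s₀, η s = 0 := by
  have hξ' : ContDiffOn ℝ ∞ (fun s => fderiv ℝ ξ s v) U :=
    (hξ.fderiv_of_isOpen hU (by norm_cast)).clm_apply contDiffOn_const
  have hη' : ContDiffOn ℝ ∞ (fun s => fderiv ℝ η s v) U :=
    (hη.fderiv_of_isOpen hU (by norm_cast)).clm_apply contDiffOn_const
  have hev : ∀ᶠ s in 𝓝 s₀, s ∈ U ∧ fderiv ℝ ξ s v ≠ 0 :=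
    (hU.eventually_mem hs₀).and
      ((hξ'.continuousOn.continuousAt (hU.mem_nhds hs₀)).eventually_ne hv)
  obtain ⟨r, hr, hb⟩ := Metric.eventually_nhds_iff_ball.1 hev
  set B := Metric.ball s₀ r with hB
  have hBo : IsOpen B := Metric.isOpen_ball
  have hBU : B ⊆ U := fun s hs => (hb s hs).1
  have hdξ : ∀ s ∈ B, DifferentiableAt ℝ ξ s := fun s hs =>
    (hξ.contDiffAt (hU.mem_nhds (hBU hs))).differentiableAt (by simp)
  -- Dividing the derivatives rather than `η / ξ` keeps the quotient smooth across zeros of `ξ`; the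
  -- hypothesis in the direction `v` then gives `η = q ξ`.
  set q : E → ℝ := fun s => fderiv ℝ η s v / fderiv ℝ ξ s v with hq
  have hqs : ContDiffOn ℝ ∞ q B := (hη'.mono hBU).div (hξ'.mono hBU) fun s hs => (hb s hs).2
  have hdq : ∀ s ∈ B, DifferentiableAt ℝ q s := fun s hs =>
    (hqs.contDiffAt (hBo.mem_nhds hs)).differentiableAt (by simp)
  have hηq : ∀ s ∈ B, η s = q s * ξ s := by
    intro s hs
    have h1 := h s (hBU hs) v
    rw [hq]
    field_simp [(hb s hs).2]
    linear_combination -h1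
  have hξq : ∀ s ∈ B, ∀ w, ξ s ^ 2 * fderiv ℝ q s w = 0 := by
    intro s hs w
    have h1 : η =ᶠ[𝓝 s] fun s => q s * ξ s := by
      filter_upwards [hBo.mem_nhds hs] with s' hs'
      exact hηq s' hs'
    have h2 := h s (hBU hs) w
    rw [h1.fderiv_eq, fderiv_fun_mul (hdq s hs) (hdξ s hs), hηq s hs] at h2
    simp only [add_apply, smul_apply, smul_eq_mul] at h2
    linear_combination h2
  -- From `ξ² dq = 0`: where `dq ≠ 0`, continuity would make `ξ` vanish on a neighbourhood, against
  -- `dξ(v) ≠ 0`. So `q` is constant, and `q s₀ = 0` because `dη(v) = 0` there.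
  have hq0 : ∀ s ∈ B, fderiv ℝ q s = 0 := by
    intro s hs
    by_contra hne
    have hcont : ContinuousAt (fderiv ℝ q) s :=
      ((hqs.contDiffAt (hBo.mem_nhds hs)).fderiv_right (m := 0) (by simp)).continuousAt
    have h1 : ξ =ᶠ[𝓝 s] fun _ => 0 := by
      filter_upwards [hcont.eventually_ne hne, hBo.mem_nhds hs] with s' hs' hsB
      by_contra hξ0
      refine hs' (ContinuousLinearMap.ext fun w => ?_)
      exact (mul_eq_zero.1 (hξq s' hsB w)).resolve_left (pow_ne_zero 2 hξ0)
    refine (hb s hs).2 ?_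
    rw [h1.fderiv_eq]
    simp
  have hs₀B : s₀ ∈ B := Metric.mem_ball_self hr
  filter_upwards [hBo.mem_nhds hs₀B] with s hs
  have h3 : q s = q s₀ := hBo.is_const_of_fderiv_eq_zero (𝕜 := ℝ)
    (convex_ball s₀ r).isPreconnected (hqs.differentiableOn (by simp)) hq0 hs hs₀B
  rw [hηq s hs, h3, hq]
  simp [hv']

/-- A planar map of rank one that is everywhere radial is locally contained in a line. -/
theorem exists_line_of_radial {x y : E → ℝ} (hU : IsOpen U)
    (hx : ContDiffOn ℝ ∞ x U) (hy : ContDiffOn ℝ ∞ y U)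
    (h : ∀ s ∈ U, ∀ w, x s * fderiv ℝ y s w = y s * fderiv ℝ x s w) (hs₀ : s₀ ∈ U) {v : E}
    (hv : fderiv ℝ x s₀ v ≠ 0 ∨ fderiv ℝ y s₀ v ≠ 0) :
    ∃ α β : ℝ, (α ≠ 0 ∨ β ≠ 0) ∧ ∀ᶠ s in 𝓝 s₀, β * x s - α * y s = 0 := by
  set α := fderiv ℝ x s₀ v with hα
  set β := fderiv ℝ y s₀ v with hβ
  have hdx : ∀ s ∈ U, DifferentiableAt ℝ x s := fun s hs =>
    (hx.contDiffAt (hU.mem_nhds hs)).differentiableAt (by simp)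
  have hdy : ∀ s ∈ U, DifferentiableAt ℝ y s := fun s hs =>
    (hy.contDiffAt (hU.mem_nhds hs)).differentiableAt (by simp)
  have hξ : ∀ s ∈ U, ∀ w, fderiv ℝ (fun s => α * x s + β * y s) s w =
      α * fderiv ℝ x s w + β * fderiv ℝ y s w := by
    intro s hs w
    rw [fderiv_fun_add ((hdx s hs).const_mul α) ((hdy s hs).const_mul β),
      fderiv_const_mul (hdx s hs), fderiv_const_mul (hdy s hs)]
    simp
  have hη : ∀ s ∈ U, ∀ w, fderiv ℝ (fun s => β * x s - α * y s) s w =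
      β * fderiv ℝ x s w - α * fderiv ℝ y s w := by
    intro s hs w
    rw [fderiv_fun_sub ((hdx s hs).const_mul β) ((hdy s hs).const_mul α),
      fderiv_const_mul (hdx s hs), fderiv_const_mul (hdy s hs)]
    simp
  -- Coordinates are turned, up to scale, towards the image `(α, β)` of `v`: the first one has
  -- derivative `α² + β² ≠ 0` along `v`, the second has derivative 0.
  refine ⟨α, β, hv, eventually_eq_zero_of_proportional (ξ := fun s => α * x s + β * y s) hU
    ((contDiffOn_const.mul hx).add (contDiffOn_const.mul hy))
    ((contDiffOn_const.mul hx).sub (contDiffOn_const.mul hy)) (fun s hs w => ?_) hs₀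
    (v := v) ?_ ?_⟩
  · rw [hξ s hs, hη s hs]
    linear_combination (-(α ^ 2 + β ^ 2)) * h s hs w
  · rw [hξ s₀ hs₀, ← hα, ← hβ]
    rcases hv with hv | hv
    · exact (add_pos_of_pos_of_nonneg (mul_self_pos.2 hv) (mul_self_nonneg _)).ne'
    · exact (add_pos_of_nonneg_of_pos (mul_self_nonneg _) (mul_self_pos.2 hv)).ne'
  · rw [hη s₀ hs₀, ← hα, ← hβ]
    ring

end RadialMaps

/-! ### Untwisted coordinates -/

section Screw

/-- The horizontal coordinates in the frame that turns by the angle `μ z` at height `z`. -/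
noncomputable def untwist₁ (μ : ℝ) (v : Fin 3 → ℝ) : ℝ :=
  v 0 * Real.cos (μ * v 2) + v 1 * Real.sin (μ * v 2)

/-- The other horizontal coordinate in the frame of `untwist₁`. -/
noncomputable def untwist₂ (μ : ℝ) (v : Fin 3 → ℝ) : ℝ :=
  -(v 0 * Real.sin (μ * v 2)) + v 1 * Real.cos (μ * v 2)

/-- The gradient of `untwist₁`. -/
noncomputable def untwistGradient₁ (μ : ℝ) (v : Fin 3 → ℝ) : Fin 3 → ℝ :=
  ![Real.cos (μ * v 2), Real.sin (μ * v 2), μ * untwist₂ μ v]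

/-- The gradient of `untwist₂`. -/
noncomputable def untwistGradient₂ (μ : ℝ) (v : Fin 3 → ℝ) : Fin 3 → ℝ :=
  ![-Real.sin (μ * v 2), Real.cos (μ * v 2), -(μ * untwist₁ μ v)]

theorem hasDerivAt_untwist (μ : ℝ) {f : ℝ → Fin 3 → ℝ} {f' : Fin 3 → ℝ} {t : ℝ}
    (hf : HasDerivAt f f' t) :
    HasDerivAt (fun t => untwist₁ μ (f t)) (untwistGradient₁ μ (f t) ⬝ᵥ f') t ∧
      HasDerivAt (fun t => untwist₂ μ (f t)) (untwistGradient₂ μ (f t) ⬝ᵥ f') t := by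
  have h := hasDerivAt_pi.1 hf
  have hc := ((h 2).const_mul μ).cos
  have hs := ((h 2).const_mul μ).sin
  constructor
  · refine (((h 0).mul hc).add ((h 1).mul hs)).congr_deriv ?_
    rw [dotProduct_fin_three]
    simp [untwistGradient₁, untwist₂]
    ring
  · refine (((h 0).mul hs).neg.add ((h 1).mul hc)).congr_deriv ?_
    rw [dotProduct_fin_three]
    simp [untwistGradient₂, untwist₁]
    ring

theorem contDiff_untwist (μ : ℝ) : ContDiff ℝ ∞ (untwist₁ μ) ∧ ContDiff ℝ ∞ (untwist₂ μ) := by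
  have h : ∀ i, ContDiff ℝ ∞ fun v : Fin 3 → ℝ => v i := fun i => contDiff_apply ℝ ℝ i
  have hc : ContDiff ℝ ∞ fun v : Fin 3 → ℝ => Real.cos (μ * v 2) :=
    Real.contDiff_cos.comp (contDiff_const.mul (h 2))
  have hs : ContDiff ℝ ∞ fun v : Fin 3 → ℝ => Real.sin (μ * v 2) :=
    Real.contDiff_sin.comp (contDiff_const.mul (h 2))
  exact ⟨((h 0).mul hc).add ((h 1).mul hs), (((h 0).mul hs).neg).add ((h 1).mul hc)⟩

/-- The untwisted coordinates are invariants of the screw motion: turning by an angle `t` raises the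
height by `l t`, and the frame turns by `μ l t = t`. -/
theorem untwistGradient_screw {μ l : ℝ} (h : μ * l = 1) (v : Fin 3 → ℝ) :
    untwistGradient₁ μ v ⬝ᵥ ![-v 1, v 0, l] = 0 ∧
      untwistGradient₂ μ v ⬝ᵥ ![-v 1, v 0, l] = 0 := by
  simp only [untwistGradient₁, untwistGradient₂, untwist₁, untwist₂, dotProduct_fin_three,
    Matrix.cons_val]
  constructor
  · linear_combination (-(v 0 * Real.sin (μ * v 2)) + v 1 * Real.cos (μ * v 2)) * h
  · linear_combination (-(v 0 * Real.cos (μ * v 2) + v 1 * Real.sin (μ * v 2))) * h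

/-- Euler's relation: the untwisted coordinates are linear in the horizontal coordinates at fixed
height. -/
theorem untwistGradient_radial (μ : ℝ) (v : Fin 3 → ℝ) :
    untwistGradient₁ μ v ⬝ᵥ ![v 0, v 1, 0] = untwist₁ μ v ∧
      untwistGradient₂ μ v ⬝ᵥ ![v 0, v 1, 0] = untwist₂ μ v := by
  simp only [untwistGradient₁, untwistGradient₂, untwist₁, untwist₂, dotProduct_fin_three,
    Matrix.cons_val]
  constructor <;> ring

theorem untwist_spec (μ : ℝ) (v : Fin 3 → ℝ) :
    v 0 = untwist₁ μ v * Real.cos (μ * v 2) - untwist₂ μ v * Real.sin (μ * v 2) ∧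
      v 1 = untwist₁ μ v * Real.sin (μ * v 2) + untwist₂ μ v * Real.cos (μ * v 2) := by
  simp only [untwist₁, untwist₂]
  have h := Real.sin_sq_add_cos_sq (μ * v 2)
  constructor
  · linear_combination (-v 0) * h
  · linear_combination (-v 1) * h

/-- At a point where the screw field and the radial field are tangent, the untwisted horizontal
coordinates form a radial map of rank one. -/
theorem untwist_radial_of_tangent {μ l : ℝ} (h : μ * l = 1) {u v P : Fin 3 → ℝ}
    (huv : crossProduct u v ≠ 0) (hV : crossProduct u v ⬝ᵥ ![-P 1, P 0, l] = 0)
    (hr : crossProduct u v ⬝ᵥ ![P 0, P 1, 0] = 0) :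
    (∀ a b : ℝ, untwist₁ μ P * (untwistGradient₂ μ P ⬝ᵥ (a • u + b • v)) =
      untwist₂ μ P * (untwistGradient₁ μ P ⬝ᵥ (a • u + b • v))) ∧
    (untwistGradient₁ μ P ⬝ᵥ u ≠ 0 ∨ untwistGradient₂ μ P ⬝ᵥ u ≠ 0 ∨
      untwistGradient₁ μ P ⬝ᵥ v ≠ 0 ∨ untwistGradient₂ μ P ⬝ᵥ v ≠ 0) := by
  have hl : l ≠ 0 := right_ne_zero_of_mul_eq_one h
  obtain ⟨p, q, hpq⟩ := exists_eq_smul_add_smul huv hV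
  obtain ⟨p', q', hpq'⟩ := exists_eq_smul_add_smul huv hr
  obtain ⟨e1, e2⟩ := untwistGradient_screw h P
  obtain ⟨e3, e4⟩ := untwistGradient_radial μ P
  have hpq0 : p ≠ 0 ∨ q ≠ 0 := by
    by_contra! hc
    have := congrFun hpq 2
    rw [hc.1, hc.2] at this
    simp at this
    exact hl this
  rw [hpq] at e1 e2
  rw [hpq'] at e3 e4
  simp only [dotProduct_add, dotProduct_smul, smul_eq_mul] at e1 e2 e3 e4 ⊢
  -- Both gradients annihilate the nonzero tangent vector `(-P₁, P₀, l)`, so the Jacobian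
  -- determinant of the untwisted coordinates on the surface is zero.
  have e5 : (untwistGradient₁ μ P ⬝ᵥ u) * (untwistGradient₂ μ P ⬝ᵥ v) =
      (untwistGradient₁ μ P ⬝ᵥ v) * (untwistGradient₂ μ P ⬝ᵥ u) := by
    rcases hpq0 with hp | hq
    · apply mul_left_cancel₀ hp
      linear_combination (untwistGradient₂ μ P ⬝ᵥ v) * e1 - (untwistGradient₁ μ P ⬝ᵥ v) * e2
    · apply mul_left_cancel₀ hq
      linear_combination (untwistGradient₁ μ P ⬝ᵥ u) * e2 - (untwistGradient₂ μ P ⬝ᵥ u) * e1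
  refine ⟨fun a b => ?_, ?_⟩
  · rw [← e3, ← e4]
    linear_combination (b * p' - a * q') * e5
  -- If both coordinates had zero differential on the surface, their gradients would both be
  -- multiples of the normal; but the horizontal parts of the gradients are orthonormal.
  · by_contra! hc
    obtain ⟨h1, h2, h3, h4⟩ := hc
    have g1 := eq_smul_cross_of_dotProduct_eq_zero huv h1 h3
    have g2 := eq_smul_cross_of_dotProduct_eq_zero huv h2 h4
    have hcs := Real.sin_sq_add_cos_sq (μ * P 2)
    generalize (untwistGradient₁ μ P ⬝ᵥ crossProduct u v) / (crossProduct u v ⬝ᵥ crossProduct u v)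
      = c₁ at g1
    generalize (untwistGradient₂ μ P ⬝ᵥ crossProduct u v) / (crossProduct u v ⬝ᵥ crossProduct u v)
      = c₂ at g2
    have a1 := congrFun g1 0
    have a2 := congrFun g1 1
    have a3 := congrFun g2 0
    have a4 := congrFun g2 1
    simp only [untwistGradient₁, untwistGradient₂, Matrix.cons_val, Pi.smul_apply, smul_eq_mul]
      at a1 a2 a3 a4
    have : Real.sin (μ * P 2) ^ 2 + Real.cos (μ * P 2) ^ 2 = 0 := by
      linear_combination Real.cos (μ * P 2) * a4 - Real.sin (μ * P 2) * a3 +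
        c₂ * (crossProduct u v 1) * a1 - c₂ * (crossProduct u v 0) * a2
    linarith

variable {M : Type*} {X : M → (Fin 3 → ℝ)}

/-- A line through the origin of the untwisted plane, at angle `θ`, becomes the standard one after a
vertical shift by `θ / μ`, because rotating a helicoid about its axis is the same as translating it
along the axis. -/
theorem liesOnHelicoid_of_untwist {μ : ℝ} (hμ : μ ≠ 0) {α β : ℝ} (hαβ : α ≠ 0 ∨ β ≠ 0)
    (h : ∀ p, β * untwist₁ μ (X p) - α * untwist₂ μ (X p) = 0) : LiesOnHelicoid X := by
  set z : ℂ := ⟨α, β⟩ with hz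
  have hz0 : ‖z‖ ≠ 0 := by
    rw [norm_ne_zero_iff]
    intro h0
    have h1 := congrArg Complex.re h0
    have h2 := congrArg Complex.im h0
    simp [hz] at h1 h2
    exact hαβ.elim (fun h => h h1) fun h => h h2
  set θ := z.arg
  have hc : ‖z‖ * Real.cos θ = α := Complex.norm_mul_cos_arg z
  have hs : ‖z‖ * Real.sin θ = β := Complex.norm_mul_sin_arg z
  have key : ∀ p, ∃ t : ℝ, X p 0 = t * Real.cos (μ * (X p 2 + θ / μ)) ∧
      X p 1 = t * Real.sin (μ * (X p 2 + θ / μ)) := by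
    intro p
    have h1 : Real.sin θ * untwist₁ μ (X p) - Real.cos θ * untwist₂ μ (X p) = 0 := by
      apply mul_left_cancel₀ hz0
      rw [mul_zero, ← h p, ← hc, ← hs]
      ring
    have h2 : μ * (X p 2 + θ / μ) = μ * X p 2 + θ := by field_simp
    obtain ⟨e1, e2⟩ := untwist_spec μ (X p)
    have hcs := Real.sin_sq_add_cos_sq θ
    refine ⟨Real.cos θ * untwist₁ μ (X p) + Real.sin θ * untwist₂ μ (X p), ?_, ?_⟩
    · rw [h2, Real.cos_add, e1]
      generalize untwist₁ μ (X p) = x at *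
      generalize untwist₂ μ (X p) = y at *
      generalize Real.cos (μ * X p 2) = C at *
      generalize Real.sin (μ * X p 2) = S at *
      linear_combination (-(C * x) + S * y) * hcs +
        (C * Real.sin θ + S * Real.cos θ) * h1
    · rw [h2, Real.sin_add, e2]
      generalize untwist₁ μ (X p) = x at *
      generalize untwist₂ μ (X p) = y at *
      generalize Real.cos (μ * X p 2) = C at *
      generalize Real.sin (μ * X p 2) = S at *
      linear_combination (-(S * x) - C * y) * hcs +
        (S * Real.sin θ - C * Real.cos θ) * h1
  rcases lt_or_gt_of_ne hμ with hneg | hpos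
  -- The other handedness is reached by a reflection, since `a` has to be positive.
  · refine ⟨-μ, 1, by linarith, one_pos, Matrix.diagonal ![1, -1, 1], ?_, ![0, 0, -(θ / μ)],
      fun p => ?_⟩
    · rw [Matrix.mem_orthogonalGroup_iff, Matrix.diagonal_transpose, Matrix.diagonal_mul_diagonal,
        ← Matrix.diagonal_one]
      congr 1
      funext i
      fin_cases i <;> simp
    · obtain ⟨t, h0, h1⟩ := key p
      refine ⟨![t, X p 2 + θ / μ], ?_⟩
      funext i
      rw [Pi.add_apply, Matrix.mulVec_diagonal]
      fin_cases i <;> simp [helicoidMap, h0, h1]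
  · refine ⟨μ, 1, hpos, one_pos, 1, one_mem _, ![0, 0, -(θ / μ)], fun p => ?_⟩
    obtain ⟨t, h0, h1⟩ := key p
    refine ⟨![t, X p 2 + θ / μ], ?_⟩
    funext i
    rw [Pi.add_apply, Matrix.one_mulVec]
    fin_cases i <;> simp [helicoidMap, h0, h1]

end Screw

/-! ### Classification from a tangent Killing field and its acceleration -/

section ScrewSurfaces

variable {M : Type*} [TopologicalSpace M] [ChartedSpace (Fin 2 → ℝ) M]
  [IsManifold 𝓘(ℝ, Fin 2 → ℝ) ∞ M] {X : M → (Fin 3 → ℝ)} {w b : Fin 3 → ℝ}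

theorem fderiv_eq_tangentVector (Y : (Fin 2 → ℝ) → Fin 3 → ℝ) (s v : Fin 2 → ℝ) :
    fderiv ℝ Y s v = v 0 • tangentVector Y s 0 + v 1 • tangentVector Y s 1 := by
  have hx : v = v 0 • Pi.single 0 1 + v 1 • Pi.single 1 1 := by
    funext i
    fin_cases i <;> simp
  conv_lhs => rw [hx, map_add, map_smul, map_smul]
  rfl

theorem fderiv_untwist (μ : ℝ) {Y : (Fin 2 → ℝ) → Fin 3 → ℝ} {s : Fin 2 → ℝ}
    (hY : DifferentiableAt ℝ Y s) (v : Fin 2 → ℝ) :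
    fderiv ℝ (fun s => untwist₁ μ (Y s)) s v =
        untwistGradient₁ μ (Y s) ⬝ᵥ (v 0 • tangentVector Y s 0 + v 1 • tangentVector Y s 1) ∧
      fderiv ℝ (fun s => untwist₂ μ (Y s)) s v =
        untwistGradient₂ μ (Y s) ⬝ᵥ (v 0 • tangentVector Y s 0 + v 1 • tangentVector Y s 1) := by
  rw [← fderiv_eq_tangentVector]
  have h := hasDerivAt_untwist μ (hY.hasFDerivAt.hasLineDerivAt v)
  simp only [zero_smul, add_zero] at h
  have h1 : DifferentiableAt ℝ (fun s => untwist₁ μ (Y s)) s :=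
    ((contDiff_untwist μ).1.differentiable (by simp) _).comp s hY
  have h2 : DifferentiableAt ℝ (fun s => untwist₂ μ (Y s)) s :=
    ((contDiff_untwist μ).2.differentiable (by simp) _).comp s hY
  exact ⟨(h1.hasFDerivAt.hasLineDerivAt v).unique h.1,
    (h2.hasFDerivAt.hasLineDerivAt v).unique h.2⟩

/-- A surface whose normals are orthogonal to the rotation field and the radial field lies on a
plane. -/
theorem liesOnPlane_of_rotation [ConnectedSpace M] (hX : IsImmersedSurface X)
    (ht : ∀ p ν, IsNormalAt X p ν → ν ⬝ᵥ ![-X p 1, X p 0, 0] = 0)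
    (hr : ∀ p ν, IsNormalAt X p ν → ν ⬝ᵥ ![X p 0, X p 1, 0] = 0) : LiesOnPlane X := by
  have hrot : ∀ x : Fin 3 → ℝ, crossProduct ![0, 0, 1] x + 0 = ![-x 1, x 0, 0] := by
    intro x
    simp [cross_apply]
  have hN : ∀ p, IsNormalAt X p ![0, 0, 1] := by
    intro p
    obtain ⟨e, he, s, hs, rfl⟩ := exists_chart p
    have hY := hX.isPatch he
    set N := normalVector (X ∘ e.symm) s with hNdef
    have hN0 : N ≠ 0 := hY.normal_ne_zero s hs
    have hNn : IsNormalAt X (e.symm s) N := isNormalAt_normalVector hX he hs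
    have hN01 : N 0 = 0 ∧ N 1 = 0 := by
      have h1 := ht _ _ hNn
      have h2 := hr _ _ hNn
      rw [dotProduct_fin_three] at h1 h2
      simp only [Matrix.cons_val, mul_zero, add_zero] at h1 h2
      by_cases h0 : X (e.symm s) 0 = 0 ∧ X (e.symm s) 1 = 0
      -- On the axis both fields vanish and say nothing. The derivative of tangency does: the
      -- horizontal part of `N`, turned by a right angle, is again normal, hence equals `c N`, which
      -- forces `N 0 = N 1 = 0`.
      · have h3 := fun a => hY.tangency_derivative (w := ![0, 0, 1]) (b := 0) (fun s hs => by
          rw [hrot]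
          exact ht _ _ (isNormalAt_normalVector hX he hs)) hs a
        have h4 : IsNormalAt X (e.symm s) ![N 1, -N 0, 0] := by
          refine (isNormalAt_chart_iff hX.smooth he hs _).2 fun a => ?_
          have h5 := h3 a
          rw [hrot, Function.comp_apply, h0.1, h0.2, ← hNdef] at h5
          rw [dotProduct_fin_three, dotProduct_fin_three] at h5
          rw [dotProduct_fin_three]
          simp [cross_apply] at h5 ⊢
          linarith
        obtain ⟨c, hc⟩ := h4.exists_eq_smul hX he hs
        have c0 := congrFun hc 0
        have c1 := congrFun hc 1
        simp only [← hNdef, Matrix.cons_val, Pi.smul_apply, smul_eq_mul] at c0 c1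
        have h6 : N 0 * (1 + c ^ 2) = 0 := by linear_combination (-1) * c1 - c * c0
        have h7 : N 1 * (1 + c ^ 2) = 0 := by linear_combination c0 - c * c1
        have hpos : (1 + c ^ 2) ≠ 0 := by positivity
        exact ⟨(mul_eq_zero.1 h6).resolve_right hpos, (mul_eq_zero.1 h7).resolve_right hpos⟩
      · have hpos : X (e.symm s) 0 ^ 2 + X (e.symm s) 1 ^ 2 ≠ 0 := by
          intro h
          refine h0 ⟨?_, ?_⟩ <;> nlinarith [sq_nonneg (X (e.symm s) 0), sq_nonneg (X (e.symm s) 1)]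
        refine ⟨mul_right_cancel₀ hpos ?_, mul_right_cancel₀ hpos ?_⟩
        · linear_combination X (e.symm s) 0 * h2 - X (e.symm s) 1 * h1
        · linear_combination X (e.symm s) 1 * h2 + X (e.symm s) 0 * h1
    have hN2 : N 2 ≠ 0 := by
      intro h
      refine hN0 (funext fun i => ?_)
      fin_cases i
      · exact hN01.1
      · exact hN01.2
      · exact h
    have he3 : (![0, 0, 1] : Fin 3 → ℝ) = (N 2)⁻¹ • N := by
      funext i
      fin_cases i <;> simp [hN01.1, hN01.2, hN2]
    rw [he3]
    intro v
    rw [smul_dotProduct, hNn v, smul_zero]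
  obtain ⟨q⟩ := (inferInstance : Nonempty M)
  exact liesOnPlane_of_dotProduct_const (ν := ![0, 0, 1])
    (fun h => by simpa using congrFun h 2) fun p => dotProduct_const_of_isNormalAt hX hN p q

/-- A surface whose normals are orthogonal to a screw field and the radial field lies on a
helicoid. -/
theorem liesOnHelicoid_of_screw [ConnectedSpace M] (hX : IsImmersedSurface X) {l : ℝ}
    (hl : l ≠ 0) (ht : ∀ p ν, IsNormalAt X p ν → ν ⬝ᵥ ![-X p 1, X p 0, l] = 0)
    (hr : ∀ p ν, IsNormalAt X p ν → ν ⬝ᵥ ![X p 0, X p 1, 0] = 0) : LiesOnHelicoid X := by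
  set μ := l⁻¹ with hμ
  have hμl : μ * l = 1 := inv_mul_cancel₀ hl
  -- The value alone would not fix the line at points of the axis, where both untwisted coordinates
  -- vanish. With the gradient condition, rank one determines the pair `(α, β)` up to scale, so that
  -- `P α β` is locally constant.
  let P : ℝ → ℝ → M → Prop := fun α β p => β * untwist₁ μ (X p) - α * untwist₂ μ (X p) = 0 ∧
    IsNormalAt X p (β • untwistGradient₁ μ (X p) - α • untwistGradient₂ μ (X p))
  have key : ∀ e ∈ atlas (Fin 2 → ℝ) M, ∀ s₀ ∈ e.target, ∃ α₀ β₀ : ℝ, (α₀ ≠ 0 ∨ β₀ ≠ 0) ∧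
      ∀ᶠ s in 𝓝 s₀, ∀ α β, P α β (e.symm s) ↔ β * α₀ - α * β₀ = 0 := by
    intro e he s₀ hs₀
    have hY := hX.isPatch he
    set Y := X ∘ e.symm with hYdef
    have hpt := fun s (hs : s ∈ e.target) => untwist_radial_of_tangent hμl (P := Y s)
      (hY.normal_ne_zero s hs) (ht _ _ (isNormalAt_normalVector hX he hs))
      (hr _ _ (isNormalAt_normalVector hX he hs))
    have hfd := fun s (hs : s ∈ e.target) => fderiv_untwist μ (hY.differentiableAt hs)
    obtain ⟨v, hv⟩ : ∃ v, fderiv ℝ (fun s => untwist₁ μ (Y s)) s₀ v ≠ 0 ∨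
        fderiv ℝ (fun s => untwist₂ μ (Y s)) s₀ v ≠ 0 := by
      simp only [(hfd s₀ hs₀ _).1, (hfd s₀ hs₀ _).2]
      rcases (hpt s₀ hs₀).2 with h | h | h | h
      · exact ⟨![1, 0], Or.inl (by simpa using h)⟩
      · exact ⟨![1, 0], Or.inr (by simpa using h)⟩
      · exact ⟨![0, 1], Or.inl (by simpa using h)⟩
      · exact ⟨![0, 1], Or.inr (by simpa using h)⟩
    obtain ⟨α₀, β₀, h0, hline⟩ := exists_line_of_radial (x := fun s => untwist₁ μ (Y s))
      (y := fun s => untwist₂ μ (Y s)) hY.isOpen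
      ((contDiff_untwist μ).1.comp_contDiffOn hY.contDiffOn)
      ((contDiff_untwist μ).2.comp_contDiffOn hY.contDiffOn)
      (fun s hs v => by
        rw [(hfd s hs v).1, (hfd s hs v).2]
        exact (hpt s hs).1 _ _) hs₀ hv
    refine ⟨α₀, β₀, h0, ?_⟩
    filter_upwards [hline.eventually_nhds, hY.isOpen.mem_nhds hs₀] with s hs hst α β
    have hval : β₀ * untwist₁ μ (X (e.symm s)) - α₀ * untwist₂ μ (X (e.symm s)) = 0 :=
      hs.self_of_nhds
    have hgrad : ∀ a, β₀ * (untwistGradient₁ μ (X (e.symm s)) ⬝ᵥ tangentVector Y s a) -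
        α₀ * (untwistGradient₂ μ (X (e.symm s)) ⬝ᵥ tangentVector Y s a) = 0 := by
      intro a
      have h1 := hasDerivAt_untwist μ (hY.hasLineDerivAt hst a)
      simp only [zero_smul, add_zero] at h1
      have h2 := (h1.1.const_mul β₀).sub (h1.2.const_mul α₀)
      refine h2.unique ((hasDerivAt_const (0 : ℝ) (0 : ℝ)).congr_of_eventuallyEq ?_)
      have hc : ContinuousAt (fun t : ℝ => s + t • (Pi.single a 1 : Fin 2 → ℝ)) 0 := by fun_prop
      exact hc.eventually (by simpa using hs)
    have hnorm : IsNormalAt X (e.symm s) (β • untwistGradient₁ μ (X (e.symm s)) -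
        α • untwistGradient₂ μ (X (e.symm s))) ↔
        ∀ a, β * (untwistGradient₁ μ (X (e.symm s)) ⬝ᵥ tangentVector Y s a) -
        α * (untwistGradient₂ μ (X (e.symm s)) ⬝ᵥ tangentVector Y s a) = 0 := by
      rw [isNormalAt_chart_iff hX.smooth he hst]
      simp only [sub_dotProduct, smul_dotProduct, smul_eq_mul, ← hYdef]
    constructor
    · rintro ⟨-, h⟩
      have h2 := hnorm.1 h
      have h3 : ∀ a, (β * α₀ - α * β₀) *
          (untwistGradient₁ μ (X (e.symm s)) ⬝ᵥ tangentVector Y s a) = 0 ∧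
          (β * α₀ - α * β₀) *
          (untwistGradient₂ μ (X (e.symm s)) ⬝ᵥ tangentVector Y s a) = 0 := fun a =>
        ⟨by linear_combination α₀ * h2 a - α * hgrad a,
          by linear_combination β₀ * h2 a - β * hgrad a⟩
      rcases (hpt s hst).2 with h | h | h | h
      · exact (mul_eq_zero.1 (h3 0).1).resolve_right h
      · exact (mul_eq_zero.1 (h3 0).2).resolve_right h
      · exact (mul_eq_zero.1 (h3 1).1).resolve_right h
      · exact (mul_eq_zero.1 (h3 1).2).resolve_right h
    · intro h
      have hprop : ∀ x y : ℝ, β₀ * x - α₀ * y = 0 → β * x - α * y = 0 := by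
        intro x y hxy
        rcases h0 with h0 | h0
        · apply mul_left_cancel₀ h0
          linear_combination α * hxy + x * h
        · apply mul_left_cancel₀ h0
          linear_combination β * hxy + y * h
      exact ⟨hprop _ _ hval, hnorm.2 fun a => hprop _ _ (hgrad a)⟩
  obtain ⟨p₀⟩ := (inferInstance : Nonempty M)
  obtain ⟨e₀, he₀, s₀, hs₀, rfl⟩ := exists_chart p₀
  obtain ⟨α, β, h0, hev⟩ := key e₀ he₀ s₀ hs₀
  have hP₀ : P α β (e₀.symm s₀) := (hev.self_of_nhds α β).2 (by ring)
  have hP : ∀ p, P α β p := fun p => (iff_of_eventually_chart (P := P α β) (fun e he s hs => by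
    obtain ⟨α', β', -, h⟩ := key e he s hs
    filter_upwards [h] with s' hs'
    rw [hs', h.self_of_nhds]) _ p).1 hP₀
  exact liesOnHelicoid_of_untwist (inv_ne_zero hl) h0 fun p => (hP p).1

/-- A surface to which a rotational Killing field and its acceleration are tangent lies on a
plane or a helicoid. -/
theorem liesOnPlane_or_liesOnHelicoid_of_acceleration [ConnectedSpace M]
    (hX : IsImmersedSurface X) (hw : w ≠ 0) (ht : IsTangentKillingField X w b)
    (ha : ∀ p, IsTangentAcceleration X w b p) : LiesOnPlane X ∨ LiesOnHelicoid X := by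
  obtain ⟨R, hR, c, hc, -, hcross⟩ := exists_adapted_frame hw
  set d := Rᵀ *ᵥ b with hd
  have hb : b = R *ᵥ d := (orthogonal_mulVec_transpose hR b).symm
  -- `v` is a point of the axis: there `w × x` cancels the part of `b` orthogonal to `w`.
  set v := R *ᵥ ![-(d 1 / c), d 0 / c, 0] with hv
  set X' : M → (Fin 3 → ℝ) := fun p => Rᵀ *ᵥ (X p - v) with hX'
  have hXX' : ∀ p, X p = R *ᵥ (X' p + ![-(d 1 / c), d 0 / c, 0]) := by
    intro p
    rw [Matrix.mulVec_add, ← hv, hX', eq_mulVec_isometry hR]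
  have hV : ∀ p, crossProduct w (X p) + b = R *ᵥ ![-(c * X' p 1), c * X' p 0, d 2] := by
    intro p
    rw [hXX', hcross, hb, ← Matrix.mulVec_add]
    congr 1
    funext i
    fin_cases i <;> simp <;> field_simp <;> ring
  have ht' : ∀ p ν, IsNormalAt X' p ν → ν ⬝ᵥ ![-X' p 1, X' p 0, d 2 / c] = 0 := by
    intro p ν hν
    have h := ht p _ ((isNormalAt_isometry_iff hX hR v p ν).1 hν)
    rw [hV, orthogonal_dotProduct hR, dotProduct_fin_three] at h
    rw [dotProduct_fin_three]
    simp only [Matrix.cons_val] at h ⊢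
    field_simp
    linear_combination h
  -- In the adapted frame the acceleration is `-c²` times the radial field.
  have hr' : ∀ p ν, IsNormalAt X' p ν → ν ⬝ᵥ ![X' p 0, X' p 1, 0] = 0 := by
    intro p ν hν
    have h := ha p _ ((isNormalAt_isometry_iff hX hR v p ν).1 hν)
    rw [hV, hcross, orthogonal_dotProduct hR, dotProduct_fin_three] at h
    rw [dotProduct_fin_three]
    simp only [Matrix.cons_val] at h ⊢
    apply mul_left_cancel₀ (pow_ne_zero 2 hc)
    linear_combination -h
  have hXi : IsImmersedSurface X' := hX.isometry hR v
  by_cases hl : d 2 / c = 0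
  · rw [hl] at ht'
    exact Or.inl (liesOnPlane_of_isometry hR v (liesOnPlane_of_rotation hXi ht' hr'))
  · exact Or.inr (liesOnHelicoid_of_isometry hR v (liesOnHelicoid_of_screw hXi hl ht' hr'))

end ScrewSurfaces

/-! ### Killing fields tangent to a helicoid -/

section Helicoid

theorem eq_zero_of_sin_cos {x y α β : ℝ} (hα : x * Real.sin α - y * Real.cos α = 0)
    (hβ : x * Real.sin β - y * Real.cos β = 0) (h : Real.sin (β - α) ≠ 0) : x = 0 ∧ y = 0 := by
  rw [Real.sin_sub] at h
  constructor
  · refine (mul_eq_zero.1 (?_ : x * _ = 0)).resolve_right h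
    linear_combination Real.cos α * hβ - Real.cos β * hα
  · refine (mul_eq_zero.1 (?_ : y * _ = 0)).resolve_right h
    linear_combination Real.sin α * hβ - Real.sin β * hα

/-- A Killing field whose component normal to the helicoid vanishes on an open set of parameters
is a screw field. -/
theorem screw_of_tangent_helicoid {μ : ℝ} (hμ : 0 < μ) {w b : Fin 3 → ℝ} {ρ₀ z₀ δ : ℝ}
    (hδ : 0 < δ) (h : ∀ ρ z : ℝ, |ρ - ρ₀| < δ → |z - z₀| < δ →
      ρ ^ 2 * (w 0 * Real.sin (μ * z) - w 1 * Real.cos (μ * z)) * μ - ρ * (w 2 - μ * b 2) +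
        (Real.sin (μ * z) * (w 1 * z + b 0) - Real.cos (μ * z) * (b 1 - w 0 * z)) = 0) :
    w 0 = 0 ∧ w 1 = 0 ∧ b 0 = 0 ∧ b 1 = 0 := by
  have habs : |δ / 2| < δ := by rw [abs_of_pos (by linarith)]; linarith
  -- For fixed `z` the expression is a quadratic polynomial in `ρ`; its values at `ρ₀` and `ρ₀ ±
  -- δ/2` make all three coefficients vanish.
  have hcoef : ∀ z, |z - z₀| < δ → w 0 * Real.sin (μ * z) - w 1 * Real.cos (μ * z) = 0 ∧
      (w 2 - μ * b 2) = 0 ∧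
      Real.sin (μ * z) * (w 1 * z + b 0) - Real.cos (μ * z) * (b 1 - w 0 * z) = 0 := by
    intro z hz
    have h0 := h ρ₀ z (by simpa using hδ) hz
    have h1 := h (ρ₀ + δ / 2) z (by rwa [add_sub_cancel_left]) hz
    have h2 := h (ρ₀ - δ / 2) z (by rwa [sub_sub_cancel_left, abs_neg]) hz
    generalize w 0 * Real.sin (μ * z) - w 1 * Real.cos (μ * z) = A at *
    generalize w 2 - μ * b 2 = B at *
    generalize Real.sin (μ * z) * (w 1 * z + b 0) - Real.cos (μ * z) * (b 1 - w 0 * z) = C at *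
    have hA : A = 0 := by
      have : A * (μ * δ ^ 2 / 2) = 0 := by linear_combination h1 + h2 - 2 * h0
      exact (mul_eq_zero.1 this).resolve_right (by positivity)
    have hB : B = 0 := by
      have : B * δ = 0 := by
        rw [hA] at h1 h2
        linear_combination h2 - h1
      exact (mul_eq_zero.1 this).resolve_right hδ.ne'
    refine ⟨hA, hB, ?_⟩
    rw [hA, hB] at h0
    linarith
  -- Two heights at distance `t` suffice: `0 < μ t ≤ 1 < π` makes the two directions `(cos, sin)`
  -- independent.
  set t := min (δ / 2) (1 / μ) with ht
  have ht0 : 0 < t := lt_min (by linarith) (by positivity)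
  have htδ : t < δ := (min_le_left _ _).trans_lt (by linarith)
  have hz0 := hcoef z₀ (by simpa using hδ)
  have hz1 := hcoef (z₀ + t) (by rwa [add_sub_cancel_left, abs_of_pos ht0])
  have hsin : Real.sin (μ * (z₀ + t) - μ * z₀) ≠ 0 := by
    have h1 : μ * (z₀ + t) - μ * z₀ = μ * t := by ring
    have h2 : μ * t ≤ 1 := by
      calc μ * t ≤ μ * (1 / μ) := by gcongr; exact min_le_right _ _
        _ = 1 := by field_simp
    rw [h1]
    exact (Real.sin_pos_of_pos_of_lt_pi (by positivity)
      (h2.trans_lt (by linarith [Real.pi_gt_three]))).ne'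
  obtain ⟨hw0, hw1⟩ := eq_zero_of_sin_cos hz0.1 hz1.1 hsin
  have e0 := hz0.2.2
  have e1 := hz1.2.2
  rw [hw0, hw1] at e0 e1
  obtain ⟨hb0, hb1⟩ := eq_zero_of_sin_cos (x := b 0) (y := b 1) (α := μ * z₀) (β := μ * (z₀ + t))
    (by linear_combination e0) (by linear_combination e1) hsin
  exact ⟨hw0, hw1, hb0, hb1⟩

/-- On the helicoid `untwist₂ μ = 0` the gradient is a normal, with `untwist₁` and the height as
parameters `ρ` and `z`. The formula is, up to sign, the expression treated by
`screw_of_tangent_helicoid`. -/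
theorem untwistGradient₂_dotProduct_killing {μ : ℝ} {w b v : Fin 3 → ℝ} (hv : untwist₂ μ v = 0) :
    untwistGradient₂ μ v ⬝ᵥ (crossProduct w v + b) =
      -(untwist₁ μ v ^ 2 * (w 0 * Real.sin (μ * v 2) - w 1 * Real.cos (μ * v 2)) * μ -
        untwist₁ μ v * (w 2 - μ * b 2) + (Real.sin (μ * v 2) * (w 1 * v 2 + b 0) -
          Real.cos (μ * v 2) * (b 1 - w 0 * v 2))) := by
  obtain ⟨e0, e1⟩ := untwist_spec μ v
  rw [hv, zero_mul, sub_zero] at e0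
  rw [hv, zero_mul, add_zero] at e1
  have hcs := Real.sin_sq_add_cos_sq (μ * v 2)
  rw [dotProduct_fin_three]
  simp only [untwistGradient₂, cross_apply, Matrix.cons_val, Pi.add_apply]
  generalize untwist₁ μ v = ρ at *
  rw [e0, e1]
  generalize Real.cos (μ * v 2) = C at *
  generalize Real.sin (μ * v 2) = S at *
  linear_combination ρ * w 2 * hcs

variable {M : Type*} [TopologicalSpace M] [ChartedSpace (Fin 2 → ℝ) M]
  [IsManifold 𝓘(ℝ, Fin 2 → ℝ) ∞ M] {X : M → (Fin 3 → ℝ)} {w b : Fin 3 → ℝ}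

/-- On the surface `(ρ, z)` are local coordinates, so tangency of the Killing field holds on an open
set of parameters and forces a screw field about the axis. Its acceleration is horizontal and
radial, along the rulings. -/
theorem isTangentAcceleration_of_untwist (hX : IsImmersedSurface X) {μ : ℝ} (hμ : 0 < μ)
    (h : ∀ p, untwist₂ μ (X p) = 0) (ht : IsTangentKillingField X w b) (p : M) :
    IsTangentAcceleration X w b p := by
  obtain ⟨e, he, s, hs, rfl⟩ := exists_chart p
  have hY := hX.isPatch he
  set Y := X ∘ e.symm with hYdef
  have hd := fun {s} (hs : s ∈ e.target) => hY.differentiableAt hs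
  have hg : ∀ s ∈ e.target, ∀ a, untwistGradient₂ μ (Y s) ⬝ᵥ tangentVector Y s a = 0 := by
    intro s hs a
    have h1 := (hasDerivAt_untwist μ (hY.hasLineDerivAt hs a)).2
    simp only [zero_smul, add_zero] at h1
    exact h1.unique ((hasDerivAt_const (0 : ℝ) (0 : ℝ)).congr_of_eventuallyEq
      (.of_forall fun t => h _))
  have hgn : ∀ s ∈ e.target, IsNormalAt X (e.symm s) (untwistGradient₂ μ (Y s)) := fun s hs =>
    (isNormalAt_chart_iff hX.smooth he hs _).2 (hg s hs)
  let f : (Fin 2 → ℝ) → Fin 2 → ℝ := fun s => ![untwist₁ μ (Y s), Y s 2]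
  have hfc : ContDiffAt ℝ ∞ f s := by
    have hYc := hY.contDiffOn.contDiffAt (hY.isOpen.mem_nhds hs)
    rw [contDiffAt_pi]
    intro i
    fin_cases i
    · exact (contDiff_untwist μ).1.contDiffAt.comp s hYc
    · exact contDiffAt_pi.1 hYc 2
  have hfs := hfc.hasStrictFDerivAt (by simp)
  have hf0 : ∀ v, fderiv ℝ f s v 0 = untwistGradient₁ μ (Y s) ⬝ᵥ fderiv ℝ Y s v := by
    intro v
    have h1 := hasDerivAt_pi.1 (hfs.hasFDerivAt.hasLineDerivAt v) 0
    have h2 := (hasDerivAt_untwist μ ((hd hs).hasFDerivAt.hasLineDerivAt v)).1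
    simp only [zero_smul, add_zero] at h2
    exact h1.unique h2
  have hf1 : ∀ v, fderiv ℝ f s v 1 = fderiv ℝ Y s v 2 := by
    intro v
    have h1 := hasDerivAt_pi.1 (hfs.hasFDerivAt.hasLineDerivAt v) 1
    exact h1.unique (hasDerivAt_pi.1 ((hd hs).hasFDerivAt.hasLineDerivAt v) 2)
  have hinj : Function.Injective (fderiv ℝ f s : (Fin 2 → ℝ) →ₗ[ℝ] (Fin 2 → ℝ)) := by
    rw [← LinearMap.ker_eq_bot, LinearMap.ker_eq_bot']
    intro v hv
    have k0 : untwistGradient₁ μ (Y s) ⬝ᵥ fderiv ℝ Y s v = 0 := by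
      rw [← hf0]; exact congrFun hv 0
    have k1 : fderiv ℝ Y s v 2 = 0 := by rw [← hf1]; exact congrFun hv 1
    have k2 : untwistGradient₂ μ (Y s) ⬝ᵥ fderiv ℝ Y s v = 0 := by
      rw [fderiv_eq_tangentVector, dotProduct_add, dotProduct_smul, dotProduct_smul, hg s hs,
        hg s hs]
      simp
    have hcs := Real.sin_sq_add_cos_sq (μ * Y s 2)
    rw [dotProduct_fin_three, k1] at k0 k2
    simp only [untwistGradient₁, untwistGradient₂, Matrix.cons_val, mul_zero, add_zero] at k0 k2
    have k3 : fderiv ℝ Y s v = 0 := by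
      funext i
      fin_cases i
      · change fderiv ℝ Y s v 0 = 0
        linear_combination Real.cos (μ * Y s 2) * k0 - Real.sin (μ * Y s 2) * k2 -
          fderiv ℝ Y s v 0 * hcs
      · change fderiv ℝ Y s v 1 = 0
        linear_combination Real.sin (μ * Y s 2) * k0 + Real.cos (μ * Y s 2) * k2 -
          fderiv ℝ Y s v 1 * hcs
      · exact k1
    rw [fderiv_eq_tangentVector] at k3
    have k4 := linearCombination_eq_zero_of_cross_ne_zero (hY.normal_ne_zero s hs) k3
    funext i
    fin_cases i
    · exact k4.1
    · exact k4.2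
  -- An injective endomorphism of `ℝ²` is onto, so `f` carries neighbourhoods of `s` onto
  -- neighbourhoods of `f s`.
  have hsurj : (fderiv ℝ f s).range = ⊤ :=
    LinearMap.range_eq_top.2 (LinearMap.injective_iff_surjective.1 hinj)
  have hmap := hfs.map_nhds_eq_of_surj hsurj
  have hev : ∀ᶠ x in 𝓝 (f s), x 0 ^ 2 * (w 0 * Real.sin (μ * x 1) - w 1 * Real.cos (μ * x 1)) * μ -
      x 0 * (w 2 - μ * b 2) + (Real.sin (μ * x 1) * (w 1 * x 1 + b 0) -
        Real.cos (μ * x 1) * (b 1 - w 0 * x 1)) = 0 := by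
    rw [← hmap, Filter.eventually_map]
    filter_upwards [hY.isOpen.mem_nhds hs] with s' hs'
    have h1 := ht _ _ (hgn s' hs')
    have h2 := untwistGradient₂_dotProduct_killing (w := w) (b := b) (h (e.symm s'))
    exact neg_eq_zero.1 (h2.symm.trans h1)
  obtain ⟨δ, hδ, hball⟩ := Metric.eventually_nhds_iff.1 hev
  obtain ⟨hw0, hw1, hb0, hb1⟩ := screw_of_tangent_helicoid hμ (w := w) (b := b) (ρ₀ := f s 0)
    (z₀ := f s 1) hδ fun ρ z hρ hz => by
      refine hball (y := ![ρ, z]) ((dist_pi_lt_iff hδ).2 fun i => ?_)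
      fin_cases i
      · exact hρ
      · exact hz
  have hacc : crossProduct w (crossProduct w (X (e.symm s)) + b) =
      (-w 2 ^ 2) • ![X (e.symm s) 0, X (e.symm s) 1, 0] := by
    funext i
    simp only [cross_apply, Pi.add_apply, Matrix.cons_val, Pi.smul_apply, smul_eq_mul, hw0, hw1]
    fin_cases i <;> simp only [Fin.zero_eta, Fin.mk_one, Fin.reduceFinMk, Matrix.cons_val, hb0, hb1]
      <;> ring
  intro ν hν
  obtain ⟨c, hc⟩ := hν.exists_eq_smul hX he hs
  obtain ⟨c', hc'⟩ := (hgn s hs).exists_eq_smul hX he hs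
  have hc0 : c' ≠ 0 := by
    intro h0
    rw [h0, zero_smul] at hc'
    have g0 := congrFun hc' 0
    have g1 := congrFun hc' 1
    simp only [untwistGradient₂, Matrix.cons_val, Pi.zero_apply] at g0 g1
    have hcs := Real.sin_sq_add_cos_sq (μ * Y s 2)
    rw [g1, neg_eq_zero.1 g0] at hcs
    norm_num at hcs
  have hrad := (untwistGradient_radial μ (X (e.symm s))).2
  rw [h] at hrad
  have hN : normalVector Y s ⬝ᵥ ![X (e.symm s) 0, X (e.symm s) 1, 0] = 0 := by
    apply mul_left_cancel₀ hc0
    rw [← smul_eq_mul, ← smul_dotProduct, ← hc', mul_zero]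
    exact hrad
  rw [hacc, hc, smul_dotProduct, dotProduct_smul, hN, smul_zero, smul_zero]

/-- The conjugate `Rᵀ [w]ₓ R` of a skew matrix is skew, hence a cross product. This avoids the sign
`det R` in the formula for `w'`. -/
theorem exists_cross_conjugate {R : Matrix (Fin 3) (Fin 3) ℝ}
    (hR : R ∈ Matrix.orthogonalGroup (Fin 3) ℝ) (w : Fin 3 → ℝ) :
    ∃ w', ∀ x, crossProduct w (R *ᵥ x) = R *ᵥ crossProduct w' x := by
  set C := LinearMap.toMatrix' (crossProduct w) with hC
  have hskew : C + Cᵀ = 0 := by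
    ext i j
    fin_cases i <;> fin_cases j <;>
      simp [hC, LinearMap.toMatrix'_apply, cross_apply]
  have hB : (Rᵀ * C * R) + (Rᵀ * C * R)ᵀ = 0 := by
    have : (Rᵀ * C * R) + (Rᵀ * C * R)ᵀ = Rᵀ * (C + Cᵀ) * R := by
      rw [Matrix.transpose_mul, Matrix.transpose_mul, Matrix.transpose_transpose,
        Matrix.mul_add, Matrix.add_mul, ← Matrix.mul_assoc]
    rw [this, hskew, Matrix.mul_zero, Matrix.zero_mul]
  obtain ⟨w', hB'⟩ : ∃ w', ∀ x, (Rᵀ * C * R) *ᵥ x = crossProduct w' x :=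
    ⟨_, skew_mulVec_eq_cross fun i j => congrFun (congrFun hB i) j⟩
  refine ⟨w', fun x => ?_⟩
  rw [← hB',
    ← Matrix.mulVec_mulVec, ← Matrix.mulVec_mulVec, orthogonal_mulVec_transpose hR, hC,
    LinearMap.toMatrix'_mulVec]

/-- After the isometry is undone, the helicoid is the zero set of `untwist₂` with `μ = a / l`;
Killing field and acceleration are carried along. -/
theorem isTangentAcceleration_of_liesOnHelicoid (hX : IsImmersedSurface X)
    (hh : LiesOnHelicoid X) (ht : IsTangentKillingField X w b) (p : M) :
    IsTangentAcceleration X w b p := by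
  obtain ⟨a, l, ha, hl, R, hR, v, hs⟩ := hh
  obtain ⟨w', hw'⟩ := exists_cross_conjugate hR w
  set X' : M → (Fin 3 → ℝ) := fun p => Rᵀ *ᵥ (X p - v) with hX'
  set b' := Rᵀ *ᵥ (crossProduct w v + b) with hb'
  have hV : ∀ p, crossProduct w (X p) + b = R *ᵥ (crossProduct w' (X' p) + b') := by
    intro p
    rw [Matrix.mulVec_add, ← hw', hb', orthogonal_mulVec_transpose hR,
      orthogonal_mulVec_transpose hR, map_sub]
    abel
  have hun : ∀ p, untwist₂ (a / l) (X' p) = 0 := by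
    intro p
    obtain ⟨s, hs⟩ := hs p
    have h1 : X' p = helicoidMap a l s := by
      simp only [hX']
      rw [hs, add_sub_cancel_right, orthogonal_transpose_mulVec hR]
    have h2 : a / l * (l * s 1) = a * s 1 := by field_simp
    rw [h1]
    simp only [untwist₂, helicoidMap, Matrix.cons_val, h2]
    ring
  have hXi : IsImmersedSurface X' := hX.isometry hR v
  have ht' : IsTangentKillingField X' w' b' := by
    intro p ν hν
    have h := ht p _ ((isNormalAt_isometry_iff hX hR v p ν).1 hν)
    rwa [hV, orthogonal_dotProduct hR] at h
  intro ν hν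
  have hν' : IsNormalAt X' p (Rᵀ *ᵥ ν) := by
    rw [hX', isNormalAt_isometry_iff hX hR, orthogonal_mulVec_transpose hR]
    exact hν
  have h := isTangentAcceleration_of_untwist hXi (div_pos ha hl) hun ht' p _ hν'
  rw [hV, hw', ← orthogonal_mulVec_transpose hR ν, orthogonal_dotProduct hR]
  exact h

end Helicoid

/-! ### Classification -/

theorem solvesBlackfoldEquation_iff_liesOn {n : ℕ} (hn : 1 ≤ n) {M : Type*} [TopologicalSpace M]
    [ChartedSpace (Fin 2 → ℝ) M] [IsManifold 𝓘(ℝ, Fin 2 → ℝ) ∞ M] [ConnectedSpace M]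
    {X : M → (Fin 3 → ℝ)} {k : (SpacetimeIndex n → ℝ) → (SpacetimeIndex n → ℝ)} {W : Set M}
    (hX : IsMinimalSurface X) (hk : IsStationaryTypeI n X k) (hne : W.Nonempty)
    (hW : W ⊆ timelikeRegion n X k) :
    SolvesBlackfoldEquation n X k W ↔ LiesOnPlane X ∨ LiesOnHelicoid X := by
  have hX' := hX.isImmersedSurface
  rcases hk.liesOnPlane_or_exists hX' with hp | ⟨w, b, hwb, ht, hkwb⟩
  · exact iff_of_true (solvesBlackfoldEquation_of_liesOnPlane hn hX hW hp) (Or.inl hp)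
  rw [solvesBlackfoldEquation_iff_acceleration hn hX hk ht hkwb hW]
  constructor
  · intro h
    -- A single point of `W` is enough, by the propagation of `isTangentAcceleration_iff`.
    obtain ⟨p₀, hp₀⟩ := hne
    have hall : ∀ p, IsTangentAcceleration X w b p := fun p =>
      (isTangentAcceleration_iff hX ht p₀ p).1 (h p₀ hp₀)
    by_cases hw : w = 0
    · subst hw
      exact Or.inl (liesOnPlane_of_translation hX (hwb rfl) ht)
    · exact liesOnPlane_or_liesOnHelicoid_of_acceleration hX' hw ht hall
  · rintro (hp | hh)
    · rw [← solvesBlackfoldEquation_iff_acceleration hn hX hk ht hkwb hW]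
      exact solvesBlackfoldEquation_of_liesOnPlane hn hX hW hp
    · exact fun p _ => isTangentAcceleration_of_liesOnHelicoid hX' hh ht p

/-! ### Parametrized surfaces -/

section Parametrized

variable {Y : (Fin 2 → ℝ) → Fin 3 → ℝ} {n : ℕ}

theorem mem_atlas_self {e : OpenPartialHomeomorph (Fin 2 → ℝ) (Fin 2 → ℝ)}
    (he : e ∈ atlas (Fin 2 → ℝ) (Fin 2 → ℝ)) : e = OpenPartialHomeomorph.refl _ :=
  chartedSpaceSelf_atlas.1 he

theorem refl_mem_atlas :
    OpenPartialHomeomorph.refl (Fin 2 → ℝ) ∈ atlas (Fin 2 → ℝ) (Fin 2 → ℝ) :=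
  chartedSpaceSelf_atlas.2 rfl

theorem isMinimalSurface_of_contDiff (hY : ContDiff ℝ ∞ Y) (hN : ∀ s, normalVector Y s ≠ 0)
    (hmin : IsMinimalPatch Y Set.univ) : IsMinimalSurface Y := by
  have hp : IsPatch Y Set.univ := ⟨isOpen_univ, hY.contDiffOn, fun s _ => hN s⟩
  refine ⟨hY.contMDiff, fun p => ?_, fun e he s _ ν hν => ?_⟩
  · rw [mfderiv_eq_fderiv]
    change Function.Injective (fderiv ℝ Y p)
    refine (injective_iff_map_eq_zero _).2 fun v hv => ?_
    rw [fderiv_eq_tangentVector] at hv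
    have h := linearCombination_eq_zero_of_cross_ne_zero (hN p) hv
    funext i
    fin_cases i
    · exact h.1
    · exact h.2
  · rw [mem_atlas_self he] at hν ⊢
    change IsNormalVector _ Y s ν at hν
    change meanCurvature _ Y s ν = 0
    have hν' : ∀ a, ν ⬝ᵥ tangentVector Y s a = 0 := fun a => by
      rw [← flatMetric_one]; exact hν a
    obtain ⟨c, hc⟩ : ∃ c : ℝ, ν = c • normalVector Y s :=
      ⟨_, eq_smul_cross_of_dotProduct_eq_zero (hN s) (hν' 0) (hν' 1)⟩
    have hne := hp.normSq_ne_zero (Set.mem_univ s)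
    have h := hmin s (Set.mem_univ s)
    unfold meanCurvature
    rw [Matrix.inv_def, Matrix.adjugate_fin_two, det_inducedMetric, Ring.inverse_eq_inv', hc]
    simp only [Fin.sum_univ_two, Matrix.smul_apply, Matrix.of_apply, Matrix.cons_val,
      inducedMetric, extrinsicCurvature, flatMetric_one, smul_eq_mul, smul_dotProduct,
      secondDerivative_comm hp.isOpen hp.contDiffOn (Set.mem_univ s) 1 0,
      dotProduct_comm (tangentVector Y s 1) (tangentVector Y s 0)]
    simp
    linear_combination (normalVector Y s ⬝ᵥ normalVector Y s)⁻¹ * c * h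

theorem tangentVector_eq_of_hasLineDerivAt {Y : (Fin 2 → ℝ) → Fin 3 → ℝ} {s : Fin 2 → ℝ}
    {a : Fin 2} {T : Fin 3 → ℝ} (hd : DifferentiableAt ℝ Y s)
    (h : HasLineDerivAt ℝ Y T s (Pi.single a 1)) : tangentVector Y s a = T :=
  (hasLineDerivAt_tangentVector hd a).unique h

theorem isKillingField_screwKillingField (n : ℕ) (α β : ℝ) :
    IsKillingField (minkowski n) (screwKillingField n α β) := by
  have hc : ContDiff ℝ ∞ (screwKillingField n α β) := by
    have h : ∀ i, ContDiff ℝ ∞ fun y : SpacetimeIndex n → ℝ => y i := fun i =>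
      contDiff_apply ℝ ℝ i
    rw [contDiff_pi]
    intro i
    rcases i with i | i | i
    · exact contDiff_const
    · fin_cases i
      · exact (contDiff_const.mul (h _)).neg
      · exact contDiff_const.mul (h _)
      · exact contDiff_const
    · exact contDiff_const
  refine ⟨hc, fun x v w => ?_⟩
  have hd : ∀ v, fderiv ℝ (screwKillingField n α β) x v =
      spacetimePoint n 0 ![-(α * v (Sum.inr (Sum.inl 1))), α * v (Sum.inr (Sum.inl 0)), 0] := by
    intro v
    have h1 := (hc.differentiable (by simp) x).hasFDerivAt.hasLineDerivAt v
    refine h1.unique ?_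
    have hl : ∀ i, HasDerivAt (fun t : ℝ => (x + t • v) i) (v i) 0 := by
      intro i
      simpa using ((hasDerivAt_id (0 : ℝ)).mul_const (v i)).const_add (x i)
    unfold HasLineDerivAt
    rw [hasDerivAt_pi]
    intro i
    rcases i with i | i | i
    · exact hasDerivAt_const _ _
    · fin_cases i
      · exact ((hl _).const_mul α).neg
      · exact (hl _).const_mul α
      · exact hasDerivAt_const _ _
    · exact hasDerivAt_const _ _
  rw [hd, hd, flatMetric_comm, flatMetric_spacetimePoint, flatMetric_spacetimePoint,
    dotProduct_fin_three, dotProduct_fin_three]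
  simp [spacePart]
  ring

theorem isStationaryTypeI_of_contDiff {α β : ℝ} (hY : ContDiff ℝ ∞ Y)
    (hN : ∀ s, normalVector Y s ≠ 0) (χ : (Fin 2 → ℝ) → Fin 2 → ℝ)
    (hχ : ∀ s, χ s 0 • tangentVector Y s 0 + χ s 1 • tangentVector Y s 1 =
      ![-(α * Y s 1), α * Y s 0, β]) (hne : ∃ s, χ s ≠ 0) :
    IsStationaryTypeI n Y (screwKillingField n α β) := by
  have hp : IsPatch Y Set.univ := ⟨isOpen_univ, hY.contDiffOn, fun s _ => hN s⟩
  have h : ∀ s τ, PushesForwardTo n Y (screwKillingField n α β) (worldvolumePoint τ s) (χ s) := by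
    intro s τ
    rw [pushesForwardTo_iff hp (Set.mem_univ s), hχ]
    rfl
  refine ⟨isKillingField_screwKillingField n α β, fun e he s _ τ => ?_, ?_⟩
  · rw [mem_atlas_self he]
    exact ⟨χ s, h s τ⟩
  · obtain ⟨s, hs⟩ := hne
    exact ⟨_, refl_mem_atlas, s, Set.mem_univ s, 0, χ s, h s 0, hs⟩

theorem killingModulusSq_screwKillingField (Y : (Fin 2 → ℝ) → Fin 3 → ℝ) (α β τ : ℝ)
    (s : Fin 2 → ℝ) :
    killingModulusSq n Y (screwKillingField n α β) τ s =
      1 - α ^ 2 * (Y s 0 ^ 2 + Y s 1 ^ 2) - β ^ 2 := by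
  unfold killingModulusSq screwKillingField
  rw [flatMetric_spacetimePoint, dotProduct_fin_three]
  simp [spacetimePoint, spacePart]
  ring

theorem timelikeRegion_screwKillingField (Y : (Fin 2 → ℝ) → Fin 3 → ℝ) (α β : ℝ) :
    timelikeRegion n Y (screwKillingField n α β) =
      {s | 0 < 1 - α ^ 2 * (Y s 0 ^ 2 + Y s 1 ^ 2) - β ^ 2} := by
  ext s
  simp only [timelikeRegion, killingModulusSq_screwKillingField, Set.mem_ofPred_eq, forall_const]

/-- The timelike region is where a continuous function is positive, so that function vanishes on the
frontier. -/
theorem satisfiesBoundaryCondition_screwKillingField (hY : Continuous Y) (α β : ℝ) :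
    SatisfiesBoundaryCondition n Y (screwKillingField n α β)
      (timelikeRegion n Y (screwKillingField n α β)) := by
  intro s hs τ
  rw [timelikeRegion_screwKillingField] at hs
  rw [killingModulusSq_screwKillingField]
  have hY' := continuous_pi_iff.1 hY
  have := hY' 0
  have := hY' 1
  exact (frontier_lt_subset_eq continuous_const (by fun_prop) hs).symm

/-- A screw-invariant minimal surface on a plane or helicoid solves the blackfold equation with
its boundary condition. -/
theorem parametrized_solution (hn : 1 ≤ n) {α β : ℝ} (hY : Continuous Y)
    (hmin : IsMinimalSurface Y) (hk : IsStationaryTypeI n Y (screwKillingField n α β))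
    (hlies : LiesOnPlane Y ∨ LiesOnHelicoid Y) (hβ : β ^ 2 < 1)
    (h0 : ∃ s, Y s 0 = 0 ∧ Y s 1 = 0) :
    IsMinimalSurface Y ∧ IsStationaryTypeI n Y (screwKillingField n α β) ∧
      (timelikeRegion n Y (screwKillingField n α β)).Nonempty ∧
      SolvesBlackfoldEquation n Y (screwKillingField n α β)
        (timelikeRegion n Y (screwKillingField n α β)) ∧
      SatisfiesBoundaryCondition n Y (screwKillingField n α β)
        (timelikeRegion n Y (screwKillingField n α β)) := by
  -- On the axis the rotation vanishes and the squared modulus is `1 - β² > 0`.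
  have hne : (timelikeRegion n Y (screwKillingField n α β)).Nonempty := by
    obtain ⟨s, hs0, hs1⟩ := h0
    refine ⟨s, ?_⟩
    rw [timelikeRegion_screwKillingField, Set.mem_ofPred_eq, hs0, hs1]
    linarith
  exact ⟨hmin, hk, hne, (solvesBlackfoldEquation_iff_liesOn hn hmin hk hne subset_rfl).2 hlies,
    satisfiesBoundaryCondition_screwKillingField hY α β⟩

end Parametrized

/-! ### The plane and the helicoid -/

section Examples

theorem hasDerivAt_line (s : Fin 2 → ℝ) (a i : Fin 2) :
    HasDerivAt (fun t : ℝ => (s + t • (Pi.single a 1 : Fin 2 → ℝ)) i)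
      ((Pi.single a 1 : Fin 2 → ℝ) i) 0 := by
  simpa using ((hasDerivAt_id (0 : ℝ)).mul_const ((Pi.single a 1 : Fin 2 → ℝ) i)).const_add (s i)

theorem contDiff_planeMap : ContDiff ℝ ∞ planeMap := by
  rw [contDiff_pi]
  intro i
  fin_cases i
  · exact contDiff_apply ℝ ℝ 0
  · exact contDiff_apply ℝ ℝ 1
  · exact contDiff_const

theorem tangentVector_planeMap (s : Fin 2 → ℝ) (a : Fin 2) :
    tangentVector planeMap s a = planeMap (Pi.single a 1) := by
  refine tangentVector_eq_of_hasLineDerivAt (contDiff_planeMap.differentiable (by simp) s) ?_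
  unfold HasLineDerivAt
  rw [hasDerivAt_pi]
  intro i
  fin_cases i
  · exact hasDerivAt_line s a 0
  · exact hasDerivAt_line s a 1
  · exact hasDerivAt_const _ _

theorem normalVector_planeMap (s : Fin 2 → ℝ) : normalVector planeMap s = ![0, 0, 1] := by
  simp [normalVector, tangentVector_planeMap, planeMap, cross_apply]

theorem isMinimalSurface_planeMap : IsMinimalSurface planeMap := by
  refine isMinimalSurface_of_contDiff contDiff_planeMap (fun s h => ?_) fun s _ => ?_
  · rw [normalVector_planeMap] at h
    simpa using congrFun h 2
  · simp [secondDerivative, tangentVector_planeMap]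

theorem isStationaryTypeI_planeMap (n : ℕ) {Ω : ℝ} (hΩ : Ω ≠ 0) :
    IsStationaryTypeI n planeMap (screwKillingField n Ω 0) := by
  refine isStationaryTypeI_of_contDiff contDiff_planeMap (fun s h => ?_)
    (fun s => ![-(Ω * s 1), Ω * s 0]) (fun s => ?_) ⟨![1, 0], fun h => hΩ ?_⟩
  · rw [normalVector_planeMap] at h
    simpa using congrFun h 2
  · funext i
    fin_cases i <;> simp [tangentVector_planeMap, planeMap]
  · simpa using congrFun h 1

theorem liesOnPlane_planeMap : LiesOnPlane planeMap :=
  ⟨1, one_mem _, 0, fun s => ⟨s, by simp⟩⟩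

variable (a l : ℝ)

theorem contDiff_helicoidMap : ContDiff ℝ ∞ (helicoidMap a l) := by
  have h : ∀ i, ContDiff ℝ ∞ fun s : Fin 2 → ℝ => s i := fun i => contDiff_apply ℝ ℝ i
  rw [contDiff_pi]
  intro i
  fin_cases i
  · exact (h 0).mul (Real.contDiff_cos.comp (contDiff_const.mul (h 1)))
  · exact (h 0).mul (Real.contDiff_sin.comp (contDiff_const.mul (h 1)))
  · exact contDiff_const.mul (h 1)

/-- The tangent vectors of the helicoid. -/
noncomputable def helicoidTangent (s : Fin 2 → ℝ) (c : Fin 2) : Fin 3 → ℝ :=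
  match c with
  | 0 => ![Real.cos (a * s 1), Real.sin (a * s 1), 0]
  | 1 => ![-(a * s 0 * Real.sin (a * s 1)), a * s 0 * Real.cos (a * s 1), l]

theorem tangentVector_helicoidMap (s : Fin 2 → ℝ) (c : Fin 2) :
    tangentVector (helicoidMap a l) s c = helicoidTangent a l s c := by
  refine tangentVector_eq_of_hasLineDerivAt
    ((contDiff_helicoidMap a l).differentiable (by simp) s) ?_
  unfold HasLineDerivAt
  rw [hasDerivAt_pi]
  have h0 := hasDerivAt_line s c 0
  have h1 := (hasDerivAt_line s c 1).const_mul a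
  intro i
  fin_cases i
  · refine (h0.mul h1.cos).congr_deriv ?_
    fin_cases c <;> simp [helicoidTangent]
    ring
  · refine (h0.mul h1.sin).congr_deriv ?_
    fin_cases c <;> simp [helicoidTangent]
    ring
  · refine ((hasDerivAt_line s c 1).const_mul l).congr_deriv ?_
    fin_cases c <;> simp [helicoidTangent]

theorem secondDerivative_helicoidMap (s : Fin 2 → ℝ) :
    secondDerivative (helicoidMap a l) s 0 0 = 0 ∧
      secondDerivative (helicoidMap a l) s 0 1 =
        ![-(a * Real.sin (a * s 1)), a * Real.cos (a * s 1), 0] ∧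
      secondDerivative (helicoidMap a l) s 1 1 =
        ![-(a ^ 2 * s 0 * Real.cos (a * s 1)), -(a ^ 2 * s 0 * Real.sin (a * s 1)), 0] := by
  have hY := (contDiff_helicoidMap a l).contDiffOn (s := Set.univ)
  have key : ∀ c d T, HasLineDerivAt ℝ (fun s => helicoidTangent a l s d) T s (Pi.single c 1) →
      secondDerivative (helicoidMap a l) s c d = T := by
    intro c d T hT
    have h := hasLineDerivAt_secondDerivative isOpen_univ hY (Set.mem_univ s) c d
    simp only [tangentVector_helicoidMap] at h
    exact h.unique hT
  refine ⟨key 0 0 _ ?_, key 0 1 _ ?_, key 1 1 _ ?_⟩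
  · have h1 := (hasDerivAt_line s 0 1).const_mul a
    unfold HasLineDerivAt
    rw [hasDerivAt_pi]
    intro i
    fin_cases i
    · exact h1.cos.congr_deriv (by simp)
    · exact h1.sin.congr_deriv (by simp)
    · exact hasDerivAt_const _ _
  all_goals
    unfold HasLineDerivAt
    rw [hasDerivAt_pi]
    intro i
    fin_cases i
  · exact (((hasDerivAt_line s 0 0).const_mul a).mul
      ((hasDerivAt_line s 0 1).const_mul a).sin).neg.congr_deriv (by simp)
  · exact (((hasDerivAt_line s 0 0).const_mul a).mul
      ((hasDerivAt_line s 0 1).const_mul a).cos).congr_deriv (by simp)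
  · exact hasDerivAt_const _ _
  · exact (((hasDerivAt_line s 1 0).const_mul a).mul
      ((hasDerivAt_line s 1 1).const_mul a).sin).neg.congr_deriv (by simp; ring)
  · exact (((hasDerivAt_line s 1 0).const_mul a).mul
      ((hasDerivAt_line s 1 1).const_mul a).cos).congr_deriv (by simp; ring)
  · exact hasDerivAt_const _ _

theorem normalVector_helicoidMap (s : Fin 2 → ℝ) :
    normalVector (helicoidMap a l) s =
      ![l * Real.sin (a * s 1), -(l * Real.cos (a * s 1)), a * s 0] := by
  have hcs := Real.sin_sq_add_cos_sq (a * s 1)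
  simp only [normalVector, tangentVector_helicoidMap, helicoidTangent, cross_apply,
    Matrix.cons_val]
  funext i
  fin_cases i <;> simp only [Fin.zero_eta, Fin.mk_one, Fin.reduceFinMk, Matrix.cons_val]
  · ring
  · ring
  · linear_combination a * s 0 * hcs

variable {a l}

theorem normalVector_helicoidMap_ne_zero (hl : l ≠ 0) (s : Fin 2 → ℝ) :
    normalVector (helicoidMap a l) s ≠ 0 := by
  intro h
  have hcs := Real.sin_sq_add_cos_sq (a * s 1)
  rw [normalVector_helicoidMap] at h
  have h0 : l * Real.sin (a * s 1) = 0 := congrFun h 0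
  have h1 : -(l * Real.cos (a * s 1)) = 0 := congrFun h 1
  rw [(mul_eq_zero.1 h0).resolve_left hl, (mul_eq_zero.1 (neg_eq_zero.1 h1)).resolve_left hl] at hcs
  norm_num at hcs

theorem isMinimalSurface_helicoidMap (hl : l ≠ 0) : IsMinimalSurface (helicoidMap a l) := by
  refine isMinimalSurface_of_contDiff (contDiff_helicoidMap a l)
    (normalVector_helicoidMap_ne_zero hl) fun s _ => ?_
  obtain ⟨h0, h1, h2⟩ := secondDerivative_helicoidMap a l s
  simp only [h0, h1, h2, tangentVector_helicoidMap, helicoidTangent, normalVector_helicoidMap,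
    dotProduct_fin_three, Matrix.cons_val, Pi.zero_apply]
  ring

theorem isStationaryTypeI_helicoidMap (n : ℕ) (hl : l ≠ 0) {Ω : ℝ} (hΩ : Ω ≠ 0) :
    IsStationaryTypeI n (helicoidMap a l) (screwKillingField n (a * Ω) (l * Ω)) := by
  refine isStationaryTypeI_of_contDiff (contDiff_helicoidMap a l)
    -- The field is `Ω ∂_φ` in the parameters `(ρ, φ)`.
    (normalVector_helicoidMap_ne_zero hl) (fun s => ![0, Ω]) (fun s => ?_)
    ⟨0, fun h => hΩ (by simpa using congrFun h 1)⟩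
  funext i
  fin_cases i <;> simp [tangentVector_helicoidMap, helicoidTangent, helicoidMap] <;> ring

theorem liesOnHelicoid_helicoidMap (ha : 0 < a) (hl : 0 < l) : LiesOnHelicoid (helicoidMap a l) :=
  ⟨a, l, ha, hl, 1, one_mem _, 0, fun s => ⟨s, by simp⟩⟩

end Examples

end Blackfold

theorem mainTheorem1 (n : ℕ) (hn : 1 ≤ n) :
    -- a stationary minimal surface of Type I solves the equation iff it is a plane or a helicoid
    (∀ (M : Type*) [TopologicalSpace M] [ChartedSpace (Fin 2 → ℝ) M]
      [IsManifold 𝓘(ℝ, Fin 2 → ℝ) ∞ M] [ConnectedSpace M] (X : M → (Fin 3 → ℝ))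
      (k : (SpacetimeIndex n → ℝ) → (SpacetimeIndex n → ℝ)) (W : Set M),
      IsMinimalSurface X → IsStationaryTypeI n X k →
      IsOpen W → W.Nonempty → W ⊆ timelikeRegion n X k →
        (SolvesBlackfoldEquation n X k W ↔ LiesOnPlane X ∨ LiesOnHelicoid X)) ∧
    -- the rotating plane
    (∀ Ω : ℝ, Ω ≠ 0 →
      IsMinimalSurface planeMap ∧
      IsStationaryTypeI n planeMap (screwKillingField n Ω 0) ∧
      (timelikeRegion n planeMap (screwKillingField n Ω 0)).Nonempty ∧
      SolvesBlackfoldEquation n planeMap (screwKillingField n Ω 0)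
        (timelikeRegion n planeMap (screwKillingField n Ω 0)) ∧
      SatisfiesBoundaryCondition n planeMap (screwKillingField n Ω 0)
        (timelikeRegion n planeMap (screwKillingField n Ω 0))) ∧
    -- the rotating and boosted helicoid
    (∀ a l Ω : ℝ, 0 < a → 0 < l → Ω ≠ 0 → Ω ^ 2 * l ^ 2 < 1 →
      IsMinimalSurface (helicoidMap a l) ∧
      IsStationaryTypeI n (helicoidMap a l) (screwKillingField n (a * Ω) (l * Ω)) ∧
      (timelikeRegion n (helicoidMap a l) (screwKillingField n (a * Ω) (l * Ω))).Nonempty ∧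
      SolvesBlackfoldEquation n (helicoidMap a l) (screwKillingField n (a * Ω) (l * Ω))
        (timelikeRegion n (helicoidMap a l) (screwKillingField n (a * Ω) (l * Ω))) ∧
      SatisfiesBoundaryCondition n (helicoidMap a l) (screwKillingField n (a * Ω) (l * Ω))
        (timelikeRegion n (helicoidMap a l) (screwKillingField n (a * Ω) (l * Ω)))) := by
  exact ⟨fun M _ _ _ _ X k W hX hk _ hne hW =>
      Blackfold.solvesBlackfoldEquation_iff_liesOn hn hX hk hne hW,
    fun Ω hΩ => Blackfold.parametrized_solution hn Blackfold.contDiff_planeMap.continuous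
      Blackfold.isMinimalSurface_planeMap (Blackfold.isStationaryTypeI_planeMap n hΩ)
      (Or.inl Blackfold.liesOnPlane_planeMap) (by norm_num) ⟨0, rfl, rfl⟩,
    fun a l Ω ha hl hΩ h => Blackfold.parametrized_solution hn
      (Blackfold.contDiff_helicoidMap a l).continuous
      (Blackfold.isMinimalSurface_helicoidMap hl.ne')
      (Blackfold.isStationaryTypeI_helicoidMap n hl.ne' hΩ)
      (Or.inr (Blackfold.liesOnHelicoid_helicoidMap ha hl)) (by linarith [mul_pow l Ω 2])
      ⟨0, by simp [helicoidMap], by simp [helicoidMap]⟩⟩
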